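/- Let $\Bbbk$ be a field, $n\ge 2$, and $\xi\in\Bbbk$ a primitive $n$-th root of unity. Let $H=L(n,\xi)$ (the Liu Hopf algebra) be the $\Bbbk$-algebra generated by $x,g,g^{-1}$ with relations $gg^{-1}=g^{-1}g=1$, $xg=\xi gx$, $x^n=1-g^n$; it is a Hopf algebra with $\Delta(g)=g\otimes g$, $\Delta(x)=x\otimes 1+g\otimes x$, $\varepsilon(g)=1$, $\varepsilon(x)=0$, $S(g)=g^{-1}$, $S(x)=-g^{-1}x$. Let $L$ be the $\Bbbk$-algebra generated by $y,g,g^{-1}$ with relations $gg^{-1}=g^{-1}g=1$, $yg=\xi gy$, $y^n=0$; it is a Hopf algebra with $\Delta(g)=g\otimes g$, $\Delta(y)=y\otimes 1+g\otimes y$, $\varepsilon(g)=1$, $\varepsilon(y)=0$, $S(g)=g^{-1}$, $S(y)=-g^{-1}y$. Let $B=\Bbbk\langle g,g^{-1},t\rangle/(gg^{-1}-1,\;g^{-1}g-1,\;tg-\xi gt,\;t^n+g^n)$, with the algebra maps $\rho:B\to B\otimes H$, $\rho(g)=g\otimes g$, $\rho(t)=t\otimes 1+g\otimes x$, and $\delta:B\to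 L\otimes B$, $\delta(g)=g\otimes g$, $\delta(t)=g\otimes t+y\otimes 1$. Then: 1. The antipodes of $H$ and $L$ are bijective. 2. There is a linear bijection $\gamma:H\to B$ with $\gamma(g^ix^j)=g^it^j$ for $i\in\mathbb Z$, $0\le j\le n-1$; it is right $H$-colinear and convolution invertible with inverse $\gamma\circ S$ (so $B$ is $H$-cleft). 3. $B$ is an $L$-$H$-biGalois extension of $\Bbbk$: $\rho$ and $\delta$ make $B$ a right $H$-comodule algebra and a left $L$-comodule algebra and commute, the coinvariants on either side are $\Bbbk$, and the canonical maps $B\otimes B\to B\otimes H$, $b'\otimes b\mapsto (b'\otimes 1)\rho(b)$, and $B\otimes B\to L\otimes B$, $b\otimes b'\mapsto\delta(b)(1\otimes b')$, are bijective. 4. $L$ and $H$ are monoidally Morita–Takeuchi equivalent: their categories of right comodules are equivalent as $\Bbbk$-linear monoidal categories. 5. The left and right global dimensions of $H$ are $1$, and the left and right global dimensions of $L$ are infinite. 6. $H$ and $L$ are (left and right) noetherian, finitely generated, PI algebras, and there is a natural number $d$ such that $H$ and $L$ both have left and right injective dimension $d$ as modules over themselves. In particular it is not true that any two monoidally Morita–Takeuchi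 equivalent Hopf algebras over $\Bbbk$ with bijective antipodes have the same (left) global dimension. -/

import Mathlib

universe u
open scoped TensorProduct

/-- Gaussian binomial coefficients evaluated at `q`. -/
def gaussBinom {k : Type u} [CommRing k] (q : k) : ℕ → ℕ → k
  | _, 0 => 1
  | 0, _ + 1 => 0
  | m + 1, j + 1 => gaussBinom q m j + q ^ (j + 1) * gaussBinom q m (j + 1)

theorem gaussBinom_mul {k : Type u} [CommRing k] (q : k) (m : ℕ) : ∀ j : ℕ,
    (q ^ (j + 1) - 1) * gaussBinom q (m + 1) (j + 1) = (q ^ (m + 1) - 1) * gaussBinom q m j := by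
  induction m with
  | zero =>
    intro j
    cases j with
    | zero => simp [gaussBinom]
    | succ j => simp [gaussBinom]
  | succ m ih =>
    intro j
    cases j with
    | zero =>
      have h := ih 0
      rw [gaussBinom]
      simp only [gaussBinom] at h ⊢
      linear_combination q * h
    | succ j =>
      have h1 := ih j
      have h2 := ih (j + 1)
      have e : gaussBinom q (m + 1) (j + 1)
          = gaussBinom q m j + q ^ (j + 1) * gaussBinom q m (j + 1) := by rw [gaussBinom]
      have e2 : gaussBinom q (m + 1 + 1) (j + 1 + 1)
          = gaussBinom q (m + 1) (j + 1) + q ^ (j + 1 + 1) * gaussBinom q (m + 1) (j + 1 + 1) := by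
        rw [gaussBinom]
      rw [e2]
      linear_combination q ^ (j + 1 + 1) * h2 + q * h1 - q * (q ^ (m + 1) - 1) * e

theorem gaussBinom_eq_zero_of_lt {k : Type u} [CommRing k] (q : k) (m : ℕ) : ∀ j : ℕ, m < j →
    gaussBinom q m j = 0 := by
  induction m with
  | zero => intro j hj; cases j with
    | zero => omega
    | succ j => rw [gaussBinom]
  | succ m ih => intro j hj; cases j with
    | zero => omega
    | succ j => rw [gaussBinom, ih j (by omega), ih (j + 1) (by omega)]; simp

theorem gaussBinom_self {k : Type u} [CommRing k] (q : k) (m : ℕ) : gaussBinom q m m = 1 := by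
  induction m with
  | zero => rw [gaussBinom]
  | succ m ih => rw [gaussBinom, ih, gaussBinom_eq_zero_of_lt q m (m + 1) (by omega)]; simp

theorem gaussBinom_primitive {k : Type u} [Field k] {q : k} {n : ℕ} (hq : IsPrimitiveRoot q n)
    {j : ℕ} (h0 : 0 < j) (hj : j < n) : gaussBinom q n j = 0 := by
  obtain ⟨j, rfl⟩ : ∃ i, j = i + 1 := ⟨j - 1, by omega⟩
  obtain ⟨m, rfl⟩ : ∃ i, n = i + 1 := ⟨n - 1, by omega⟩
  have h := gaussBinom_mul q m j
  rw [hq.pow_eq_one, sub_self, zero_mul] at h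
  rcases mul_eq_zero.1 h with h | h
  · exact absurd (sub_eq_zero.1 h) (hq.pow_ne_one_of_pos_of_lt (by omega) hj)
  · exact h

theorem qcomm_pow {k R : Type u} [Field k] [Ring R] [Algebra k R] {q : k} {a b : R}
    (h : a * b = q • (b * a)) (j : ℕ) : a * b ^ j = q ^ j • (b ^ j * a) := by
  induction j with
  | zero => simp
  | succ j ih =>
    rw [pow_succ, ← mul_assoc, ih, smul_mul_assoc, mul_assoc, h, mul_smul_comm, smul_smul,
      ← mul_assoc, pow_succ]

theorem qbinomial {k R : Type u} [Field k] [Ring R] [Algebra k R] {q : k} {a b : R}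
    (h : a * b = q • (b * a)) (m : ℕ) :
    (a + b) ^ m = ∑ j ∈ Finset.range (m + 1), gaussBinom q m j • (b ^ j * a ^ (m - j)) := by
  induction m with
  | zero => simp [gaussBinom]
  | succ m ih =>
    have e1 : a * (a + b) ^ m = ∑ j ∈ Finset.range (m + 1),
        (q ^ j * gaussBinom q m j) • (b ^ j * a ^ (m + 1 - j)) := by
      rw [ih, Finset.mul_sum]
      refine Finset.sum_congr rfl fun j hj => ?_
      have : m + 1 - j = (m - j) + 1 := by have := Finset.mem_range.1 hj; omega
      rw [mul_smul_comm, ← mul_assoc, qcomm_pow h, smul_mul_assoc, smul_smul, mul_assoc,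
        ← pow_succ', this, mul_comm]
    have e2 : b * (a + b) ^ m = ∑ j ∈ Finset.range (m + 1),
        gaussBinom q m j • (b ^ (j + 1) * a ^ (m + 1 - (j + 1))) := by
      rw [ih, Finset.mul_sum]
      refine Finset.sum_congr rfl fun j hj => ?_
      rw [mul_smul_comm, ← mul_assoc, ← pow_succ', Nat.add_sub_add_right]
    rw [pow_succ', add_mul, e1, e2, Finset.sum_range_succ' _ (m + 1)]
    simp only [gaussBinom, add_smul, Finset.sum_add_distrib]
    rw [Finset.sum_range_succ' (fun j => (q ^ j * gaussBinom q m j) • (b ^ j * a ^ (m + 1 - j))),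
      Finset.sum_range_succ (fun j => (q ^ (j + 1) * gaussBinom q m (j + 1)) •
        (b ^ (j + 1) * a ^ (m + 1 - (j + 1))))]
    rw [gaussBinom_eq_zero_of_lt q m (m + 1) (by omega)]
    have g0 : gaussBinom q m 0 = 1 := by cases m <;> rw [gaussBinom]
    simp [g0]
    abel

theorem add_pow_of_qcomm {k R : Type u} [Field k] [Ring R] [Algebra k R] {q : k} {n : ℕ}
    (hn : 2 ≤ n) (hq : IsPrimitiveRoot q n) {a b : R} (h : a * b = q • (b * a)) :
    (a + b) ^ n = a ^ n + b ^ n := by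
  have g0 : gaussBinom q n 0 = 1 := by cases n <;> rw [gaussBinom]
  rw [qbinomial h n, Finset.sum_range_succ, gaussBinom_self]
  obtain ⟨m, rfl⟩ : ∃ i, n = i + 1 := ⟨n - 1, by omega⟩
  rw [Finset.sum_range_succ', Finset.sum_eq_zero, g0]
  · simp
  · intro j hj
    rw [gaussBinom_primitive hq (by omega) (by have := Finset.mem_range.1 hj; omega), zero_smul]

theorem mul_pow_of_qcomm {k R : Type u} [Field k] [Ring R] [Algebra k R] {q : k} {a b : R}
    (h : a * b = q • (b * a)) (m : ℕ) : (b * a) ^ m = q ^ (m * (m - 1) / 2) • (b ^ m * a ^ m) := by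
  induction m with
  | zero => simp
  | succ m ih =>
    have : (m + 1) * (m + 1 - 1) / 2 = m + m * (m - 1) / 2 := by
      rw [← Finset.sum_range_id_mul_two, ← Finset.sum_range_id_mul_two] 
      simp [Finset.sum_range_succ, add_comm]
    rw [pow_succ', ih, this, mul_smul_comm, mul_assoc, ← mul_assoc a, qcomm_pow h, smul_mul_assoc,
      mul_smul_comm, smul_smul, pow_succ', pow_succ' a, pow_add, mul_assoc, mul_assoc, mul_comm (q ^ m)]

theorem neg_one_pow_mul_primitive {k : Type u} [Field k] {q : k} {n : ℕ}
    (hn : 2 ≤ n) (hq : IsPrimitiveRoot q n) : (-1) ^ n * q ^ (n * (n - 1) / 2) = -1 := by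
  rcases Nat.even_or_odd' n with ⟨m, rfl | rfl⟩
  · have h2 : q ^ m = -1 := (hq.pow (by omega) (mul_comm 2 m)).eq_neg_one_of_two_right
    have : 2 * m * (2 * m - 1) / 2 = m * (2 * m - 1) := by
      rw [mul_assoc, Nat.mul_div_cancel_left _ (by norm_num)]
    have ho : Odd (2 * m - 1) := ⟨m - 1, by omega⟩
    rw [this, pow_mul q, h2, pow_mul, ho.neg_one_pow]
    simp
  · have : (2 * m + 1) * (2 * m + 1 - 1) / 2 = (2 * m + 1) * m := by
      rw [Nat.add_sub_cancel, mul_left_comm, Nat.mul_div_cancel_left _ (by norm_num)]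
    rw [this, pow_mul, hq.pow_eq_one, Odd.neg_one_pow ⟨m, rfl⟩]
    simp

/-! ### The algebras -/

/-- Names of the generators `g`, `g⁻¹`, `x`. -/
inductive LiuGen : Type
  | g | ginv | x

/-- The relations `g g⁻¹ = 1`, `g⁻¹ g = 1`, `x g = ξ g x`, `xⁿ = a - b gⁿ`. -/
inductive LiuRel {k : Type u} [Field k] (n : ℕ) (ξ a b : k) :
    FreeAlgebra k LiuGen → FreeAlgebra k LiuGen → Prop
  | mul_inv : LiuRel n ξ a b (FreeAlgebra.ι k LiuGen.g * FreeAlgebra.ι k LiuGen.ginv) 1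
  | inv_mul : LiuRel n ξ a b (FreeAlgebra.ι k LiuGen.ginv * FreeAlgebra.ι k LiuGen.g) 1
  | comm : LiuRel n ξ a b (FreeAlgebra.ι k LiuGen.x * FreeAlgebra.ι k LiuGen.g)
      (ξ • (FreeAlgebra.ι k LiuGen.g * FreeAlgebra.ι k LiuGen.x))
  | pow : LiuRel n ξ a b (FreeAlgebra.ι k LiuGen.x ^ n)
      (algebraMap k _ a - b • FreeAlgebra.ι k LiuGen.g ^ n)

/-- The `k`-algebra `k⟨g, g⁻¹, x⟩ / (g g⁻¹ - 1, g⁻¹ g - 1, x g - ξ g x, xⁿ - (a - b gⁿ))`. -/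
def LiuAlg {k : Type u} [Field k] (n : ℕ) (ξ a b : k) : Type u :=
  RingQuot (LiuRel n ξ a b)

namespace LiuAlg

noncomputable section

variable {k : Type u} [Field k] {n : ℕ} {ξ : k}

instance (a b : k) : Ring (LiuAlg n ξ a b) := inferInstanceAs (Ring (RingQuot (LiuRel n ξ a b)))

instance (a b : k) : Algebra k (LiuAlg n ξ a b) :=
  inferInstanceAs (Algebra k (RingQuot (LiuRel n ξ a b)))

/-- The quotient map from the free algebra. -/
def mk (a b : k) : FreeAlgebra k LiuGen →ₐ[k] LiuAlg n ξ a b :=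
  RingQuot.mkAlgHom k (LiuRel n ξ a b)

theorem mk_surjective (a b : k) : Function.Surjective (mk a b : _ →ₐ[k] LiuAlg n ξ a b) :=
  RingQuot.mkAlgHom_surjective k (LiuRel n ξ a b)

theorem mk_rel {a b : k} {u v : FreeAlgebra k LiuGen} (h : LiuRel n ξ a b u v) :
    (mk a b u : LiuAlg n ξ a b) = mk a b v :=
  RingQuot.mkAlgHom_rel k h

variable (n ξ) in
/-- The generator `g`, as a unit. -/
def g (a b : k) : (LiuAlg n ξ a b)ˣ where
  val := mk a b (FreeAlgebra.ι k LiuGen.g)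
  inv := mk a b (FreeAlgebra.ι k LiuGen.ginv)
  val_inv := by rw [← map_mul, mk_rel LiuRel.mul_inv, map_one]
  inv_val := by rw [← map_mul, mk_rel LiuRel.inv_mul, map_one]

variable (n ξ) in
/-- The generator `x` (called `t` or `y` in two of the special cases). -/
def x (a b : k) : LiuAlg n ξ a b := mk a b (FreeAlgebra.ι k LiuGen.x)

theorem x_mul_g (a b : k) : x n ξ a b * (g n ξ a b : LiuAlg n ξ a b)
    = ξ • ((g n ξ a b : LiuAlg n ξ a b) * x n ξ a b) := by
  have := mk_rel (LiuRel.comm (n := n) (ξ := ξ) (a := a) (b := b))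
  rw [map_mul, map_smul, map_mul] at this
  exact this

theorem x_pow (a b : k) : x n ξ a b ^ n
    = algebraMap k _ a - b • (g n ξ a b : LiuAlg n ξ a b) ^ n := by
  have := mk_rel (LiuRel.pow (n := n) (ξ := ξ) (a := a) (b := b))
  rw [map_pow, map_sub, map_smul, map_pow, AlgHom.commutes] at this
  exact this

variable {R : Type u} [Ring R] [Algebra k R]

/-- The algebra map out of `LiuAlg n ξ a b` determined by the images of the generators. -/
def lift {a b : k} (G : Rˣ) (X : R) (h1 : X * (G : R) = ξ • ((G : R) * X))
    (h2 : X ^ n = algebraMap k R a - b • (G : R) ^ n) : LiuAlg n ξ a b →ₐ[k] R :=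
  RingQuot.liftAlgHom k ⟨FreeAlgebra.lift k
    (fun i => match i with
      | LiuGen.g => (G : R)
      | LiuGen.ginv => ((G⁻¹ : Rˣ) : R)
      | LiuGen.x => X), by
    rintro _ _ (_ | _ | _ | _)
    · simp
    · simp
    · simpa using h1
    · simpa using h2⟩

section
variable {a b : k} (G : Rˣ) (X : R) (h1 : X * (G : R) = ξ • ((G : R) * X))
    (h2 : X ^ n = algebraMap k R a - b • (G : R) ^ n)

theorem lift_mk (u : FreeAlgebra k LiuGen) : lift G X h1 h2 (mk a b u) =
    FreeAlgebra.lift k (fun i => match i with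
      | LiuGen.g => (G : R)
      | LiuGen.ginv => ((G⁻¹ : Rˣ) : R)
      | LiuGen.x => X) u :=
  RingQuot.liftAlgHom_mkAlgHom_apply k _ _ _

@[simp] theorem lift_g : lift G X h1 h2 (g n ξ a b : LiuAlg n ξ a b) = G :=
  (lift_mk G X h1 h2 _).trans (FreeAlgebra.lift_ι_apply _ _)

@[simp] theorem lift_g_inv :
    lift G X h1 h2 ((g n ξ a b)⁻¹ : (LiuAlg n ξ a b)ˣ) = ((G⁻¹ : Rˣ) : R) :=
  (lift_mk G X h1 h2 _).trans (FreeAlgebra.lift_ι_apply _ _)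

@[simp] theorem lift_x : lift G X h1 h2 (x n ξ a b) = X :=
  (lift_mk G X h1 h2 _).trans (FreeAlgebra.lift_ι_apply _ _)
end

/-- Induction on elements of `LiuAlg n ξ a b`. -/
theorem induction {a b : k} {P : LiuAlg n ξ a b → Prop} (hk : ∀ r, P (algebraMap k _ r))
    (hg : P (g n ξ a b : LiuAlg n ξ a b)) (hgi : P ((g n ξ a b)⁻¹ : (LiuAlg n ξ a b)ˣ))
    (hx : P (x n ξ a b)) (hm : ∀ u v, P u → P v → P (u * v)) (ha : ∀ u v, P u → P v → P (u + v))
    (u : LiuAlg n ξ a b) : P u := by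
  obtain ⟨w, rfl⟩ := mk_surjective a b u
  refine FreeAlgebra.induction k LiuGen (motive := fun w => P (mk a b w)) ?_ ?_ ?_ ?_ w
  · intro r; rw [AlgHom.commutes]; exact hk r
  · rintro (_ | _ | _)
    exacts [hg, hgi, hx]
  · intro u v hu hv; rw [map_mul]; exact hm _ _ hu hv
  · intro u v hu hv; rw [map_add]; exact ha _ _ hu hv

theorem algHom_ext {S : Type u} [Ring S] [Algebra k S] {a b : k} {φ ψ : LiuAlg n ξ a b →ₐ[k] S}
    (hg : φ (g n ξ a b : LiuAlg n ξ a b) = ψ (g n ξ a b : LiuAlg n ξ a b))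
    (hx : φ (x n ξ a b) = ψ (x n ξ a b)) : φ = ψ := by
  ext u
  refine induction (P := fun u => φ u = ψ u) ?_ hg ?_ hx ?_ ?_ u
  · intro r; simp
  · have : Units.map (φ : LiuAlg n ξ a b →* S) (g n ξ a b)
        = Units.map (ψ : LiuAlg n ξ a b →* S) (g n ξ a b) := Units.ext hg
    have := congrArg (fun w : Sˣ => ((w⁻¹ : Sˣ) : S)) this
    simpa [← map_inv] using this
  · intro u v hu hv; rw [map_mul, map_mul, hu, hv]
  · intro u v hu hv; rw [map_add, map_add, hu, hv]

/-! ### Comultiplication, coactions, counit, antipode -/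

/-- The tensor product of two units. -/
def tmulUnit {S : Type u} [Ring S] [Algebra k S] (G : Rˣ) (G' : Sˣ) : (R ⊗[k] S)ˣ where
  val := (G : R) ⊗ₜ (G' : S)
  inv := ((G⁻¹ : Rˣ) : R) ⊗ₜ ((G'⁻¹ : Sˣ) : S)
  val_inv := by simp [Algebra.TensorProduct.tmul_mul_tmul, Algebra.TensorProduct.one_def]
  inv_val := by simp [Algebra.TensorProduct.tmul_mul_tmul, Algebra.TensorProduct.one_def]

variable [hn : Fact (2 ≤ n)]

/-- The counit `g ↦ 1`, `x ↦ 0`. -/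
def eps (a : k) : LiuAlg n ξ a a →ₐ[k] k :=
  lift 1 0 (by simp) (by
    have : n ≠ 0 := by have := hn.out; omega
    simp [this])

@[simp] theorem eps_g (a : k) : eps a (g n ξ a a : LiuAlg n ξ a a) = 1 := lift_g _ _ _ _
@[simp] theorem eps_g_inv (a : k) :
    eps a (((g n ξ a a)⁻¹ : (LiuAlg n ξ a a)ˣ) : LiuAlg n ξ a a) = 1 := by
  refine (lift_g_inv _ _ _ _).trans ?_
  simp
@[simp] theorem eps_x (a : k) : eps a (x n ξ a a) = 0 := lift_x _ _ _ _

variable [hξ : Fact (IsPrimitiveRoot ξ n)]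

/-- The algebra map `LiuAlg n ξ a c → LiuAlg n ξ a b ⊗ LiuAlg n ξ b c` with `g ↦ g ⊗ g` and
`x ↦ x ⊗ 1 + g ⊗ x`. For `a = b = c` it is the comultiplication; it also gives the coactions. -/
def cop (a b c : k) : LiuAlg n ξ a c →ₐ[k] LiuAlg n ξ a b ⊗[k] LiuAlg n ξ b c :=
  lift (tmulUnit (g n ξ a b) (g n ξ b c))
    (x n ξ a b ⊗ₜ 1 + (g n ξ a b : LiuAlg n ξ a b) ⊗ₜ x n ξ b c)
    (by
      simp only [tmulUnit, add_mul, mul_add, Algebra.TensorProduct.tmul_mul_tmul, one_mul, mul_one,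
        x_mul_g, smul_add, TensorProduct.smul_tmul', TensorProduct.tmul_smul])
    (by
      rw [add_pow_of_qcomm hn.out hξ.out (by
        simp only [Algebra.TensorProduct.tmul_mul_tmul, one_mul, mul_one, x_mul_g,
          TensorProduct.smul_tmul'])]
      simp only [tmulUnit, Algebra.TensorProduct.tmul_pow, x_pow, one_pow, TensorProduct.sub_tmul,
        TensorProduct.tmul_sub, TensorProduct.tmul_smul, Algebra.algebraMap_eq_smul_one,
        ← TensorProduct.smul_tmul', Algebra.TensorProduct.one_def]
      abel)

@[simp] theorem cop_g (a b c : k) : cop a b c (g n ξ a c : LiuAlg n ξ a c)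
    = (g n ξ a b : LiuAlg n ξ a b) ⊗ₜ (g n ξ b c : LiuAlg n ξ b c) := lift_g _ _ _ _

@[simp] theorem cop_g_inv (a b c : k) : cop a b c ((g n ξ a c)⁻¹ : (LiuAlg n ξ a c)ˣ)
    = (((g n ξ a b)⁻¹ : (LiuAlg n ξ a b)ˣ) : LiuAlg n ξ a b) ⊗ₜ
      (((g n ξ b c)⁻¹ : (LiuAlg n ξ b c)ˣ) : LiuAlg n ξ b c) := lift_g_inv _ _ _ _

@[simp] theorem cop_x (a b c : k) : cop a b c (x n ξ a c)
    = x n ξ a b ⊗ₜ 1 + (g n ξ a b : LiuAlg n ξ a b) ⊗ₜ x n ξ b c := lift_x _ _ _ _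

theorem x_mul_g_inv (a b : k) : x n ξ a b * (((g n ξ a b)⁻¹ : (LiuAlg n ξ a b)ˣ) : LiuAlg n ξ a b)
    = ξ⁻¹ • ((((g n ξ a b)⁻¹ : (LiuAlg n ξ a b)ˣ) : LiuAlg n ξ a b) * x n ξ a b) := by
  have h0 : ξ ≠ 0 := hξ.out.ne_zero (by have := hn.out; omega)
  have h := x_mul_g (n := n) (ξ := ξ) a b
  generalize g n ξ a b = G at h ⊢
  rw [eq_inv_smul_iff₀ h0]
  calc ξ • (x n ξ a b * ((G⁻¹ : (LiuAlg n ξ a b)ˣ) : LiuAlg n ξ a b))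
      = ((G⁻¹ : (LiuAlg n ξ a b)ˣ) : LiuAlg n ξ a b) * (ξ • ((G : LiuAlg n ξ a b) * x n ξ a b))
          * ((G⁻¹ : (LiuAlg n ξ a b)ˣ) : LiuAlg n ξ a b) := by
        rw [mul_smul_comm, Units.inv_mul_cancel_left, smul_mul_assoc]
    _ = _ := by rw [← h, mul_assoc, Units.mul_inv_cancel_right]

/-- The anti-algebra map `LiuAlg n ξ a b → LiuAlg n ξ b a` with `g ↦ g⁻¹` and `x ↦ -g⁻¹ x`.
For `a = b` it is the antipode. -/
def antiHom (a b : k) : LiuAlg n ξ a b →ₐ[k] (LiuAlg n ξ b a)ᵐᵒᵖ :=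
  lift (Units.opEquiv.symm (MulOpposite.op (g n ξ b a)⁻¹))
    (MulOpposite.op
      (-((((g n ξ b a)⁻¹ : (LiuAlg n ξ b a)ˣ) : LiuAlg n ξ b a) * x n ξ b a)))
    (by
      have h0 : ξ ≠ 0 := hξ.out.ne_zero (by have := hn.out; omega)
      rw [Units.coe_opEquiv_symm]
      simp only [MulOpposite.unop_op, ← MulOpposite.op_mul, ← MulOpposite.op_smul]
      congr 1
      rw [neg_mul, mul_assoc, x_mul_g_inv, mul_smul_comm, smul_neg, smul_smul, mul_inv_cancel₀ h0,
        one_smul, mul_neg])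
    (by
      have h0 : ξ ≠ 0 := hξ.out.ne_zero (by have := hn.out; omega)
      rw [Units.coe_opEquiv_symm, MulOpposite.algebraMap_apply]
      simp only [MulOpposite.unop_op, ← MulOpposite.op_pow, ← MulOpposite.op_smul,
        ← MulOpposite.op_sub]
      congr 1
      have hs : (-1 : k) ^ n * ξ⁻¹ ^ (n * (n - 1) / 2) = -1 :=
        neg_one_pow_mul_primitive hn.out hξ.out.inv
      have hg : (((g n ξ b a)⁻¹ : (LiuAlg n ξ b a)ˣ) : LiuAlg n ξ b a) ^ n
          * (g n ξ b a : LiuAlg n ξ b a) ^ n = 1 := by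
        rw [← Units.val_pow_eq_pow_val, ← Units.val_pow_eq_pow_val, ← Units.val_mul, inv_pow,
          inv_mul_cancel, Units.val_one]
      rw [← neg_one_smul k, smul_pow, mul_pow_of_qcomm (x_mul_g_inv b a), smul_smul, hs, x_pow,
        mul_sub, mul_smul_comm, hg, Algebra.algebraMap_eq_smul_one, Algebra.algebraMap_eq_smul_one,
        mul_smul_comm, mul_one, neg_one_smul, neg_sub])

/-- The antipode, as a linear map. -/
def anti (a b : k) : LiuAlg n ξ a b →ₗ[k] LiuAlg n ξ b a :=
  (MulOpposite.opLinearEquiv k).symm.toLinearMap ∘ₗ (antiHom a b).toLinearMap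

theorem anti_apply (a b : k) (u : LiuAlg n ξ a b) :
    anti a b u = MulOpposite.unop (antiHom a b u) := rfl

@[simp] theorem anti_g (a b : k) : anti a b (g n ξ a b : LiuAlg n ξ a b)
    = (((g n ξ b a)⁻¹ : (LiuAlg n ξ b a)ˣ) : LiuAlg n ξ b a) := by
  rw [anti_apply, antiHom, lift_g, Units.coe_opEquiv_symm]; rfl

@[simp] theorem anti_g_inv (a b : k) : anti a b ((g n ξ a b)⁻¹ : (LiuAlg n ξ a b)ˣ)
    = (g n ξ b a : LiuAlg n ξ b a) := by
  rw [anti_apply, antiHom, lift_g_inv, ← map_inv, Units.coe_opEquiv_symm]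
  simp

@[simp] theorem anti_x (a b : k) : anti a b (x n ξ a b)
    = -((((g n ξ b a)⁻¹ : (LiuAlg n ξ b a)ˣ) : LiuAlg n ξ b a) * x n ξ b a) := by
  rw [anti_apply, antiHom, lift_x]; rfl

@[simp] theorem anti_one (a b : k) : anti a b (1 : LiuAlg n ξ a b) = 1 := by
  rw [anti_apply, map_one]; rfl

theorem anti_mul (a b : k) (u v : LiuAlg n ξ a b) :
    anti a b (u * v) = anti a b v * anti a b u := by
  rw [anti_apply, map_mul]; rfl

theorem mul_anti_left (a : k) (u v : LiuAlg n ξ a a ⊗[k] LiuAlg n ξ a a) (r : k)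
    (h : LinearMap.mul' k _ ((anti a a).rTensor _ u) = algebraMap k (LiuAlg n ξ a a) r) :
    LinearMap.mul' k _ ((anti a a).rTensor _ (u * v))
      = r • LinearMap.mul' k _ ((anti a a).rTensor _ v) := by
  induction v with
  | zero => simp
  | add v w hv hw => rw [mul_add, map_add, map_add, hv, hw, map_add, map_add, smul_add]
  | tmul b c =>
    have key : ∀ u : LiuAlg n ξ a a ⊗[k] LiuAlg n ξ a a,
        LinearMap.mul' k _ ((anti a a).rTensor _ (u * (b ⊗ₜ c)))
          = anti a a b * LinearMap.mul' k _ ((anti a a).rTensor _ u) * c := by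
      intro u
      induction u with
      | zero => simp
      | add u w hu hw => rw [add_mul, map_add, map_add, hu, hw, map_add, map_add, mul_add, add_mul]
      | tmul d e =>
        simp [Algebra.TensorProduct.tmul_mul_tmul, anti_mul, mul_assoc]
    rw [key, h, Algebra.algebraMap_eq_smul_one]
    simp

theorem mul_anti_right (a : k) (u v : LiuAlg n ξ a a ⊗[k] LiuAlg n ξ a a) (r : k)
    (h : LinearMap.mul' k _ ((anti a a).lTensor _ v) = algebraMap k (LiuAlg n ξ a a) r) :
    LinearMap.mul' k _ ((anti a a).lTensor _ (u * v))
      = r • LinearMap.mul' k _ ((anti a a).lTensor _ u) := by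
  induction u with
  | zero => simp
  | add u w hv hw => rw [add_mul, map_add, map_add, hv, hw, map_add, map_add, smul_add]
  | tmul b c =>
    have key : ∀ v : LiuAlg n ξ a a ⊗[k] LiuAlg n ξ a a,
        LinearMap.mul' k _ ((anti a a).lTensor _ ((b ⊗ₜ c) * v))
          = b * LinearMap.mul' k _ ((anti a a).lTensor _ v) * anti a a c := by
      intro u
      induction u with
      | zero => simp
      | add u w hu hw => rw [mul_add, map_add, map_add, hu, hw, map_add, map_add, mul_add, add_mul]
      | tmul d e =>
        simp [Algebra.TensorProduct.tmul_mul_tmul, anti_mul, mul_assoc]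
    rw [key, h, Algebra.algebraMap_eq_smul_one]
    simp

theorem anti_rTensor_cop (a : k) (u : LiuAlg n ξ a a) :
    LinearMap.mul' k _ ((anti a a).rTensor _ (cop a a a u)) = algebraMap k _ (eps a u) := by
  induction u using induction with
  | hk r => simp [Algebra.algebraMap_eq_smul_one, Algebra.TensorProduct.one_def]
  | hg => simp
  | hgi => simp
  | hx => simp
  | hm u v hu hv =>
    rw [map_mul, mul_anti_left a _ _ _ hu, hv, map_mul, map_mul, Algebra.smul_def]
  | ha u v hu hv => simp only [map_add, hu, hv]

theorem anti_lTensor_cop (a : k) (u : LiuAlg n ξ a a) :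
    LinearMap.mul' k _ ((anti a a).lTensor _ (cop a a a u)) = algebraMap k _ (eps a u) := by
  induction u using induction with
  | hk r => simp [Algebra.algebraMap_eq_smul_one, Algebra.TensorProduct.one_def]
  | hg => simp
  | hgi => simp
  | hx => simp
  | hm u v hu hv =>
    rw [map_mul, mul_anti_right a _ _ _ hv, hu, map_mul, map_mul, Algebra.smul_def,
      Algebra.commutes]
  | ha u v hu hv => simp only [map_add, hu, hv]

/-- The Hopf algebra structure on `LiuAlg n ξ a a`. -/
instance instHopfAlgebra (a : k) : HopfAlgebra k (LiuAlg n ξ a a) where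
  __ := Bialgebra.ofAlgHom (cop a a a) (eps a)
    (algHom_ext (by simp) (by
      simp [TensorProduct.add_tmul, TensorProduct.tmul_add, Algebra.TensorProduct.one_def, add_assoc]))
    (algHom_ext (by simp) (by simp))
    (algHom_ext (by simp) (by simp))
  antipode := anti a a
  mul_antipode_rTensor_comul := LinearMap.ext fun u => anti_rTensor_cop a u
  mul_antipode_lTensor_comul := LinearMap.ext fun u => anti_lTensor_cop a u

end
end LiuAlg

/-! ### Right comodules and their monoidal category -/

section Comod
open CategoryTheory

variable (k : Type u) [Field k]

noncomputable section

/-- The linear map `(M ⊗ A) ⊗ (N ⊗ A) → (M ⊗ N) ⊗ A`,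
`(m ⊗ a) ⊗ (n ⊗ b) ↦ (m ⊗ n) ⊗ a b`, for an algebra `A`. -/
def tensorMulMap (A M N : Type u) [Ring A] [Algebra k A] [AddCommGroup M] [Module k M]
    [AddCommGroup N] [Module k N] : (M ⊗[k] A) ⊗[k] (N ⊗[k] A) →ₗ[k] (M ⊗[k] N) ⊗[k] A :=
  (LinearMap.mul' k A).lTensor (M ⊗[k] N) ∘ₗ
    (TensorProduct.tensorTensorTensorComm k M A N A).toLinearMap

@[simp] theorem tensorMulMap_tmul (A M N : Type u) [Ring A] [Algebra k A] [AddCommGroup M]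
    [Module k M] [AddCommGroup N] [Module k N] (m : M) (a : A) (n : N) (b : A) :
    tensorMulMap k A M N ((m ⊗ₜ a) ⊗ₜ (n ⊗ₜ b)) = (m ⊗ₜ n) ⊗ₜ (a * b) := by
  simp [tensorMulMap]

/-- A right comodule over the `k`-coalgebra `H`. -/
structure RightComod (H : Type u) [Ring H] [Bialgebra k H] where
  /-- The underlying vector space. -/
  carrier : Type u
  [addCommGroup : AddCommGroup carrier]
  [module : Module k carrier]
  /-- The coaction `m ↦ ∑ m₀ ⊗ m₁`. -/
  coact : carrier →ₗ[k] carrier ⊗[k] H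
  coassoc : (TensorProduct.assoc k carrier H H).toLinearMap ∘ₗ coact.rTensor H ∘ₗ coact =
    (Coalgebra.comul (R := k) (A := H)).lTensor carrier ∘ₗ coact
  counit : (TensorProduct.rid k carrier).toLinearMap ∘ₗ
    (Coalgebra.counit (R := k) (A := H)).lTensor carrier ∘ₗ coact = LinearMap.id

attribute [instance] RightComod.addCommGroup RightComod.module

namespace RightComod

variable {k} {H : Type u} [Ring H] [Bialgebra k H]

/-- Colinear maps, as a subspace of the space of all linear maps. -/
def colinear (M N : RightComod k H) : Submodule k (M.carrier →ₗ[k] N.carrier) where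
  carrier := {f | N.coact ∘ₗ f = f.rTensor H ∘ₗ M.coact}
  add_mem' {f f'} hf hf' := by
    simp only [Set.mem_ofPred_eq] at hf hf' ⊢
    rw [LinearMap.comp_add, hf, hf', LinearMap.rTensor_add, LinearMap.add_comp]
  zero_mem' := by simp
  smul_mem' c f hf := by
    simp only [Set.mem_ofPred_eq] at hf ⊢
    rw [LinearMap.comp_smul, hf, LinearMap.rTensor_smul, LinearMap.smul_comp]

theorem mem_colinear {M N : RightComod k H} {f : M.carrier →ₗ[k] N.carrier} :
    f ∈ colinear M N ↔ ∀ m, N.coact (f m) = f.rTensor H (M.coact m) :=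
  ⟨fun h m => LinearMap.congr_fun h m, fun h => LinearMap.ext h⟩

/-- The category of right `H`-comodules and colinear maps. -/
instance : Category (RightComod k H) where
  Hom M N := colinear M N
  id M := ⟨LinearMap.id, by simp [mem_colinear]⟩
  comp f f' := ⟨f'.1 ∘ₗ f.1, mem_colinear.2 fun m => by
    rw [LinearMap.rTensor_comp, LinearMap.comp_apply, LinearMap.comp_apply,
      mem_colinear.1 f'.2, mem_colinear.1 f.2]⟩

/-- The linear map underlying a morphism of comodules. -/
def Hom.lin {M N : RightComod k H} (f : M ⟶ N) : M.carrier →ₗ[k] N.carrier := Subtype.val f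

/-- A colinear map as a morphism. -/
def ofLin {M N : RightComod k H} (f : M.carrier →ₗ[k] N.carrier)
    (h : ∀ m, N.coact (f m) = f.rTensor H (M.coact m)) : M ⟶ N :=
  Subtype.mk f (mem_colinear.2 h)

@[simp] theorem lin_ofLin {M N : RightComod k H} (f : M.carrier →ₗ[k] N.carrier)
    (h : ∀ m, N.coact (f m) = f.rTensor H (M.coact m)) : Hom.lin (ofLin f h) = f := rfl
@[simp] theorem lin_id (M : RightComod k H) : Hom.lin (𝟙 M) = LinearMap.id := rfl
@[simp] theorem lin_comp {M N P : RightComod k H} (f : M ⟶ N) (f' : N ⟶ P) :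
    Hom.lin (f ≫ f') = Hom.lin f' ∘ₗ Hom.lin f := rfl

theorem Hom.coact_lin {M N : RightComod k H} (f : M ⟶ N) (m : M.carrier) :
    N.coact (Hom.lin f m) = (Hom.lin f).rTensor H (M.coact m) := mem_colinear.1 (Subtype.prop f) m

theorem hom_ext {M N : RightComod k H} {f f' : M ⟶ N} (h : Hom.lin f = Hom.lin f') : f = f' :=
  Subtype.ext h

instance : Preadditive (RightComod k H) where
  homGroup M N := inferInstanceAs (AddCommGroup (colinear M N))
  add_comp _ _ _ _ _ _ := hom_ext (LinearMap.comp_add _ _ _)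
  comp_add _ _ _ _ _ _ := hom_ext (LinearMap.add_comp _ _ _)

instance : Linear k (RightComod k H) where
  homModule M N := inferInstanceAs (Module k (colinear M N))
  smul_comp _ _ _ _ _ _ := hom_ext (LinearMap.comp_smul _ _ _)
  comp_smul _ _ _ _ _ _ := hom_ext (LinearMap.smul_comp _ _ _)

variable (k H) in
/-- The functor forgetting the coaction. -/
def forget : RightComod k H ⥤ ModuleCat.{u} k where
  obj M := ModuleCat.of k M.carrier
  map f := ModuleCat.ofHom (Hom.lin f)

instance : (forget k H).Faithful where
  map_injective h := hom_ext (congrArg ModuleCat.Hom.hom h)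

theorem coassoc_apply (M : RightComod k H) (m : M.carrier) :
    TensorProduct.assoc k M.carrier H H (M.coact.rTensor H (M.coact m)) =
      (Coalgebra.comul (R := k) (A := H)).lTensor M.carrier (M.coact m) :=
  LinearMap.congr_fun M.coassoc m

theorem counit_apply (M : RightComod k H) (m : M.carrier) :
    TensorProduct.rid k M.carrier
      ((Coalgebra.counit (R := k) (A := H)).lTensor M.carrier (M.coact m)) = m :=
  LinearMap.congr_fun M.counit m

/-- The coaction `m ⊗ n ↦ ∑ (m₀ ⊗ n₀) ⊗ m₁ n₁` on a tensor product. -/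
def tensorCoact (M N : RightComod k H) :
    M.carrier ⊗[k] N.carrier →ₗ[k] (M.carrier ⊗[k] N.carrier) ⊗[k] H :=
  tensorMulMap k H M.carrier N.carrier ∘ₗ TensorProduct.map M.coact N.coact

theorem tensorCoact_tmul (M N : RightComod k H) (m : M.carrier) (n : N.carrier) :
    tensorCoact M N (m ⊗ₜ n) = tensorMulMap k H M.carrier N.carrier (M.coact m ⊗ₜ N.coact n) := rfl

theorem comul_tensorMulMap (M N : Type u) [AddCommGroup M] [Module k M]
    [AddCommGroup N] [Module k N] (u : M ⊗[k] H) (v : N ⊗[k] H) :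
    (Coalgebra.comul (R := k) (A := H)).lTensor (M ⊗[k] N) (tensorMulMap k H M N (u ⊗ₜ v)) =
      tensorMulMap k (H ⊗[k] H) M N ((Coalgebra.comul (R := k) (A := H)).lTensor M u ⊗ₜ
        (Coalgebra.comul (R := k) (A := H)).lTensor N v) := by
  induction u with
  | zero => simp
  | add u w hu hw => simp only [TensorProduct.add_tmul, map_add, hu, hw]
  | tmul m h =>
    induction v with
    | zero => simp
    | add u w hu hw => simp only [TensorProduct.tmul_add, map_add, hu, hw]
    | tmul n h' => simp

theorem assoc_tensorMulMap (M N : Type u) [AddCommGroup M] [Module k M]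
    [AddCommGroup N] [Module k N] (u : M ⊗[k] H) (v : N ⊗[k] H) (h h' : H) :
    TensorProduct.assoc k (M ⊗[k] N) H H (tensorMulMap k H M N (u ⊗ₜ v) ⊗ₜ (h * h')) =
      tensorMulMap k (H ⊗[k] H) M N
        (TensorProduct.assoc k M H H (u ⊗ₜ h) ⊗ₜ TensorProduct.assoc k N H H (v ⊗ₜ h')) := by
  induction u with
  | zero => simp
  | add u w hu hw => simp only [TensorProduct.add_tmul, map_add, hu, hw]
  | tmul m h =>
    induction v with
    | zero => simp
    | add u w hu hw => simp only [TensorProduct.add_tmul, TensorProduct.tmul_add, map_add, hu, hw]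
    | tmul n h' => simp

theorem assoc_tensorCoact (M N : RightComod k H) (u : M.carrier ⊗[k] H) (v : N.carrier ⊗[k] H) :
    TensorProduct.assoc k (M.carrier ⊗[k] N.carrier) H H
      ((tensorCoact M N).rTensor H (tensorMulMap k H _ _ (u ⊗ₜ v))) =
      tensorMulMap k (H ⊗[k] H) M.carrier N.carrier
        (TensorProduct.assoc k M.carrier H H (M.coact.rTensor H u) ⊗ₜ
          TensorProduct.assoc k N.carrier H H (N.coact.rTensor H v)) := by
  induction u with
  | zero => simp
  | add u w hu hw => simp only [TensorProduct.add_tmul, map_add, hu, hw]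
  | tmul m h =>
    induction v with
    | zero => simp
    | add u w hu hw => simp only [TensorProduct.tmul_add, map_add, hu, hw]
    | tmul n h' =>
      rw [tensorMulMap_tmul, LinearMap.rTensor_tmul, tensorCoact_tmul, assoc_tensorMulMap]
      simp

theorem counit_tensorMulMap (M N : Type u) [AddCommGroup M] [Module k M]
    [AddCommGroup N] [Module k N] (u : M ⊗[k] H) (v : N ⊗[k] H) :
    TensorProduct.rid k (M ⊗[k] N) ((Coalgebra.counit (R := k) (A := H)).lTensor (M ⊗[k] N)
      (tensorMulMap k H M N (u ⊗ₜ v))) =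
      TensorProduct.rid k M ((Coalgebra.counit (R := k) (A := H)).lTensor M u) ⊗ₜ
        TensorProduct.rid k N ((Coalgebra.counit (R := k) (A := H)).lTensor N v) := by
  induction u with
  | zero => simp
  | add u w hu hw => simp only [TensorProduct.add_tmul, map_add, hu, hw]
  | tmul m h =>
    induction v with
    | zero => simp
    | add u w hu hw => simp only [TensorProduct.tmul_add, map_add, hu, hw]
    | tmul n h' => 
      simp [← TensorProduct.smul_tmul', TensorProduct.tmul_smul, smul_smul, mul_comm]

theorem tensorCoact_map {M M' N N' : RightComod k H} (f : M ⟶ M') (f' : N ⟶ N') :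
    tensorCoact M' N' ∘ₗ TensorProduct.map (Hom.lin f) (Hom.lin f') =
      (TensorProduct.map (Hom.lin f) (Hom.lin f')).rTensor H ∘ₗ tensorCoact M N := by
  have key : ∀ (u : M.carrier ⊗[k] H) (v : N.carrier ⊗[k] H),
      tensorMulMap k H _ _ ((Hom.lin f).rTensor H u ⊗ₜ (Hom.lin f').rTensor H v) =
        (TensorProduct.map (Hom.lin f) (Hom.lin f')).rTensor H
          (tensorMulMap k H _ _ (u ⊗ₜ v)) := by
    intro u v
    induction u with
    | zero => simp
    | add u w hu hw => simp only [TensorProduct.add_tmul, map_add, hu, hw]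
    | tmul m h =>
      induction v with
      | zero => simp
      | add u w hu hw => simp only [TensorProduct.tmul_add, map_add, hu, hw]
      | tmul n h' => simp
  refine TensorProduct.ext' fun m n => ?_
  rw [LinearMap.comp_apply, LinearMap.comp_apply, TensorProduct.map_tmul, tensorCoact_tmul,
    Hom.coact_lin, Hom.coact_lin, key, tensorCoact_tmul]

theorem tensorMulMap_assoc (M N P : Type u) [AddCommGroup M] [Module k M] [AddCommGroup N]
    [Module k N] [AddCommGroup P] [Module k P]
    (u : M ⊗[k] H) (v : N ⊗[k] H) (w : P ⊗[k] H) :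
    tensorMulMap k H M (N ⊗[k] P) (u ⊗ₜ tensorMulMap k H N P (v ⊗ₜ w)) =
      (TensorProduct.assoc k M N P).toLinearMap.rTensor H
        (tensorMulMap k H (M ⊗[k] N) P (tensorMulMap k H M N (u ⊗ₜ v) ⊗ₜ w)) := by
  induction u with
  | zero => simp
  | add u w hu hw => simp only [TensorProduct.add_tmul, map_add, hu, hw]
  | tmul m h =>
    induction v with
    | zero => simp
    | add u w hu hw =>
      simp only [TensorProduct.add_tmul, TensorProduct.tmul_add, map_add, hu, hw]
    | tmul n h' =>
      induction w with
      | zero => simp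
      | add u w hu hw => simp only [TensorProduct.tmul_add, map_add, hu, hw]
      | tmul n h' => simp [mul_assoc]

theorem tensorMulMap_one_left (M : Type u) [AddCommGroup M] [Module k M] (r : k)
    (u : M ⊗[k] H) : (TensorProduct.lid k M).toLinearMap.rTensor H
      (tensorMulMap k H k M ((r ⊗ₜ (1 : H)) ⊗ₜ u)) = r • u := by
  induction u with
  | zero => simp
  | add u w hu hw => simp only [TensorProduct.tmul_add, map_add, smul_add, hu, hw]
  | tmul n h' => simp [TensorProduct.smul_tmul']

theorem tensorMulMap_one_right (M : Type u) [AddCommGroup M] [Module k M] (r : k)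
    (u : M ⊗[k] H) : (TensorProduct.rid k M).toLinearMap.rTensor H
      (tensorMulMap k H M k (u ⊗ₜ (r ⊗ₜ (1 : H)))) = r • u := by
  induction u with
  | zero => simp
  | add u w hu hw => simp only [TensorProduct.add_tmul, map_add, smul_add, hu, hw]
  | tmul n h' => simp [TensorProduct.smul_tmul']

/-- The tensor product of right comodules. -/
def tensor (M N : RightComod k H) : RightComod k H where
  carrier := M.carrier ⊗[k] N.carrier
  coact := tensorCoact M N
  coassoc := by
    refine TensorProduct.ext' fun m n => ?_
    simp only [LinearMap.comp_apply, LinearEquiv.coe_coe]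
    rw [tensorCoact_tmul, assoc_tensorCoact, coassoc_apply, coassoc_apply, comul_tensorMulMap]
  counit := by
    refine TensorProduct.ext' fun m n => ?_
    simp only [LinearMap.comp_apply, LinearEquiv.coe_coe]
    rw [tensorCoact_tmul, counit_tensorMulMap, counit_apply, counit_apply]
    rfl

variable (k H) in
/-- The trivial comodule `k`, with coaction `c ↦ c ⊗ 1`. -/
def unit : RightComod k H where
  carrier := k
  coact := (TensorProduct.mk k k H).flip 1
  coassoc := by ext; simp [Algebra.TensorProduct.one_def]
  counit := by ext; simp

/-- The tensor product of colinear maps. -/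
def tensorMap {M M' N N' : RightComod k H} (f : M ⟶ M') (f' : N ⟶ N') :
    tensor M N ⟶ tensor M' N' :=
  ofLin (M := tensor M N) (N := tensor M' N') (TensorProduct.map (Hom.lin f) (Hom.lin f'))
    (LinearMap.congr_fun (tensorCoact_map f f'))

theorem tensorCoact_assoc (M N P : RightComod k H) :
    tensorCoact M (tensor N P) ∘ₗ
        (TensorProduct.assoc k M.carrier N.carrier P.carrier).toLinearMap =
      (TensorProduct.assoc k M.carrier N.carrier P.carrier).toLinearMap.rTensor H ∘ₗ
        tensorCoact (tensor M N) P :=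
  TensorProduct.ext_threefold fun m n p =>
    tensorMulMap_assoc _ _ _ (M.coact m) (N.coact n) (P.coact p)

theorem tensorCoact_lid (M : RightComod k H) :
    M.coact ∘ₗ (TensorProduct.lid k M.carrier).toLinearMap =
      (TensorProduct.lid k M.carrier).toLinearMap.rTensor H ∘ₗ tensorCoact (unit k H) M :=
  TensorProduct.ext' fun (r : k) m =>
    (map_smul M.coact r m).trans (tensorMulMap_one_left _ r (M.coact m)).symm

theorem tensorCoact_rid (M : RightComod k H) :
    M.coact ∘ₗ (TensorProduct.rid k M.carrier).toLinearMap =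
      (TensorProduct.rid k M.carrier).toLinearMap.rTensor H ∘ₗ tensorCoact M (unit k H) :=
  TensorProduct.ext' fun m (r : k) =>
    (map_smul M.coact r m).trans (tensorMulMap_one_right _ r (M.coact m)).symm

/-- An isomorphism of comodules from a colinear linear equivalence. -/
def isoOfEquiv {M N : RightComod k H} (e : M.carrier ≃ₗ[k] N.carrier)
    (h : ∀ m, N.coact (e m) = e.toLinearMap.rTensor H (M.coact m)) : M ≅ N where
  hom := ofLin e.toLinearMap h
  inv := ofLin e.symm.toLinearMap fun n => by
    obtain ⟨m, rfl⟩ := e.surjective n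
    rw [h, ← LinearMap.comp_apply (LinearMap.rTensor H _), ← LinearMap.rTensor_comp]
    simp
  hom_inv_id := hom_ext (by ext; simp)
  inv_hom_id := hom_ext (by ext; simp)

instance : MonoidalCategoryStruct (RightComod k H) where
  tensorObj := tensor
  whiskerLeft M _ _ f := tensorMap (𝟙 M) f
  whiskerRight f N := tensorMap f (𝟙 N)
  tensorHom f f' := tensorMap f f'
  tensorUnit := unit k H
  associator M N P := isoOfEquiv (M := tensor (tensor M N) P) (N := tensor M (tensor N P))
    (TensorProduct.assoc k M.carrier N.carrier P.carrier)
    (LinearMap.congr_fun (tensorCoact_assoc M N P))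
  leftUnitor M := isoOfEquiv (M := tensor (unit k H) M) (N := M) (TensorProduct.lid k M.carrier)
    (LinearMap.congr_fun (tensorCoact_lid M))
  rightUnitor M := isoOfEquiv (M := tensor M (unit k H)) (N := M) (TensorProduct.rid k M.carrier)
    (LinearMap.congr_fun (tensorCoact_rid M))

/-- The forgetful functor preserves the tensor operations on the nose. -/
def inducingFunctorData : Monoidal.InducingFunctorData (forget k H) where
  μIso _ _ := Iso.refl _
  whiskerLeft_eq _ _ _ _ := by ext; rfl
  whiskerRight_eq _ _ := by ext; rfl
  tensorHom_eq _ _ := by ext; rfl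
  εIso := Iso.refl _
  associator_eq X Y Z := ModuleCat.hom_ext <| TensorProduct.ext <| TensorProduct.ext <| by ext; rfl
  leftUnitor_eq X := ModuleCat.hom_ext <| TensorProduct.ext <| by ext; rfl
  rightUnitor_eq X := ModuleCat.hom_ext <| TensorProduct.ext <| by ext; rfl

/-- The monoidal category of right `H`-comodules. -/
instance : MonoidalCategory (RightComod k H) := Monoidal.induced (forget k H) inducingFunctorData

end RightComod

/-- `H` and `L` are monoidally Morita-Takeuchi equivalent: their categories of right comodules are
equivalent as `k`-linear monoidal categories. -/
def MonoidallyMoritaTakeuchiEquivalent (H L : Type u) [Ring H] [HopfAlgebra k H]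
    [Ring L] [HopfAlgebra k L] : Prop :=
  ∃ e : RightComod k H ≌ RightComod k L,
    Nonempty e.functor.Monoidal ∧ e.functor.Additive ∧ e.functor.Linear k

end
end Comod

/-! ### Galois and biGalois extensions of the base field -/

section Galois

variable (k : Type u) [Field k] {L B H : Type u} [Ring L] [HopfAlgebra k L] [Ring B] [Algebra k B]
  [Ring H] [HopfAlgebra k H]

noncomputable section

/-- `ρ` makes the algebra `B` a right `H`-comodule algebra. -/
structure IsRightComoduleAlgebra (ρ : B →ₐ[k] B ⊗[k] H) : Prop where
  coassoc : (TensorProduct.assoc k B H H).toLinearMap ∘ₗ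
      ρ.toLinearMap.rTensor H ∘ₗ ρ.toLinearMap =
    (Coalgebra.comul (R := k) (A := H)).lTensor B ∘ₗ ρ.toLinearMap
  counit : (TensorProduct.rid k B).toLinearMap ∘ₗ
    (Coalgebra.counit (R := k) (A := H)).lTensor B ∘ₗ ρ.toLinearMap = LinearMap.id

/-- `δ` makes the algebra `B` a left `L`-comodule algebra. -/
structure IsLeftComoduleAlgebra (δ : B →ₐ[k] L ⊗[k] B) : Prop where
  coassoc : (TensorProduct.assoc k L L B).toLinearMap ∘ₗ
      (Coalgebra.comul (R := k) (A := L)).rTensor B ∘ₗ δ.toLinearMap =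
    δ.toLinearMap.lTensor L ∘ₗ δ.toLinearMap
  counit : (TensorProduct.lid k B).toLinearMap ∘ₗ
    (Coalgebra.counit (R := k) (A := L)).rTensor B ∘ₗ δ.toLinearMap = LinearMap.id

/-- The canonical map `B ⊗ B → B ⊗ H`, `b' ⊗ b ↦ (b' ⊗ 1) ρ(b)`. -/
def rightCanonicalMap (ρ : B →ₐ[k] B ⊗[k] H) : B ⊗[k] B →ₗ[k] B ⊗[k] H :=
  TensorProduct.lift ((LinearMap.mul k (B ⊗[k] H)).compl₁₂
    (Algebra.TensorProduct.includeLeft : B →ₐ[k] B ⊗[k] H).toLinearMap ρ.toLinearMap)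

/-- The canonical map `B ⊗ B → L ⊗ B`, `b ⊗ b' ↦ δ(b) (1 ⊗ b')`. -/
def leftCanonicalMap (δ : B →ₐ[k] L ⊗[k] B) : B ⊗[k] B →ₗ[k] L ⊗[k] B :=
  TensorProduct.lift ((LinearMap.mul k (L ⊗[k] B)).compl₁₂
    δ.toLinearMap (Algebra.TensorProduct.includeRight : B →ₐ[k] L ⊗[k] B).toLinearMap)

/-- `B` is a right `H`-Galois extension of `k`: the coinvariants are the scalars `k ⊆ B`,
and the canonical map is bijective. -/
structure IsRightGaloisExtension (ρ : B →ₐ[k] B ⊗[k] H) : Prop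
    extends IsRightComoduleAlgebra k ρ where
  injective_algebraMap : Function.Injective (algebraMap k B)
  coinvariants : {b : B | ρ b = b ⊗ₜ 1} = Set.range (algebraMap k B)
  bijective : Function.Bijective (rightCanonicalMap k ρ)

/-- `B` is a left `L`-Galois extension of `k`. -/
structure IsLeftGaloisExtension (δ : B →ₐ[k] L ⊗[k] B) : Prop
    extends IsLeftComoduleAlgebra k δ where
  injective_algebraMap : Function.Injective (algebraMap k B)
  coinvariants : {b : B | δ b = 1 ⊗ₜ b} = Set.range (algebraMap k B)
  bijective : Function.Bijective (leftCanonicalMap k δ)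

/-- `B` is an `L`-`H`-biGalois extension of `k`: left `L`-Galois, right `H`-Galois, and the two
coactions commute. -/
structure IsBiGaloisExtension (δ : B →ₐ[k] L ⊗[k] B) (ρ : B →ₐ[k] B ⊗[k] H) : Prop where
  left : IsLeftGaloisExtension k δ
  right : IsRightGaloisExtension k ρ
  bicomodule : (TensorProduct.assoc k L B H).toLinearMap ∘ₗ
      δ.toLinearMap.rTensor H ∘ₗ ρ.toLinearMap =
    ρ.toLinearMap.lTensor L ∘ₗ δ.toLinearMap

/-- The convolution product `h ↦ ∑ φ(h₁) ψ(h₂)` of linear maps from `H` to `B`. -/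
def convolution (φ ψ : H →ₗ[k] B) : H →ₗ[k] B :=
  LinearMap.mul' k B ∘ₗ TensorProduct.map φ ψ ∘ₗ Coalgebra.comul (R := k) (A := H)

/-- `γ` is a convolution invertible right `H`-colinear map `H → B` with convolution inverse `γ'`;
its existence says that `B` is `H`-cleft. -/
structure IsCleaving (ρ : B →ₐ[k] B ⊗[k] H) (γ γ' : H →ₗ[k] B) : Prop where
  colinear : ρ.toLinearMap ∘ₗ γ = γ.rTensor H ∘ₗ Coalgebra.comul (R := k) (A := H)
  mul_inv : convolution k γ γ' = Algebra.linearMap k B ∘ₗ Coalgebra.counit (R := k) (A := H)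
  inv_mul : convolution k γ' γ = Algebra.linearMap k B ∘ₗ Coalgebra.counit (R := k) (A := H)

end
end Galois

/-! ### Homological dimensions and polynomial identities -/

section Dim
open CategoryTheory

noncomputable section

/-- The left global dimension of a ring: the supremum of the projective dimensions of its left
modules. -/
def leftGlobalDim (R : Type u) [Ring R] : WithBot ℕ∞ :=
  ⨆ M : ModuleCat.{u} R, projectiveDimension M

/-- The right global dimension: right `R`-modules are left modules over the opposite ring. -/
def rightGlobalDim (R : Type u) [Ring R] : WithBot ℕ∞ := leftGlobalDim Rᵐᵒᵖ

/-- The injective dimension of the left regular module. -/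
def leftInjDim (R : Type u) [Ring R] : WithBot ℕ∞ := injectiveDimension (ModuleCat.of R R)

/-- The injective dimension of the right regular module. -/
def rightInjDim (R : Type u) [Ring R] : WithBot ℕ∞ := leftInjDim Rᵐᵒᵖ

/-- `R` is a PI algebra: some nonzero noncommutative polynomial vanishes on `R`. -/
def IsPIAlgebra (k R : Type u) [Field k] [Ring R] [Algebra k R] : Prop :=
  ∃ f : FreeAlgebra k ℕ, f ≠ 0 ∧ ∀ v : ℕ → R, FreeAlgebra.lift k v f = 0

end
end Dim

/-! ### The three algebras of the example -/

section Example

variable {k : Type u} [Field k] (n : ℕ) (ξ : k)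

/-- The Liu algebra `H = L(n, ξ)`: generators `x, g, g⁻¹`, with `x g = ξ g x`, `xⁿ = 1 - gⁿ`. -/
abbrev LiuH : Type u := LiuAlg n ξ 1 1

/-- The algebra `L`: generators `y, g, g⁻¹`, with `y g = ξ g y`, `yⁿ = 0`. -/
abbrev LiuL : Type u := LiuAlg n ξ 0 0

/-- The algebra `B`: generators `t, g, g⁻¹`, with `t g = ξ g t`, `tⁿ = -gⁿ`. -/
abbrev LiuB : Type u := LiuAlg n ξ 0 1

namespace LiuH
/-- The generator `g` of `H`, as a unit. -/
noncomputable abbrev g : (LiuH n ξ)ˣ := LiuAlg.g n ξ 1 1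
/-- The generator `x` of `H`. -/
noncomputable abbrev x : LiuH n ξ := LiuAlg.x n ξ 1 1
end LiuH

namespace LiuL
/-- The generator `g` of `L`, as a unit. -/
noncomputable abbrev g : (LiuL n ξ)ˣ := LiuAlg.g n ξ 0 0
/-- The generator `y` of `L`. -/
noncomputable abbrev y : LiuL n ξ := LiuAlg.x n ξ 0 0
end LiuL

namespace LiuB
/-- The generator `g` of `B`, as a unit. -/
noncomputable abbrev g : (LiuB n ξ)ˣ := LiuAlg.g n ξ 0 1
/-- The generator `t` of `B`. -/
noncomputable abbrev t : LiuB n ξ := LiuAlg.x n ξ 0 1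

variable [Fact (2 ≤ n)] [Fact (IsPrimitiveRoot ξ n)]

/-- The right coaction `ρ : B → B ⊗ H`, `g ↦ g ⊗ g`, `t ↦ t ⊗ 1 + g ⊗ x`. -/
noncomputable abbrev ρ : LiuB n ξ →ₐ[k] LiuB n ξ ⊗[k] LiuH n ξ := LiuAlg.cop 0 1 1

/-- The left coaction `δ : B → L ⊗ B`, `g ↦ g ⊗ g`, `t ↦ g ⊗ t + y ⊗ 1`. -/
noncomputable abbrev δ : LiuB n ξ →ₐ[k] LiuL n ξ ⊗[k] LiuB n ξ := LiuAlg.cop 0 0 1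

end LiuB

end Example

/-! The three algebras belong to one family. Write A(a,b) for `LiuAlg n ξ a b`, where x^n = a - b
g^n. Then H = A(1,1), L = A(0,0) and B = A(0,1). The inner Gaussian binomials vanish at a primitive
n-th root of unity, so the formulas for Δ and S define maps A(a,c) → A(a,b) ⊗ A(b,c) and A(a,b) →
A(b,a) for all parameters (a cogroupoid). Mixed coassociativity, counit and antipode laws hold
because they hold on generators. The biGalois property is formal from them: the inverse canonical
maps are given by the mixed antipode.

Each A(a,b) has the basis g^i x^j with i an integer and 0 ≤ j < n (`basis`). On these monomials the
q-binomial formula `cop_monomial` never needs the relation for x^n, so a, b and c do not occur in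
it. The linear map `transfer`, which matches basis monomials, therefore respects all
comultiplications, counits and antipodes (`cop_transfer`, `transfer_anti`); only the products
differ. Hence γ is a cleaving map, and a comodule over A(a,a) is the same thing as a comodule over
A(b,b). Only the tensor product has to be corrected. The map m ↦ ∑ m₀ ⊗ m₁ identifies M with its
cotensor product with A(a,b), and multiplication in A(a,b) then gives the tensorator on M ⊗ N.

The ring theory separates H from L. In H one has g^n = 1 - x^n, so H is finite and torsion free over
the PID k[x] localized at 1 - x^n. Left ideals are projective over that PID, and averaging over the
powers of g (n is invertible in k) makes a splitting H-linear (`projective_ideal`). Thus the global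
dimension is at most 1, and the trivial module shows that it is 1. In L the generator y is
nilpotent, and L/Ly and L/Ly^(n-1) are syzygies of each other, neither of them projective; the
global dimension is infinite.

For the injective dimension, every A(a,b) is finite free over the PID k[g,g⁻¹], and the coefficient
of x^(n-1) is a Frobenius form over it, which gives the bound 1; non-invertibility of g - 1 gives
equality when a = b. All powers of g^n are central, so the algebras are finite over their centres,
hence PI. Right-hand statements follow from the left-hand ones because the antipode is an
isomorphism onto the opposite ring. -/

namespace LiuAlg

noncomputable section

set_option linter.unusedSectionVars false

variable {k : Type u} [Field k] {n : ℕ} {ξ : k}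

/-! ### The basis of monomials -/

variable (n ξ) in
/-- The monomial `g ^ i x ^ j`. -/
def monomial (a b : k) (i : ℤ) (j : ℕ) : LiuAlg n ξ a b :=
  ((g n ξ a b ^ i : (LiuAlg n ξ a b)ˣ) : LiuAlg n ξ a b) * x n ξ a b ^ j

variable (n ξ) in
theorem root_ne_zero [hn : Fact (2 ≤ n)] [hξ : Fact (IsPrimitiveRoot ξ n)] : ξ ≠ 0 :=
  hξ.out.ne_zero (by have := hn.out; omega)

variable (n) in
theorem root_zpow_natCast [hξ : Fact (IsPrimitiveRoot ξ n)] : ξ ^ (n : ℤ) = 1 := by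
  rw [zpow_natCast, hξ.out.pow_eq_one]

variable (n) in
theorem root_zpow_mul_natCast [Fact (IsPrimitiveRoot ξ n)] (i : ℤ) : ξ ^ (i * n) = 1 := by
  rw [mul_comm, zpow_mul, root_zpow_natCast, one_zpow]

variable [hn : Fact (2 ≤ n)] [hξ : Fact (IsPrimitiveRoot ξ n)]

theorem x_mul_g_zpow (a b : k) (i : ℤ) :
    x n ξ a b * ((g n ξ a b ^ i : (LiuAlg n ξ a b)ˣ) : LiuAlg n ξ a b)
      = ξ ^ i • (((g n ξ a b ^ i : (LiuAlg n ξ a b)ˣ) : LiuAlg n ξ a b) * x n ξ a b) := by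
  have h0 := root_ne_zero n ξ
  induction i with
  | zero => simp
  | succ i ih =>
    rw [zpow_add_one, Units.val_mul, ← mul_assoc, ih, smul_mul_assoc, mul_assoc, x_mul_g,
      mul_smul_comm, smul_smul, ← zpow_add_one₀ h0, mul_assoc]
  | pred i ih =>
    rw [zpow_sub_one, Units.val_mul, ← mul_assoc, ih, smul_mul_assoc, mul_assoc, x_mul_g_inv,
      mul_smul_comm, smul_smul, ← zpow_sub_one₀ h0, mul_assoc]

theorem x_pow_mul_g_zpow (a b : k) (i : ℤ) (j : ℕ) :
    x n ξ a b ^ j * ((g n ξ a b ^ i : (LiuAlg n ξ a b)ˣ) : LiuAlg n ξ a b)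
      = ξ ^ (i * j) • monomial n ξ a b i j := by
  have h0 := root_ne_zero n ξ
  induction j with
  | zero => simp [monomial]
  | succ j ih =>
    rw [pow_succ', mul_assoc, ih, monomial, mul_smul_comm, ← mul_assoc, x_mul_g_zpow,
      smul_mul_assoc, smul_smul, ← zpow_add₀ h0, monomial, mul_assoc, pow_succ']
    congr 2
    push_cast; ring

theorem monomial_mul_monomial (a b : k) (i i' : ℤ) (j j' : ℕ) :
    monomial n ξ a b i j * monomial n ξ a b i' j'
      = ξ ^ (i' * j) • monomial n ξ a b (i + i') (j + j') := by
  rw [monomial, mul_assoc, monomial, ← mul_assoc (_ ^ j), x_pow_mul_g_zpow, smul_mul_assoc,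
    mul_smul_comm, monomial, monomial, zpow_add, Units.val_mul, pow_add]
  simp only [mul_assoc]

theorem monomial_add_natCast (a b : k) (i : ℤ) (j : ℕ) :
    monomial n ξ a b i (j + n) = a • monomial n ξ a b i j - b • monomial n ξ a b (i + n) j := by
  rw [monomial, add_comm j, pow_add, x_pow, sub_mul, mul_sub, Algebra.algebraMap_eq_smul_one,
    smul_mul_assoc, one_mul, mul_smul_comm, smul_mul_assoc, mul_smul_comm, monomial, monomial,
    zpow_add, Units.val_mul, zpow_natCast, Units.val_pow_eq_pow_val, mul_assoc]

/-! ### A model of the regular representation -/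

variable (k n) in
/-- The endomorphisms of the model `(ℤ × Fin n) →₀ k`. -/
abbrev ModelEnd : Type u := Module.End k ((ℤ × Fin n) →₀ k)

/-- The vector that represents `g ^ i x ^ j`, for `j ≤ n`, in the module `(ℤ × Fin n) →₀ k`. -/
def modelVec (a b : k) (i : ℤ) (j : ℕ) : (ℤ × Fin n) →₀ k :=
  if h : j < n then Finsupp.single (i, ⟨j, h⟩) 1
  else a • Finsupp.single (i, ⟨0, by have := hn.out; omega⟩) 1
    - b • Finsupp.single (i + n, ⟨0, by have := hn.out; omega⟩) 1

variable (k n) in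
/-- Multiplication by `g` on the model. -/
def modelG : (ModelEnd k n)ˣ :=
  (LinearMap.GeneralLinearGroup.generalLinearEquiv k _).symm
    (Finsupp.domLCongr ((Equiv.addRight (1 : ℤ)).prodCongr (Equiv.refl (Fin n))))

variable (ξ) in
/-- Multiplication by `x` on the model. -/
def modelX (a b : k) : ModelEnd k n :=
  Finsupp.linearCombination k fun p : ℤ × Fin n => ξ ^ p.1 • modelVec a b p.1 (p.2 + 1)

theorem modelG_single (i : ℤ) (j : Fin n) (r : k) :
    (modelG k n : ModelEnd k n) (Finsupp.single (i, j) r)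
      = Finsupp.single (i + 1, j) r := by
  change (Finsupp.domLCongr ((Equiv.addRight (1 : ℤ)).prodCongr (Equiv.refl (Fin n)))) _ = _
  simp

theorem modelG_modelVec (a b : k) (i : ℤ) (j : ℕ) :
    (modelG k n : ModelEnd k n) (modelVec a b i j) = modelVec a b (i + 1) j := by
  unfold modelVec
  split_ifs
  · rw [modelG_single]
  · rw [map_sub, map_smul, map_smul, modelG_single, modelG_single, add_right_comm]

theorem modelG_zpow_modelVec (a b : k) (i l : ℤ) (j : ℕ) :
    ((modelG k n ^ l : (ModelEnd k n)ˣ) :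
      ModelEnd k n) (modelVec a b i j) = modelVec a b (i + l) j := by
  induction l generalizing i with
  | zero => simp
  | succ l ih =>
    rw [zpow_add_one, Units.val_mul, Module.End.mul_apply, modelG_modelVec, ih]
    congr 1; ring
  | pred l ih =>
    rw [zpow_sub_one, Units.val_mul, Module.End.mul_apply]
    have : (((modelG k n)⁻¹ : (ModelEnd k n)ˣ) :
        ModelEnd k n) (modelVec a b i j) = modelVec a b (i - 1) j := by
      have h := modelG_modelVec (n := n) a b (i - 1) j
      rw [sub_add_cancel] at h
      rw [← h, ← Module.End.mul_apply, Units.inv_mul, Module.End.one_apply]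
    rw [this, ih]
    congr 1; ring

theorem modelX_modelVec (a b : k) (i : ℤ) {j : ℕ} (hj : j < n) :
    (modelX ξ a b : ModelEnd k n) (modelVec a b i j) = ξ ^ i • modelVec a b i (j + 1) := by
  conv_lhs => rw [modelVec, dif_pos hj]
  simp [modelX]

theorem modelX_pow_modelVec (a b : k) (i : ℤ) (j m : ℕ) (h : j + m ≤ n) :
    (modelX ξ a b ^ m : ModelEnd k n) (modelVec a b i j) = ξ ^ (i * m) • modelVec a b i (j + m) := by
  induction m with
  | zero => simp
  | succ m ih =>
    rw [pow_succ', Module.End.mul_apply, ih (by omega), map_smul, modelX_modelVec _ _ _ (by omega),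
      smul_smul, ← zpow_add₀ (root_ne_zero n ξ), add_assoc]
    congr 2; push_cast; ring

theorem end_ext_modelVec (a b : k) {f f' : ModelEnd k n}
    (h : ∀ i j, j < n → f (modelVec a b i j) = f' (modelVec a b i j)) : f = f' := by
  refine Finsupp.lhom_ext' fun ⟨i, j⟩ => LinearMap.ext_ring ?_
  have := h i j j.2
  rwa [modelVec, dif_pos j.2] at this

theorem modelX_mul_modelG (a b : k) : (modelX ξ a b : ModelEnd k n) * (modelG k n : ModelEnd k n)
    = ξ • ((modelG k n : ModelEnd k n) * modelX ξ a b) := by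
  refine end_ext_modelVec a b fun i j hj => ?_
  rw [Module.End.mul_apply, modelG_modelVec, modelX_modelVec _ _ _ hj, LinearMap.smul_apply,
    Module.End.mul_apply, modelX_modelVec _ _ _ hj, map_smul, modelG_modelVec, smul_smul,
    zpow_add_one₀ (root_ne_zero n ξ), mul_comm]

/-- Starting from g^i x^j, n - j steps reach degree n, where the vector splits into the terms with
coefficients a and -b, both of degree 0. The remaining j steps bring both back to degree j. The
accumulated power of ξ is ξ^(i n) = 1, since the shift of i by n contributes only a power of ξ^n. -/
theorem modelX_pow (a b : k) : (modelX ξ a b : ModelEnd k n) ^ n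
    = algebraMap k _ a - b • (modelG k n : ModelEnd k n) ^ n := by
  refine end_ext_modelVec a b fun i j hj => ?_
  have h1 : n = j + (n - j) := by omega
  have h2 : modelVec (n := n) a b i n = a • modelVec a b i 0 - b • modelVec a b (i + n) 0 := by
    simp [modelVec, show 0 < n by omega]
  have h3 : (modelX ξ a b ^ n : ModelEnd k n)
      = modelX ξ a b ^ j * modelX ξ a b ^ (n - j) := by rw [← pow_add, ← h1]
  rw [h3, Module.End.mul_apply, modelX_pow_modelVec _ _ _ _ _ (by omega), ← h1, h2, map_smul,
    map_sub, map_smul, map_smul, modelX_pow_modelVec _ _ _ _ _ (by omega),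
    modelX_pow_modelVec _ _ _ _ _ (by omega), zero_add, add_mul, zpow_add₀ (root_ne_zero n ξ),
    mul_comm (n : ℤ) j, root_zpow_mul_natCast n (j : ℤ), mul_one, smul_comm a, smul_comm b, ← smul_sub,
    smul_smul, ← zpow_add₀ (root_ne_zero n ξ), ← mul_add, ← Nat.cast_add, add_comm (n - j),
    ← h1, root_zpow_mul_natCast n i, one_smul, LinearMap.sub_apply, LinearMap.smul_apply,
    Module.algebraMap_end_apply, ← Units.val_pow_eq_pow_val, ← zpow_natCast, modelG_zpow_modelVec]

variable (n ξ) in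
/-- The representation of `LiuAlg n ξ a b` on the model. -/
def modelRep (a b : k) : LiuAlg n ξ a b →ₐ[k] ModelEnd k n :=
  lift (R := ModelEnd k n) (modelG k n) (modelX ξ a b) (modelX_mul_modelG a b) (modelX_pow a b)

/-- Acting on the vector of the monomial 1 recovers the basis vector of each monomial; this is what
proves linear independence. -/
theorem modelRep_monomial (a b : k) (i : ℤ) (j : ℕ) (hj : j ≤ n) :
    modelRep n ξ a b (monomial n ξ a b i j) (modelVec a b 0 0) = modelVec a b i j := by
  have hg : modelRep n ξ a b ((g n ξ a b ^ i : (LiuAlg n ξ a b)ˣ) : LiuAlg n ξ a b)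
      = ((modelG k n ^ i : (ModelEnd k n)ˣ) : ModelEnd k n) := by
    have : Units.map (modelRep n ξ a b).toRingHom.toMonoidHom (g n ξ a b) = modelG k n :=
      Units.ext (lift_g _ _ _ _)
    rw [← this, ← map_zpow]; rfl
  rw [monomial, map_mul, map_pow, hg, modelRep, lift_x, Module.End.mul_apply,
    modelX_pow_modelVec _ _ _ _ _ (by omega), zero_mul, zpow_zero, one_smul, zero_add,
    modelG_zpow_modelVec, zero_add]

variable (n ξ) in
/-- The linear map from the model that sends basis vectors to monomials. -/
def ofModel (a b : k) : ((ℤ × Fin n) →₀ k) →ₗ[k] LiuAlg n ξ a b :=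
  Finsupp.linearCombination k fun p : ℤ × Fin n => monomial n ξ a b p.1 p.2

theorem ofModel_injective (a b : k) : Function.Injective (ofModel n ξ a b) := by
  have : Function.LeftInverse
      (LinearMap.applyₗ (modelVec a b 0 0) ∘ₗ (modelRep n ξ a b).toLinearMap)
      (ofModel n ξ a b) := by
    intro v
    rw [← LinearMap.comp_apply, ← LinearMap.id_apply (R := k) v]
    congr 1
    refine Finsupp.lhom_ext' fun ⟨i, j⟩ => LinearMap.ext_ring ?_
    have h := modelRep_monomial (ξ := ξ) a b i j j.2.le
    conv_rhs at h => rw [modelVec, dif_pos j.2]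
    simpa [ofModel] using h
  exact this.injective

theorem monomial_mem_range (a b : k) (i : ℤ) (j : ℕ) :
    monomial n ξ a b i j ∈ LinearMap.range (ofModel n ξ a b) := by
  induction j using Nat.strong_induction_on generalizing i with
  | _ j ih =>
    by_cases h : j < n
    · exact ⟨Finsupp.single (i, ⟨j, h⟩) 1, by simp [ofModel]⟩
    · have h2 := hn.out
      -- Replacing x^n by a - b g^n lowers the degree in x by n, whatever the power of g, so the
      -- induction hypothesis is needed for all i.
      obtain ⟨l, rfl⟩ : ∃ l, j = l + n := ⟨j - n, by omega⟩
      rw [monomial_add_natCast]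
      exact sub_mem (Submodule.smul_mem _ _ (ih _ (by omega) _))
        (Submodule.smul_mem _ _ (ih _ (by omega) _))

theorem one_eq_monomial (a b : k) : (1 : LiuAlg n ξ a b) = monomial n ξ a b 0 0 := by
  simp [monomial]

theorem g_eq_monomial (a b : k) : (g n ξ a b : LiuAlg n ξ a b) = monomial n ξ a b 1 0 := by
  simp [monomial]

theorem g_zpow_eq_monomial (a b : k) (i : ℤ) :
    ((g n ξ a b ^ i : (LiuAlg n ξ a b)ˣ) : LiuAlg n ξ a b) = monomial n ξ a b i 0 := by
  simp [monomial]

theorem x_eq_monomial (a b : k) : x n ξ a b = monomial n ξ a b 0 1 := by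
  simp [monomial]

theorem x_pow_eq_monomial (a b : k) (j : ℕ) : x n ξ a b ^ j = monomial n ξ a b 0 j := by
  simp [monomial]

theorem ofModel_surjective (a b : k) : Function.Surjective (ofModel n ξ a b) := by
  rw [← LinearMap.range_eq_top, eq_top_iff]
  rintro u -
  have key : ∀ u v : LiuAlg n ξ a b, v ∈ LinearMap.range (ofModel n ξ a b) →
      u * v ∈ LinearMap.range (ofModel n ξ a b) := by
    have hm : ∀ (i : ℤ) (j : ℕ) (v : LiuAlg n ξ a b), v ∈ LinearMap.range (ofModel n ξ a b) →
        monomial n ξ a b i j * v ∈ LinearMap.range (ofModel n ξ a b) := by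
      rintro i j _ ⟨w, rfl⟩
      induction w using Finsupp.induction_linear with
      | zero => simp
      | add w w' hw hw' => rw [map_add, mul_add]; exact add_mem hw hw'
      | single p r =>
        rw [ofModel, Finsupp.linearCombination_single, mul_smul_comm, monomial_mul_monomial]
        exact Submodule.smul_mem _ _ (Submodule.smul_mem _ _ (monomial_mem_range _ _ _ _))
    intro u
    induction u using induction with
    | hk r =>
      intro v hv
      rw [← Algebra.smul_def]
      exact Submodule.smul_mem _ _ hv
    | hg => rw [g_eq_monomial]; exact hm _ _
    | hgi => rw [← zpow_neg_one, g_zpow_eq_monomial]; exact hm _ _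
    | hx => rw [x_eq_monomial]; exact hm _ _
    | hm u v hu hv => intro w hw; rw [mul_assoc]; exact hu _ (hv _ hw)
    | ha u v hu hv => intro w hw; rw [add_mul]; exact add_mem (hu _ hw) (hv _ hw)
  -- The span of the monomials is a left ideal, and it contains 1.
  have := key u 1 (one_eq_monomial (n := n) (ξ := ξ) a b ▸ monomial_mem_range _ _ _ _)
  rwa [mul_one] at this

variable (n ξ) in
/-- The basis `g ^ i x ^ j`, `i : ℤ`, `j < n`, of `LiuAlg n ξ a b`. -/
def basis (a b : k) : Module.Basis (ℤ × Fin n) k (LiuAlg n ξ a b) :=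
  .ofRepr (LinearEquiv.ofBijective (ofModel n ξ a b)
    ⟨ofModel_injective a b, ofModel_surjective a b⟩).symm

theorem basis_apply (a b : k) (p : ℤ × Fin n) :
    basis n ξ a b p = monomial n ξ a b p.1 p.2 := by
  simp [basis, Module.Basis.coe_ofRepr, ofModel]

theorem linearMap_ext {M : Type*} [AddCommGroup M] [Module k M] {a b : k}
    {f f' : LiuAlg n ξ a b →ₗ[k] M}
    (h : ∀ (i : ℤ) (j : ℕ), j < n → f (monomial n ξ a b i j) = f' (monomial n ξ a b i j)) :
    f = f' :=
  (basis n ξ a b).ext fun p => by rw [basis_apply]; exact h _ _ p.2.2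

/-! ### Comparison of the different algebras -/

variable (n ξ) in
/-- The linear bijection `g ^ i x ^ j ↦ g ^ i x ^ j`, `j < n`. -/
def transfer (a b c d : k) : LiuAlg n ξ a b ≃ₗ[k] LiuAlg n ξ c d :=
  (basis n ξ a b).equiv (basis n ξ c d) (Equiv.refl _)

theorem transfer_monomial (a b c d : k) (i : ℤ) {j : ℕ} (hj : j < n) :
    transfer n ξ a b c d (monomial n ξ a b i j) = monomial n ξ c d i j := by
  have := (basis n ξ a b).equiv_apply (i, ⟨j, hj⟩) (basis n ξ c d) (Equiv.refl _)
  rwa [basis_apply, Equiv.refl_apply, basis_apply] at this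

@[simp] theorem transfer_transfer (a b c d e f : k) (u : LiuAlg n ξ a b) :
    transfer n ξ c d e f (transfer n ξ a b c d u) = transfer n ξ a b e f u := by
  have : (transfer n ξ c d e f).toLinearMap ∘ₗ (transfer n ξ a b c d).toLinearMap
      = (transfer n ξ a b e f).toLinearMap :=
    linearMap_ext fun i j hj => by simp [transfer_monomial, hj]
  exact LinearMap.congr_fun this u

@[simp] theorem transfer_self (a b : k) (u : LiuAlg n ξ a b) : transfer n ξ a b a b u = u := by
  have : (transfer n ξ a b a b).toLinearMap = LinearMap.id :=
    linearMap_ext fun i j hj => by simp [transfer_monomial, hj]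
  exact LinearMap.congr_fun this u

@[simp] theorem transfer_one (a b c d : k) : transfer n ξ a b c d 1 = 1 := by
  have := hn.out
  rw [one_eq_monomial, transfer_monomial _ _ _ _ _ (by omega), ← one_eq_monomial]

/-- Since (x ⊗ 1)(g ⊗ x) = ξ (g ⊗ x)(x ⊗ 1), the q-binomial theorem applies. The coefficients are
free of a, b and c, which is what makes the comparison of the different algebras possible. -/
theorem cop_monomial (a b c : k) (i : ℤ) (j : ℕ) :
    cop a b c (monomial n ξ a c i j) = ∑ l ∈ Finset.range (j + 1), gaussBinom ξ j l •
      (monomial n ξ a b (i + l) (j - l) ⊗ₜ[k] monomial n ξ b c i l) := by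
  have hg : cop a b c ((g n ξ a c ^ i : (LiuAlg n ξ a c)ˣ) : LiuAlg n ξ a c)
      = ((g n ξ a b ^ i : (LiuAlg n ξ a b)ˣ) : LiuAlg n ξ a b) ⊗ₜ[k]
        ((g n ξ b c ^ i : (LiuAlg n ξ b c)ˣ) : LiuAlg n ξ b c) := by
    induction i with
    | zero => simp [Algebra.TensorProduct.one_def]
    | succ i ih =>
      rw [zpow_add_one, Units.val_mul, map_mul, ih, cop_g, Algebra.TensorProduct.tmul_mul_tmul,
        zpow_add_one, zpow_add_one, Units.val_mul, Units.val_mul]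
    | pred i ih =>
      rw [zpow_sub_one, Units.val_mul, map_mul, ih, cop_g_inv, Algebra.TensorProduct.tmul_mul_tmul,
        zpow_sub_one, zpow_sub_one, Units.val_mul, Units.val_mul]
  rw [monomial, map_mul, map_pow, hg, cop_x, qbinomial (q := ξ) (by
      simp only [Algebra.TensorProduct.tmul_mul_tmul, one_mul, mul_one, x_mul_g,
        TensorProduct.smul_tmul']), Finset.mul_sum]
  refine Finset.sum_congr rfl fun l _ => ?_
  simp only [mul_smul_comm, Algebra.TensorProduct.tmul_pow, Algebra.TensorProduct.tmul_mul_tmul,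
    one_pow, mul_one, monomial, zpow_add, zpow_natCast, Units.val_mul, Units.val_pow_eq_pow_val,
    mul_assoc]

/-- The transfer maps are compatible with all comultiplications. -/
theorem cop_transfer (a b c a' b' c' : k) (u : LiuAlg n ξ a c) :
    cop a' b' c' (transfer n ξ a c a' c' u) =
      TensorProduct.map (transfer n ξ a b a' b').toLinearMap (transfer n ξ b c b' c').toLinearMap
        (cop a b c u) := by
  have : (cop a' b' c').toLinearMap ∘ₗ (transfer n ξ a c a' c').toLinearMap =
      TensorProduct.map (transfer n ξ a b a' b').toLinearMap (transfer n ξ b c b' c').toLinearMap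
        ∘ₗ (cop a b c).toLinearMap := by
    refine linearMap_ext fun i j hj => ?_
    simp only [LinearMap.comp_apply, LinearEquiv.coe_coe, AlgHom.toLinearMap_apply,
      transfer_monomial _ _ _ _ _ hj, cop_monomial, map_sum, map_smul, TensorProduct.map_tmul]
    refine Finset.sum_congr rfl fun l hl => ?_
    have := Finset.mem_range.1 hl
    -- Both exponents j - l and l stay below n, so each tensor factor is still a basis monomial.
    rw [transfer_monomial _ _ _ _ _ (by omega), transfer_monomial _ _ _ _ _ (by omega)]
  exact LinearMap.congr_fun this u

theorem eps_monomial (a : k) (i : ℤ) (j : ℕ) :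
    eps a (monomial n ξ a a i j) = if j = 0 then 1 else 0 := by
  have hg : eps a ((g n ξ a a ^ i : (LiuAlg n ξ a a)ˣ) : LiuAlg n ξ a a) = 1 := by
    have : Units.map (eps a : LiuAlg n ξ a a →ₐ[k] k).toRingHom.toMonoidHom (g n ξ a a) = 1 :=
      Units.ext (eps_g (n := n) (ξ := ξ) a)
    have h := congrArg (fun w : kˣ => ((w ^ i : kˣ) : k)) this
    rw [← map_zpow, one_zpow] at h
    exact h
  rw [monomial, map_mul, hg, map_pow, eps_x, one_mul, zero_pow_eq]

theorem eps_transfer (a a' : k) (u : LiuAlg n ξ a a) :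
    eps a' (transfer n ξ a a a' a' u) = eps a u := by
  have : (eps a').toLinearMap ∘ₗ (transfer n ξ a a a' a').toLinearMap = (eps a).toLinearMap :=
    linearMap_ext fun i j hj => by
      simp [transfer_monomial _ _ _ _ _ hj, eps_monomial]
  exact LinearMap.congr_fun this u

end
end LiuAlg

namespace LiuAlg

noncomputable section

set_option linter.unusedSectionVars false

variable {k : Type u} [Field k] {n : ℕ} {ξ : k} [hn : Fact (2 ≤ n)] [hξ : Fact (IsPrimitiveRoot ξ n)]

/-! ### Coassociativity, counits and antipodes for the whole family -/

/-- Both sides are algebra maps, so it suffices to compare them on g and x. The four free parameters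
make this the common source of the coalgebra and comodule axioms and of the bicomodule condition. -/
theorem cop_coassoc (a b c d : k) (u : LiuAlg n ξ a d) :
    TensorProduct.assoc k _ _ _ ((cop a b c).toLinearMap.rTensor _ (cop a c d u)) =
      (cop b c d).toLinearMap.lTensor _ (cop a b d u) := by
  have : ((Algebra.TensorProduct.assoc k k k (LiuAlg n ξ a b) (LiuAlg n ξ b c)
        (LiuAlg n ξ c d)).toAlgHom.comp
      (Algebra.TensorProduct.map (cop a b c) (AlgHom.id k (LiuAlg n ξ c d)))).comp (cop a c d) =
      (Algebra.TensorProduct.map (AlgHom.id k (LiuAlg n ξ a b)) (cop b c d)).comp (cop a b d) :=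
    algHom_ext (by simp) (by
      simp [TensorProduct.add_tmul, TensorProduct.tmul_add, Algebra.TensorProduct.one_def,
        add_assoc])
  exact congrArg (fun f : _ →ₐ[k] _ => f u) this

theorem eps_rTensor_cop (a b : k) (u : LiuAlg n ξ a b) :
    TensorProduct.lid k _ ((eps a).toLinearMap.rTensor _ (cop a a b u)) = u := by
  have : ((Algebra.TensorProduct.lid k (LiuAlg n ξ a b)).toAlgHom.comp
      (Algebra.TensorProduct.map (eps a) (AlgHom.id k (LiuAlg n ξ a b)))).comp (cop a a b) =
      AlgHom.id k _ :=
    algHom_ext (by simp) (by simp)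
  exact congrArg (fun f : _ →ₐ[k] _ => f u) this

theorem eps_lTensor_cop (a b : k) (u : LiuAlg n ξ a b) :
    TensorProduct.rid k _ ((eps b).toLinearMap.lTensor _ (cop a b b u)) = u := by
  have : ((Algebra.TensorProduct.rid k k (LiuAlg n ξ a b)).toAlgHom.comp
      (Algebra.TensorProduct.map (AlgHom.id k (LiuAlg n ξ a b)) (eps b))).comp (cop a b b) =
      AlgHom.id k _ :=
    algHom_ext (by simp) (by simp)
  exact congrArg (fun f : _ →ₐ[k] _ => f u) this

/-- Because S reverses products, S(u₁v₁)u₂v₂ = S(v₁)(S(u₁)u₂)v₂; a scalar in the middle can be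
pulled out. This makes the antipode identity multiplicative, so that it can be checked on
generators. -/
theorem mul_anti_rTensor (a b : k) (u v : LiuAlg n ξ b a ⊗[k] LiuAlg n ξ a b) (r : k)
    (h : LinearMap.mul' k _ ((anti b a).rTensor _ u) = algebraMap k (LiuAlg n ξ a b) r) :
    LinearMap.mul' k _ ((anti b a).rTensor _ (u * v))
      = r • LinearMap.mul' k _ ((anti b a).rTensor _ v) := by
  induction v with
  | zero => simp
  | add v w hv hw => rw [mul_add, map_add, map_add, hv, hw, map_add, map_add, smul_add]
  | tmul c d =>
    have key : ∀ u : LiuAlg n ξ b a ⊗[k] LiuAlg n ξ a b,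
        LinearMap.mul' k _ ((anti b a).rTensor _ (u * (c ⊗ₜ d)))
          = anti b a c * LinearMap.mul' k _ ((anti b a).rTensor _ u) * d := by
      intro u
      induction u with
      | zero => simp
      | add u w hu hw => rw [add_mul, map_add, map_add, hu, hw, map_add, map_add, mul_add, add_mul]
      | tmul e f => simp [Algebra.TensorProduct.tmul_mul_tmul, anti_mul, mul_assoc]
    rw [key, h, Algebra.algebraMap_eq_smul_one]
    simp

theorem mul_anti_lTensor (a b : k) (u v : LiuAlg n ξ a b ⊗[k] LiuAlg n ξ b a) (r : k)
    (h : LinearMap.mul' k _ ((anti b a).lTensor _ v) = algebraMap k (LiuAlg n ξ a b) r) :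
    LinearMap.mul' k _ ((anti b a).lTensor _ (u * v))
      = r • LinearMap.mul' k _ ((anti b a).lTensor _ u) := by
  induction u with
  | zero => simp
  | add u w hv hw => rw [add_mul, map_add, map_add, hv, hw, map_add, map_add, smul_add]
  | tmul c d =>
    have key : ∀ v : LiuAlg n ξ a b ⊗[k] LiuAlg n ξ b a,
        LinearMap.mul' k _ ((anti b a).lTensor _ ((c ⊗ₜ d) * v))
          = c * LinearMap.mul' k _ ((anti b a).lTensor _ v) * anti b a d := by
      intro u
      induction u with
      | zero => simp
      | add u w hu hw => rw [mul_add, map_add, map_add, hu, hw, map_add, map_add, mul_add, add_mul]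
      | tmul e f => simp [Algebra.TensorProduct.tmul_mul_tmul, anti_mul, mul_assoc]
    rw [key, h, Algebra.algebraMap_eq_smul_one]
    simp

theorem mul_anti_rTensor_cop (a b : k) (u : LiuAlg n ξ b b) :
    LinearMap.mul' k _ ((anti b a).rTensor _ (cop b a b u)) = algebraMap k _ (eps b u) := by
  induction u using induction with
  | hk r => simp [Algebra.algebraMap_eq_smul_one, Algebra.TensorProduct.one_def]
  | hg => simp
  | hgi => simp
  | hx => simp
  | hm u v hu hv =>
    rw [map_mul, mul_anti_rTensor a b _ _ _ hu, hv, map_mul, map_mul, Algebra.smul_def]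
  | ha u v hu hv => simp only [map_add, hu, hv]

theorem mul_anti_lTensor_cop (a b : k) (u : LiuAlg n ξ a a) :
    LinearMap.mul' k _ ((anti b a).lTensor _ (cop a b a u)) = algebraMap k _ (eps a u) := by
  induction u using induction with
  | hk r => simp [Algebra.algebraMap_eq_smul_one, Algebra.TensorProduct.one_def]
  | hg => simp
  | hgi => simp
  | hx => simp
  | hm u v hu hv =>
    rw [map_mul, mul_anti_lTensor a b _ _ _ hv, hu, map_mul, map_mul, Algebra.smul_def,
      Algebra.commutes]
  | ha u v hu hv => simp only [map_add, hu, hv]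

/-- The composite of the two antipodes is an algebra map, and it agrees with an inner automorphism
on generators. Bijectivity of the antipode follows at once. -/
theorem anti_anti (a b : k) (u : LiuAlg n ξ a b) : anti b a (anti a b u) =
    (((g n ξ a b)⁻¹ : (LiuAlg n ξ a b)ˣ) : LiuAlg n ξ a b) * u * g n ξ a b := by
  induction u using induction with
  | hk r => simp [Algebra.algebraMap_eq_smul_one]
  | hg => simp
  | hgi => simp
  | hx => simp [anti_mul, mul_assoc]
  | hm u v hu hv => rw [anti_mul, anti_mul, hu, hv]; simp [mul_assoc]
  | ha u v hu hv => rw [map_add, map_add, hu, hv, mul_add, add_mul]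

theorem anti_bijective (a b : k) : Function.Bijective (anti a b : LiuAlg n ξ a b →ₗ[k] _) := by
  constructor
  · rw [injective_iff_map_eq_zero]
    intro u hu
    have h := anti_anti a b u
    rw [hu, map_zero] at h
    simpa using h.symm
  · intro u
    refine ⟨anti b a ((g n ξ b a : LiuAlg n ξ b a) * u
      * ((g n ξ b a)⁻¹ : (LiuAlg n ξ b a)ˣ)), ?_⟩
    rw [anti_anti]
    simp [mul_assoc]

variable (n ξ) in
/-- The antipode, as an isomorphism onto the opposite ring. -/
def opEquiv (a : k) : LiuAlg n ξ a a ≃+* (LiuAlg n ξ a a)ᵐᵒᵖ :=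
  RingEquiv.ofBijective (antiHom a a)
    ⟨fun _ _ h => (anti_bijective a a).1 (congrArg MulOpposite.unop h), fun u =>
      (anti_bijective a a).2 u.unop |>.imp fun _ h => MulOpposite.unop_injective h⟩

theorem anti_monomial (a b : k) (i : ℤ) (j : ℕ) : anti a b (monomial n ξ a b i j) =
    ((-1) ^ j * ξ⁻¹ ^ (j * (j - 1) / 2) * ξ ^ (-i * j)) • monomial n ξ b a (-j - i) j := by
  have hg : ∀ i : ℤ, anti a b ((g n ξ a b ^ i : (LiuAlg n ξ a b)ˣ) : LiuAlg n ξ a b)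
      = ((g n ξ b a ^ (-i) : (LiuAlg n ξ b a)ˣ) : LiuAlg n ξ b a) := by
    intro i
    induction i with
    | zero => simp
    | succ i ih =>
      rw [zpow_add_one, Units.val_mul, anti_mul, ih, anti_g, ← Units.val_mul, neg_add, zpow_add,
        zpow_neg_one, ← zpow_neg_one, (Commute.refl (g n ξ b a)).zpow_zpow]
    | pred i ih =>
      rw [zpow_sub_one, Units.val_mul, anti_mul, ih, anti_g_inv, ← Units.val_mul, neg_sub,
        sub_eq_add_neg, zpow_add, zpow_one]
  have hx : anti a b (x n ξ a b ^ j) = ((-1) ^ j * ξ⁻¹ ^ (j * (j - 1) / 2)) •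
      monomial n ξ b a (-j) j := by
    rw [anti_apply, map_pow, MulOpposite.unop_pow, ← anti_apply, anti_x, ← neg_one_smul k, smul_pow,
      mul_pow_of_qcomm (x_mul_g_inv b a), smul_smul, monomial, zpow_neg, zpow_natCast, ← inv_pow,
      Units.val_pow_eq_pow_val]
  rw [monomial, anti_mul, hx, hg, g_zpow_eq_monomial, smul_mul_assoc, monomial_mul_monomial,
    smul_smul, add_zero, sub_eq_add_neg]

/-- The scalar in `anti_monomial` does not depend on the parameters. -/
theorem transfer_anti (a b c d : k) (u : LiuAlg n ξ a b) :
    transfer n ξ b a d c (anti a b u) = anti c d (transfer n ξ a b c d u) := by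
  have : (transfer n ξ b a d c).toLinearMap ∘ₗ anti a b =
      anti c d ∘ₗ (transfer n ξ a b c d).toLinearMap :=
    linearMap_ext fun i j hj => by simp [anti_monomial, transfer_monomial, hj]
  exact LinearMap.congr_fun this u

/-! ### Galois objects -/

variable (n ξ) in
/-- The inverse `b ⊗ h ↦ ∑ b S(h₁) ⊗ h₂` of the right canonical map. -/
def rightCanonicalInv (a b : k) : LiuAlg n ξ a b ⊗[k] LiuAlg n ξ b b →ₗ[k]
    LiuAlg n ξ a b ⊗[k] LiuAlg n ξ a b :=
  TensorProduct.lift ((LinearMap.mul k (LiuAlg n ξ a b ⊗[k] LiuAlg n ξ a b)).compl₁₂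
    (Algebra.TensorProduct.includeLeft :
      LiuAlg n ξ a b →ₐ[k] LiuAlg n ξ a b ⊗[k] LiuAlg n ξ a b).toLinearMap
    ((anti b a).rTensor _ ∘ₗ (cop b a b).toLinearMap))

variable (n ξ) in
/-- The inverse `l ⊗ b ↦ ∑ l₁ ⊗ S(l₂) b` of the left canonical map. -/
def leftCanonicalInv (a b : k) : LiuAlg n ξ a a ⊗[k] LiuAlg n ξ a b →ₗ[k]
    LiuAlg n ξ a b ⊗[k] LiuAlg n ξ a b :=
  TensorProduct.lift ((LinearMap.mul k (LiuAlg n ξ a b ⊗[k] LiuAlg n ξ a b)).compl₁₂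
    ((anti b a).lTensor _ ∘ₗ (cop a b a).toLinearMap)
    (Algebra.TensorProduct.includeRight :
      LiuAlg n ξ a b →ₐ[k] LiuAlg n ξ a b ⊗[k] LiuAlg n ξ a b).toLinearMap)

theorem rightCanonicalMap_tmul {B H : Type u} [Ring B] [Algebra k B] [Ring H] [HopfAlgebra k H]
    (ρ : B →ₐ[k] B ⊗[k] H) (b c : B) :
    rightCanonicalMap k ρ (b ⊗ₜ c) = (b ⊗ₜ 1) * ρ c := by
  simp [rightCanonicalMap]

theorem leftCanonicalMap_tmul {B L : Type u} [Ring B] [Algebra k B] [Ring L] [HopfAlgebra k L]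
    (δ : B →ₐ[k] L ⊗[k] B) (b c : B) :
    leftCanonicalMap k δ (b ⊗ₜ c) = δ b * (1 ⊗ₜ c) := by
  simp [leftCanonicalMap]

theorem rightCanonicalInv_tmul (a b : k) (c : LiuAlg n ξ a b) (h : LiuAlg n ξ b b) :
    rightCanonicalInv n ξ a b (c ⊗ₜ h) = (c ⊗ₜ 1) * (anti b a).rTensor _ (cop b a b h) := by
  simp [rightCanonicalInv]

theorem leftCanonicalInv_tmul (a b : k) (l : LiuAlg n ξ a a) (c : LiuAlg n ξ a b) :
    leftCanonicalInv n ξ a b (l ⊗ₜ c) = (anti b a).lTensor _ (cop a b a l) * (1 ⊗ₜ c) := by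
  simp [leftCanonicalInv]

/-- The proposed inverse applies the mixed comultiplication A(b,b) → A(b,a) ⊗ A(a,b) followed by the
mixed antipode on the first factor. In both composites, coassociativity brings an element next to
its antipode; the antipode law and then the counit law collapse the expression. -/
theorem rightCanonicalMap_bijective (a b : k) :
    Function.Bijective (rightCanonicalMap k (cop a b b : LiuAlg n ξ a b →ₐ[k] _)) := by
  rw [Function.bijective_iff_has_inverse]
  refine ⟨rightCanonicalInv n ξ a b, fun w => ?_, fun w => ?_⟩
  · induction w with
    | zero => simp
    | add v w hv hw => rw [map_add, map_add, hv, hw]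
    | tmul c d =>
      rw [rightCanonicalMap_tmul]
      -- The composite is rewritten as c · d₁ S(d₂) ⊗ d₃, in a form to which coassociativity applies
      -- as an identity of iterated comultiplications.
      have h1 : ∀ v : LiuAlg n ξ a b ⊗[k] LiuAlg n ξ b b,
          rightCanonicalInv n ξ a b ((c ⊗ₜ 1) * v) = (c ⊗ₜ 1) * (LinearMap.mul' k _ ∘ₗ
            (anti b a).lTensor _).rTensor _ ((TensorProduct.assoc k _ _ _).symm
              ((cop b a b).toLinearMap.lTensor _ v)) := by
        intro v
        induction v with
        | zero => simp
        | add v w hv hw => simp only [mul_add, map_add, hv, hw]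
        | tmul e f =>
          rw [Algebra.TensorProduct.tmul_mul_tmul, one_mul, rightCanonicalInv_tmul,
            LinearMap.lTensor_tmul, AlgHom.toLinearMap_apply]
          induction cop b a b f with
          | zero => simp
          | add v w hv hw => simp only [mul_add, map_add, TensorProduct.tmul_add, hv, hw]
          | tmul p q => simp [mul_assoc]
      rw [h1, ← cop_coassoc, LinearEquiv.symm_apply_apply, ← LinearMap.comp_apply,
        ← LinearMap.rTensor_comp]
      have h2 : (LinearMap.mul' k (LiuAlg n ξ a b) ∘ₗ (anti b a).lTensor _) ∘ₗ
          (cop a b a).toLinearMap = Algebra.linearMap k _ ∘ₗ (eps a).toLinearMap :=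
        LinearMap.ext (mul_anti_lTensor_cop a b)
      rw [h2]
      conv_rhs => rw [← eps_rTensor_cop a b d]
      induction cop a a b d with
      | zero => simp
      | add v w hv hw => simp only [mul_add, map_add, TensorProduct.tmul_add, hv, hw]
      | tmul p q =>
        simp [Algebra.algebraMap_eq_smul_one, ← TensorProduct.smul_tmul']
  · induction w with
    | zero => simp
    | add v w hv hw => rw [map_add, map_add, hv, hw]
    | tmul c h =>
      rw [rightCanonicalInv_tmul]
      have h1 : ∀ v : LiuAlg n ξ b a ⊗[k] LiuAlg n ξ a b,
          rightCanonicalMap k (cop a b b) ((c ⊗ₜ 1) * (anti b a).rTensor _ v) =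
            (c ⊗ₜ 1) * (LinearMap.mul' k _ ∘ₗ
              (anti b a).rTensor _).rTensor _ ((TensorProduct.assoc k _ _ _).symm
                ((cop a b b).toLinearMap.lTensor _ v)) := by
        intro v
        induction v with
        | zero => simp
        | add v w hv hw => simp only [mul_add, map_add, hv, hw]
        | tmul e f =>
          rw [LinearMap.rTensor_tmul, Algebra.TensorProduct.tmul_mul_tmul, one_mul,
            rightCanonicalMap_tmul, LinearMap.lTensor_tmul, AlgHom.toLinearMap_apply]
          induction cop a b b f with
          | zero => simp
          | add v w hv hw => simp only [mul_add, map_add, TensorProduct.tmul_add, hv, hw]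
          | tmul p q => simp [mul_assoc]
      rw [h1, ← cop_coassoc, LinearEquiv.symm_apply_apply, ← LinearMap.comp_apply,
        ← LinearMap.rTensor_comp]
      have h2 : (LinearMap.mul' k (LiuAlg n ξ a b) ∘ₗ (anti b a).rTensor _) ∘ₗ
          (cop b a b).toLinearMap = Algebra.linearMap k _ ∘ₗ (eps b).toLinearMap :=
        LinearMap.ext (mul_anti_rTensor_cop a b)
      rw [h2]
      conv_rhs => rw [← eps_rTensor_cop b b h]
      induction cop b b b h with
      | zero => simp
      | add v w hv hw => simp only [mul_add, map_add, TensorProduct.tmul_add, hv, hw]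
      | tmul p q =>
        simp [Algebra.algebraMap_eq_smul_one, ← TensorProduct.smul_tmul']

/-- Mirror image of the right-hand case: the inverse l ⊗ c ↦ l₁ ⊗ S(l₂) c uses the comultiplication
A(a,a) → A(a,b) ⊗ A(b,a). -/
theorem leftCanonicalMap_bijective (a b : k) :
    Function.Bijective (leftCanonicalMap k (cop a a b : LiuAlg n ξ a b →ₐ[k] _)) := by
  rw [Function.bijective_iff_has_inverse]
  refine ⟨leftCanonicalInv n ξ a b, fun w => ?_, fun w => ?_⟩
  · induction w with
    | zero => simp
    | add v w hv hw => rw [map_add, map_add, hv, hw]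
    | tmul d c =>
      rw [leftCanonicalMap_tmul]
      have h1 : ∀ v : LiuAlg n ξ a a ⊗[k] LiuAlg n ξ a b,
          leftCanonicalInv n ξ a b (v * (1 ⊗ₜ c)) = (LinearMap.mul' k _ ∘ₗ
            (anti b a).rTensor _).lTensor _ (TensorProduct.assoc k _ _ _
              ((cop a b a).toLinearMap.rTensor _ v)) * (1 ⊗ₜ c) := by
        intro v
        induction v with
        | zero => simp
        | add v w hv hw => simp only [add_mul, map_add, hv, hw]
        | tmul e f =>
          rw [Algebra.TensorProduct.tmul_mul_tmul, mul_one, leftCanonicalInv_tmul,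
            LinearMap.rTensor_tmul, AlgHom.toLinearMap_apply]
          induction cop a b a e with
          | zero => simp
          | add v w hv hw => simp only [add_mul, map_add, TensorProduct.add_tmul, hv, hw]
          | tmul p q => simp [mul_assoc]
      rw [h1, cop_coassoc, ← LinearMap.comp_apply, ← LinearMap.lTensor_comp]
      have h2 : (LinearMap.mul' k (LiuAlg n ξ a b) ∘ₗ (anti b a).rTensor _) ∘ₗ
          (cop b a b).toLinearMap = Algebra.linearMap k _ ∘ₗ (eps b).toLinearMap :=
        LinearMap.ext (mul_anti_rTensor_cop a b)
      rw [h2]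
      conv_rhs => rw [← eps_lTensor_cop a b d]
      induction cop a b b d with
      | zero => simp
      | add v w hv hw => simp only [add_mul, map_add, TensorProduct.add_tmul, hv, hw]
      | tmul p q =>
        simp [Algebra.algebraMap_eq_smul_one, TensorProduct.smul_tmul']
  · induction w with
    | zero => simp
    | add v w hv hw => rw [map_add, map_add, hv, hw]
    | tmul h c =>
      rw [leftCanonicalInv_tmul]
      have h1 : ∀ v : LiuAlg n ξ a b ⊗[k] LiuAlg n ξ b a,
          leftCanonicalMap k (cop a a b) ((anti b a).lTensor _ v * (1 ⊗ₜ c)) =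
            (LinearMap.mul' k _ ∘ₗ
              (anti b a).lTensor _).lTensor _ (TensorProduct.assoc k _ _ _
                ((cop a a b).toLinearMap.rTensor _ v)) * (1 ⊗ₜ c) := by
        intro v
        induction v with
        | zero => simp
        | add v w hv hw => simp only [add_mul, map_add, hv, hw]
        | tmul e f =>
          rw [LinearMap.lTensor_tmul, Algebra.TensorProduct.tmul_mul_tmul, mul_one,
            leftCanonicalMap_tmul, LinearMap.rTensor_tmul, AlgHom.toLinearMap_apply]
          induction cop a a b e with
          | zero => simp
          | add v w hv hw => simp only [add_mul, map_add, TensorProduct.add_tmul, hv, hw]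
          | tmul p q => simp [mul_assoc]
      rw [h1, cop_coassoc, ← LinearMap.comp_apply, ← LinearMap.lTensor_comp]
      have h2 : (LinearMap.mul' k (LiuAlg n ξ a b) ∘ₗ (anti b a).lTensor _) ∘ₗ
          (cop a b a).toLinearMap = Algebra.linearMap k _ ∘ₗ (eps a).toLinearMap :=
        LinearMap.ext (mul_anti_lTensor_cop a b)
      rw [h2]
      conv_rhs => rw [← eps_lTensor_cop a a h]
      induction cop a a a h with
      | zero => simp
      | add v w hv hw => simp only [add_mul, map_add, TensorProduct.add_tmul, hv, hw]
      | tmul p q =>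
        simp [Algebra.algebraMap_eq_smul_one, TensorProduct.smul_tmul']

/-! ### Coinvariants and the biGalois property -/

instance nontrivial (a b : k) : Nontrivial (LiuAlg n ξ a b) :=
  have := hn.out
  have : Nonempty (ℤ × Fin n) := ⟨(0, ⟨0, by omega⟩)⟩
  (basis n ξ a b).repr.toEquiv.nontrivial

/-- Transferred to the Hopf algebra A(a,a), the hypothesis becomes Δ(u') = u' ⊗ 1. Applying the
counit to the left factor gives u' = ε(u') 1. -/
theorem eq_algebraMap_of_cop_right (a b : k) {u : LiuAlg n ξ a b} (h : cop a b b u = u ⊗ₜ 1) :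
    u = algebraMap k _ (eps a (transfer n ξ a b a a u)) := by
  have h1 := cop_transfer a b b a a a u
  rw [h, TensorProduct.map_tmul] at h1
  have h2 := eps_rTensor_cop a a (transfer n ξ a b a a u)
  rw [h1] at h2
  simp only [LinearEquiv.coe_coe, transfer_one, LinearMap.rTensor_tmul, AlgHom.toLinearMap_apply,
    TensorProduct.lid_tmul] at h2
  apply (transfer n ξ a b a a).injective
  rw [← h2]
  simp [Algebra.algebraMap_eq_smul_one]

theorem eq_algebraMap_of_cop_left (a b : k) {u : LiuAlg n ξ a b} (h : cop a a b u = 1 ⊗ₜ u) :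
    u = algebraMap k _ (eps a (transfer n ξ a b a a u)) := by
  have h1 := cop_transfer a a b a a a u
  rw [h, TensorProduct.map_tmul] at h1
  have h2 := eps_lTensor_cop a a (transfer n ξ a b a a u)
  rw [h1] at h2
  simp only [LinearEquiv.coe_coe, transfer_one, LinearMap.lTensor_tmul, AlgHom.toLinearMap_apply,
    TensorProduct.rid_tmul] at h2
  apply (transfer n ξ a b a a).injective
  rw [← h2]
  simp [Algebra.algebraMap_eq_smul_one]

theorem isRightGaloisExtension (a b : k) :
    IsRightGaloisExtension k (cop a b b : LiuAlg n ξ a b →ₐ[k] _) where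
  coassoc := LinearMap.ext (cop_coassoc a b b b)
  counit := LinearMap.ext (eps_lTensor_cop a b)
  injective_algebraMap := (algebraMap k _).injective
  coinvariants := by
    ext u
    refine ⟨fun h => ⟨_, (eq_algebraMap_of_cop_right a b h).symm⟩, ?_⟩
    rintro ⟨r, rfl⟩
    simp [Algebra.algebraMap_eq_smul_one, Algebra.TensorProduct.one_def,
      ← TensorProduct.smul_tmul']
  bijective := rightCanonicalMap_bijective a b

theorem isLeftGaloisExtension (a b : k) :
    IsLeftGaloisExtension k (cop a a b : LiuAlg n ξ a b →ₐ[k] _) where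
  coassoc := LinearMap.ext (cop_coassoc a a a b)
  counit := LinearMap.ext (eps_rTensor_cop a b)
  injective_algebraMap := (algebraMap k _).injective
  coinvariants := by
    ext u
    refine ⟨fun h => ⟨_, (eq_algebraMap_of_cop_left a b h).symm⟩, ?_⟩
    rintro ⟨r, rfl⟩
    simp [Algebra.algebraMap_eq_smul_one, Algebra.TensorProduct.one_def]
  bijective := leftCanonicalMap_bijective a b

theorem isBiGaloisExtension (a b : k) :
    IsBiGaloisExtension k (cop a a b : LiuAlg n ξ a b →ₐ[k] _) (cop a b b) where
  left := isLeftGaloisExtension a b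
  right := isRightGaloisExtension a b
  bicomodule := LinearMap.ext (cop_coassoc a a b b)

/-! ### Cleftness -/

theorem comul_eq (a : k) :
    Coalgebra.comul (R := k) (A := LiuAlg n ξ a a) = (cop a a a).toLinearMap := rfl

theorem counit_eq (a : k) :
    Coalgebra.counit (R := k) (A := LiuAlg n ξ a a) = (eps a).toLinearMap := rfl

/-- This replaces γ ∘ S by the mixed antipode after a transfer, so that the two convolution
identities become the mixed antipode laws. -/
theorem transfer_comp_antipode (a b : k) :
    (transfer n ξ b b a b).toLinearMap ∘ₗ HopfAlgebra.antipode k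
      = anti b a ∘ₗ (transfer n ξ b b b a).toLinearMap := by
  refine LinearMap.ext fun u => ?_
  rw [LinearMap.comp_apply, LinearMap.comp_apply, LinearEquiv.coe_coe, LinearEquiv.coe_coe,
    ← transfer_anti]
  rfl

/-- All three conditions are instances of `cop_transfer`: colinearity directly, and the two inverse
laws by carrying the mixed antipode laws for A(a,a) and A(b,b) back along the transfer. -/
theorem isCleaving (a b : k) : IsCleaving k (cop a b b : LiuAlg n ξ a b →ₐ[k] _)
    (transfer n ξ b b a b).toLinearMap
    ((transfer n ξ b b a b).toLinearMap ∘ₗ HopfAlgebra.antipode k) where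
  colinear := by
    rw [comul_eq]
    refine LinearMap.ext fun u => ?_
    have : (transfer n ξ b b b b).toLinearMap = LinearMap.id := LinearMap.ext (transfer_self b b)
    have h := cop_transfer b b b a b b u
    rw [this] at h
    exact h
  mul_inv := by
    rw [convolution, comul_eq, counit_eq, transfer_comp_antipode]
    refine LinearMap.ext fun u => ?_
    have h1 := mul_anti_lTensor_cop a b (transfer n ξ b b a a u)
    rw [cop_transfer b b b a b a, eps_transfer, ← LinearMap.comp_apply (LinearMap.lTensor _ _),
      LinearMap.lTensor_comp_map] at h1
    exact h1
  inv_mul := by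
    rw [convolution, comul_eq, counit_eq, transfer_comp_antipode]
    refine LinearMap.ext fun u => ?_
    have h1 := mul_anti_rTensor_cop a b (transfer n ξ b b b b u)
    rw [cop_transfer b b b b a b, eps_transfer,
      ← LinearMap.comp_apply (LinearMap.rTensor _ _), LinearMap.rTensor_comp_map] at h1
    exact h1

end
end LiuAlg

/-! ### The multiplication map `(M ⊗ A) ⊗ (N ⊗ A) → (M ⊗ N) ⊗ A` -/

section TensorMulMap

variable {k : Type u} [Field k] {A A' : Type u} [Ring A] [Algebra k A] [Ring A'] [Algebra k A']
  {M M' N N' P : Type u} [AddCommGroup M] [Module k M] [AddCommGroup M'] [Module k M']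
  [AddCommGroup N] [Module k N] [AddCommGroup N'] [Module k N'] [AddCommGroup P] [Module k P]

theorem tensorMulMap_algHom (f : A →ₐ[k] A') (u : M ⊗[k] A) (v : N ⊗[k] A) :
    f.toLinearMap.lTensor _ (tensorMulMap k A M N (u ⊗ₜ v)) =
      tensorMulMap k A' M N (f.toLinearMap.lTensor _ u ⊗ₜ f.toLinearMap.lTensor _ v) := by
  induction u with
  | zero => simp
  | add u w hu hw => simp only [TensorProduct.add_tmul, map_add, hu, hw]
  | tmul m h =>
    induction v with
    | zero => simp
    | add u w hu hw => simp only [TensorProduct.tmul_add, map_add, hu, hw]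
    | tmul n h' => simp

theorem tensorMulMap_rTensor (f : M →ₗ[k] M') (f' : N →ₗ[k] N') (u : M ⊗[k] A) (v : N ⊗[k] A) :
    tensorMulMap k A M' N' (f.rTensor _ u ⊗ₜ f'.rTensor _ v) =
      (TensorProduct.map f f').rTensor _ (tensorMulMap k A M N (u ⊗ₜ v)) := by
  induction u with
  | zero => simp
  | add u w hu hw => simp only [TensorProduct.add_tmul, map_add, hu, hw]
  | tmul m h =>
    induction v with
    | zero => simp
    | add u w hu hw => simp only [TensorProduct.tmul_add, map_add, hu, hw]
    | tmul n h' => simp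

theorem tensorMulMap_tensorMulMap (u : M ⊗[k] A) (v : N ⊗[k] A) (w : P ⊗[k] A) :
    tensorMulMap k A M (N ⊗[k] P) (u ⊗ₜ tensorMulMap k A N P (v ⊗ₜ w)) =
      (TensorProduct.assoc k M N P).toLinearMap.rTensor A
        (tensorMulMap k A (M ⊗[k] N) P (tensorMulMap k A M N (u ⊗ₜ v) ⊗ₜ w)) := by
  induction u with
  | zero => simp
  | add u w hu hw => simp only [TensorProduct.add_tmul, map_add, hu, hw]
  | tmul m h =>
    induction v with
    | zero => simp
    | add u w hu hw =>
      simp only [TensorProduct.add_tmul, TensorProduct.tmul_add, map_add, hu, hw]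
    | tmul n h' =>
      induction w with
      | zero => simp
      | add u w hu hw => simp only [TensorProduct.tmul_add, map_add, hu, hw]
      | tmul n h' => simp [mul_assoc]

theorem tensorMulMap_tmul_one_left (r : k) (u : M ⊗[k] A) :
    (TensorProduct.lid k M).toLinearMap.rTensor A
      (tensorMulMap k A k M ((r ⊗ₜ (1 : A)) ⊗ₜ u)) = r • u := by
  induction u with
  | zero => simp
  | add u w hu hw => simp only [TensorProduct.tmul_add, map_add, smul_add, hu, hw]
  | tmul n h' => simp [TensorProduct.smul_tmul']

theorem tensorMulMap_tmul_one_right (r : k) (u : M ⊗[k] A) :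
    (TensorProduct.rid k M).toLinearMap.rTensor A
      (tensorMulMap k A M k (u ⊗ₜ (r ⊗ₜ (1 : A)))) = r • u := by
  induction u with
  | zero => simp
  | add u w hu hw => simp only [TensorProduct.add_tmul, map_add, smul_add, hu, hw]
  | tmul n h' => simp [TensorProduct.smul_tmul']

theorem assoc_tmul_tensorMulMap (u : M ⊗[k] A) (v : N ⊗[k] A) (h h' : A') :
    TensorProduct.assoc k (M ⊗[k] N) A A' (tensorMulMap k A M N (u ⊗ₜ v) ⊗ₜ (h * h')) =
      tensorMulMap k (A ⊗[k] A') M N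
        (TensorProduct.assoc k M A A' (u ⊗ₜ h) ⊗ₜ TensorProduct.assoc k N A A' (v ⊗ₜ h')) := by
  induction u with
  | zero => simp
  | add u w hu hw => simp only [TensorProduct.add_tmul, map_add, hu, hw]
  | tmul m h =>
    induction v with
    | zero => simp
    | add u w hu hw => simp only [TensorProduct.add_tmul, TensorProduct.tmul_add, map_add, hu, hw]
    | tmul n h' => simp

/-- Two algebras are allowed because the maps that occur later take values in different members of
the family, such as A(a,b) and A(b,c). -/
theorem assoc_rTensor_tensorMulMap (i : M →ₗ[k] M' ⊗[k] A) (j : N →ₗ[k] N' ⊗[k] A)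
    (u : M ⊗[k] A') (v : N ⊗[k] A') :
    TensorProduct.assoc k (M' ⊗[k] N') A A' ((tensorMulMap k A M' N' ∘ₗ
        TensorProduct.map i j).rTensor A' (tensorMulMap k A' M N (u ⊗ₜ v))) =
      tensorMulMap k (A ⊗[k] A') M' N'
        (TensorProduct.assoc k M' A A' (i.rTensor A' u) ⊗ₜ
          TensorProduct.assoc k N' A A' (j.rTensor A' v)) := by
  induction u with
  | zero => simp
  | add u w hu hw => simp only [TensorProduct.add_tmul, map_add, hu, hw]
  | tmul m h =>
    induction v with
    | zero => simp
    | add u w hu hw => simp only [TensorProduct.tmul_add, map_add, hu, hw]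
    | tmul n h' =>
      rw [tensorMulMap_tmul, LinearMap.rTensor_tmul, LinearMap.comp_apply, TensorProduct.map_tmul,
        assoc_tmul_tensorMulMap]
      simp

end TensorMulMap

namespace LiuAlg

noncomputable section

set_option linter.unusedSectionVars false

variable {k : Type u} [Field k] {n : ℕ} {ξ : k} [hn : Fact (2 ≤ n)] [hξ : Fact (IsPrimitiveRoot ξ n)]
  {M M' N N' P : Type u} [AddCommGroup M] [Module k M] [AddCommGroup M'] [Module k M']
  [AddCommGroup N] [Module k N] [AddCommGroup N'] [Module k N'] [AddCommGroup P] [Module k P]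

/-! ### Coactions of `LiuAlg n ξ a a` and the embeddings `M → M ⊗ LiuAlg n ξ a b` -/

/-- `c` is a coaction of `LiuAlg n ξ a a` on `M`. -/
structure IsCoaction (a : k) (c : M →ₗ[k] M ⊗[k] LiuAlg n ξ a a) : Prop where
  coassoc : ∀ m, TensorProduct.assoc k _ _ _ (c.rTensor _ (c m)) =
    (cop a a a).toLinearMap.lTensor _ (c m)
  counit : ∀ m, TensorProduct.rid k _ ((eps a).toLinearMap.lTensor _ (c m)) = m

/-- The map `m ↦ ∑ m₀ ⊗ m₁` with `m₁` transferred to `LiuAlg n ξ b c`. -/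
def coactTransfer {a : k} (b c : k) (ρ : M →ₗ[k] M ⊗[k] LiuAlg n ξ a a) :
    M →ₗ[k] M ⊗[k] LiuAlg n ξ b c :=
  (transfer n ξ a a b c).toLinearMap.lTensor M ∘ₗ ρ

theorem coactTransfer_apply {a : k} (b c : k) (ρ : M →ₗ[k] M ⊗[k] LiuAlg n ξ a a) (m : M) :
    coactTransfer b c ρ m = (transfer n ξ a a b c).toLinearMap.lTensor M (ρ m) := rfl

variable (n ξ M) in
/-- The left inverse of `coactTransfer a b`. -/
def contract (a b : k) : M ⊗[k] LiuAlg n ξ a b →ₗ[k] M :=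
  (TensorProduct.rid k M).toLinearMap ∘ₗ
    ((eps a).toLinearMap ∘ₗ (transfer n ξ a b a a).toLinearMap).lTensor M

theorem contract_rTensor (a b : k) (f : M →ₗ[k] N) (z : M ⊗[k] LiuAlg n ξ a b) :
    contract n ξ N a b (f.rTensor _ z) = f (contract n ξ M a b z) := by
  induction z with
  | zero => simp
  | add u w hu hw => simp only [map_add, hu, hw]
  | tmul m h => simp [contract]

theorem coactTransfer_self {a : k} (ρ : M →ₗ[k] M ⊗[k] LiuAlg n ξ a a) :
    coactTransfer a a ρ = ρ := by
  have : (transfer n ξ a a a a).toLinearMap = LinearMap.id := LinearMap.ext (transfer_self a a)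
  rw [coactTransfer, this, LinearMap.lTensor_id, LinearMap.id_comp]

theorem coactTransfer_coactTransfer {a : k} (b c d : k) (ρ : M →ₗ[k] M ⊗[k] LiuAlg n ξ a a) :
    coactTransfer c d (coactTransfer b b ρ) = coactTransfer c d ρ := by
  have : (transfer n ξ b b c d).toLinearMap ∘ₗ (transfer n ξ a a b b).toLinearMap
      = (transfer n ξ a a c d).toLinearMap := 
    LinearMap.ext fun u => transfer_transfer a a b b c d u
  rw [coactTransfer, coactTransfer, ← LinearMap.comp_assoc, ← LinearMap.lTensor_comp, this]
  rfl

theorem coactTransfer_natural {a b c : k} {ρ : M →ₗ[k] M ⊗[k] LiuAlg n ξ a a}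
    {σ : N →ₗ[k] N ⊗[k] LiuAlg n ξ a a} {f : M →ₗ[k] N} (h : ∀ m, σ (f m) = f.rTensor _ (ρ m))
    (m : M) : coactTransfer b c σ (f m) = f.rTensor _ (coactTransfer b c ρ m) := by
  rw [coactTransfer_apply, coactTransfer_apply, h, ← LinearMap.comp_apply (LinearMap.lTensor _ _),
    LinearMap.lTensor_comp_rTensor, ← LinearMap.comp_apply (LinearMap.rTensor _ _),
    LinearMap.rTensor_comp_lTensor]

namespace IsCoaction

variable {a : k} {ρ : M →ₗ[k] M ⊗[k] LiuAlg n ξ a a} {σ : N →ₗ[k] N ⊗[k] LiuAlg n ξ a a}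

theorem contract_coactTransfer (hρ : IsCoaction a ρ) (b : k) (m : M) :
    contract n ξ M a b (coactTransfer a b ρ m) = m := by
  conv_rhs => rw [← hρ.counit m]
  rw [contract, coactTransfer_apply, LinearMap.comp_apply,
    ← LinearMap.comp_apply (LinearMap.lTensor _ _), ← LinearMap.lTensor_comp]
  have : ((eps a).toLinearMap ∘ₗ (transfer n ξ a b a a).toLinearMap) ∘ₗ
      (transfer n ξ a a a b).toLinearMap = (eps (n := n) (ξ := ξ) a).toLinearMap :=
    LinearMap.ext fun u => by simp
  rw [this]
  rfl

theorem coactTransfer_injective (hρ : IsCoaction a ρ) (b : k) :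
    Function.Injective (coactTransfer a b ρ) :=
  Function.LeftInverse.injective (hρ.contract_coactTransfer b)

theorem rTensor_coactTransfer_injective (hρ : IsCoaction a ρ) (b : k) (A : Type u) [AddCommGroup A]
    [Module k A] : Function.Injective ((coactTransfer a b ρ).rTensor A) := by
  refine Function.LeftInverse.injective (g := (contract n ξ M a b).rTensor A) fun z => ?_
  have : contract n ξ M a b ∘ₗ coactTransfer a b ρ = LinearMap.id :=
    LinearMap.ext (hρ.contract_coactTransfer b)
  rw [← LinearMap.comp_apply, ← LinearMap.rTensor_comp, this, LinearMap.rTensor_id,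
    LinearMap.id_apply]

/-- Mixed coassociativity of a coaction: the transfers commute with every comultiplication, so the
coassociativity of ρ itself carries over to any triple of parameters. -/
theorem assoc_coactTransfer (hρ : IsCoaction a ρ) (a' b c : k) (m : M) :
    TensorProduct.assoc k _ _ _ ((coactTransfer a' b ρ).rTensor _ (coactTransfer b c ρ m)) =
      (cop a' b c).toLinearMap.lTensor _ (coactTransfer a' c ρ m) := by
  have h1 : ∀ z : M ⊗[k] LiuAlg n ξ a a,
      TensorProduct.assoc k _ _ _ ((coactTransfer a' b ρ).rTensor _
        ((transfer n ξ a a b c).toLinearMap.lTensor M z)) =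
      (TensorProduct.map (transfer n ξ a a a' b).toLinearMap
        (transfer n ξ a a b c).toLinearMap).lTensor M
          (TensorProduct.assoc k _ _ _ (ρ.rTensor _ z)) := by
    intro z
    induction z with
    | zero => simp
    | add u w hu hw => simp only [map_add, hu, hw]
    | tmul m h =>
      rw [LinearMap.lTensor_tmul, LinearMap.rTensor_tmul, LinearMap.rTensor_tmul, coactTransfer,
        LinearMap.comp_apply]
      induction ρ m with
      | zero => simp
      | add u w hu hw => simp only [map_add, TensorProduct.add_tmul, hu, hw]
      | tmul p q => simp
  have h2 : TensorProduct.map (transfer n ξ a a a' b).toLinearMap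
        (transfer n ξ a a b c).toLinearMap ∘ₗ (cop a a a).toLinearMap =
      (cop a' b c).toLinearMap ∘ₗ (transfer n ξ a a a' c).toLinearMap :=
    LinearMap.ext fun u => (cop_transfer a a a a' b c u).symm
  rw [coactTransfer_apply b c, h1, hρ.coassoc, ← LinearMap.comp_apply,
    ← LinearMap.lTensor_comp, h2, LinearMap.lTensor_comp]
  rfl

theorem twist (hρ : IsCoaction a ρ) (b : k) : IsCoaction b (coactTransfer b b ρ) where
  coassoc := hρ.assoc_coactTransfer b b b
  counit m := by
    conv_rhs => rw [← hρ.counit m]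
    rw [coactTransfer_apply, ← LinearMap.comp_apply (LinearMap.lTensor _ _),
      ← LinearMap.lTensor_comp]
    have : (eps b).toLinearMap ∘ₗ (transfer n ξ a a b b).toLinearMap
        = (eps (n := n) (ξ := ξ) a).toLinearMap := LinearMap.ext (eps_transfer a b)
    rw [this]

/-- The hypothesis says that z lies in the cotensor product of M with A(a,b). With
`contract_coactTransfer` this identifies M with that cotensor product. Contracting the last factor
of the hypothesis and using the counit law returns z. -/
theorem coactTransfer_contract (b : k) {z : M ⊗[k] LiuAlg n ξ a b}
    (hz : TensorProduct.assoc k _ _ _ (ρ.rTensor _ z) = (cop a a b).toLinearMap.lTensor _ z) :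
    coactTransfer a b ρ (contract n ξ M a b z) = z := by
  have h1 : ∀ z : M ⊗[k] LiuAlg n ξ a b, coactTransfer a b ρ (contract n ξ M a b z) =
      (contract n ξ _ a b).lTensor M (((transfer n ξ a a a b).toLinearMap.rTensor
        _).lTensor M (TensorProduct.assoc k _ _ _ (ρ.rTensor _ z))) := by
    intro z
    induction z with
    | zero => simp
    | add u w hu hw => simp only [map_add, hu, hw]
    | tmul m h =>
      simp only [contract, LinearMap.comp_apply, LinearMap.lTensor_tmul, LinearEquiv.coe_coe,
        TensorProduct.rid_tmul, map_smul, LinearMap.rTensor_tmul, coactTransfer]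
      induction ρ m with
      | zero => simp
      | add u w hu hw => simp only [map_add, smul_add, TensorProduct.add_tmul, hu, hw]
      | tmul p q => simp
  have h2 : contract n ξ _ a b ∘ₗ ((transfer n ξ a a a b).toLinearMap.rTensor _ ∘ₗ
      (cop a a b).toLinearMap) = LinearMap.id := by
    refine LinearMap.ext fun u => ?_
    rw [LinearMap.comp_apply, LinearMap.comp_apply, contract_rTensor, contract, LinearMap.comp_apply,
      LinearMap.lTensor_comp, LinearMap.comp_apply]
    have h3 : (transfer n ξ a b a a).toLinearMap.lTensor _ (cop a a b u)
        = cop a a a (transfer n ξ a b a a u) := by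
      have : (transfer n ξ a a a a).toLinearMap = LinearMap.id :=
        LinearMap.ext (transfer_self a a)
      rw [cop_transfer a a b a a a, this]
      rfl
    rw [AlgHom.toLinearMap_apply, h3, LinearEquiv.coe_coe, LinearEquiv.coe_coe, eps_lTensor_cop,
      transfer_transfer, transfer_self, LinearMap.id_apply]
  rw [h1, hz, ← LinearMap.comp_apply (LinearMap.lTensor M _), ← LinearMap.lTensor_comp,
    ← LinearMap.comp_apply (LinearMap.lTensor M _), ← LinearMap.lTensor_comp,
    LinearMap.comp_assoc, h2,
    LinearMap.lTensor_id, LinearMap.id_apply]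

end IsCoaction

/-! ### The tensorator -/

/-- The codiagonal coaction. -/
def tensorCoaction {a : k} (ρ : M →ₗ[k] M ⊗[k] LiuAlg n ξ a a)
    (σ : N →ₗ[k] N ⊗[k] LiuAlg n ξ a a) : M ⊗[k] N →ₗ[k] (M ⊗[k] N) ⊗[k] LiuAlg n ξ a a :=
  tensorMulMap k _ M N ∘ₗ TensorProduct.map ρ σ

/-- The map `m ⊗ n ↦ ∑ (m₀ ⊗ n₀) ⊗ m₁ n₁` with product in `LiuAlg n ξ a b`. -/
def mulTransfer {a : k} (b : k) (ρ : M →ₗ[k] M ⊗[k] LiuAlg n ξ a a)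
    (σ : N →ₗ[k] N ⊗[k] LiuAlg n ξ a a) : M ⊗[k] N →ₗ[k] (M ⊗[k] N) ⊗[k] LiuAlg n ξ a b :=
  tensorMulMap k _ M N ∘ₗ TensorProduct.map (coactTransfer a b ρ) (coactTransfer a b σ)

/-- The tensorator `M ⊗ N → M ⊗ N` of the twisting functor. -/
def tensorator {a : k} (b : k) (ρ : M →ₗ[k] M ⊗[k] LiuAlg n ξ a a)
    (σ : N →ₗ[k] N ⊗[k] LiuAlg n ξ a a) : M ⊗[k] N →ₗ[k] M ⊗[k] N :=
  contract n ξ _ a b ∘ₗ mulTransfer b ρ σ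

section
variable {a : k} {ρ : M →ₗ[k] M ⊗[k] LiuAlg n ξ a a} {σ : N →ₗ[k] N ⊗[k] LiuAlg n ξ a a}
  {τ : P →ₗ[k] P ⊗[k] LiuAlg n ξ a a}

theorem mulTransfer_tmul (b : k) (m : M) (p : N) : mulTransfer b ρ σ (m ⊗ₜ p) =
    tensorMulMap k _ M N (coactTransfer a b ρ m ⊗ₜ coactTransfer a b σ p) := rfl

theorem tensorCoaction_tmul (m : M) (p : N) : tensorCoaction ρ σ (m ⊗ₜ p) =
    tensorMulMap k _ M N (ρ m ⊗ₜ σ p) := rfl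

/-- This characterizes the tensorator: products of elements of cotensor products lie again in the
cotensor product, so contracting them loses nothing. Since `coactTransfer` is injective, later
identities are tested after applying it. -/
theorem coactTransfer_comp_tensorator (hρ : IsCoaction a ρ) (hσ : IsCoaction a σ) (b : k) :
    coactTransfer a b (tensorCoaction ρ σ) ∘ₗ tensorator b ρ σ = mulTransfer b ρ σ := by
  refine TensorProduct.ext' fun m p => ?_
  rw [LinearMap.comp_apply, tensorator, LinearMap.comp_apply]
  apply IsCoaction.coactTransfer_contract
  have h1 := hρ.assoc_coactTransfer a a b m
  have h2 := hσ.assoc_coactTransfer a a b p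
  rw [coactTransfer_self] at h1 h2
  rw [mulTransfer_tmul, tensorCoaction, assoc_rTensor_tensorMulMap, h1, h2, tensorMulMap_algHom]

/-- Comparison of `mulTransfer` and the coactions with the comultiplications. -/
theorem assoc_mulTransfer (hρ : IsCoaction a ρ) (hσ : IsCoaction a σ) (b c : k)
    (m : M) (p : N) :
    TensorProduct.assoc k _ _ _ ((mulTransfer b ρ σ).rTensor _
      (tensorMulMap k (LiuAlg n ξ b c) M N (coactTransfer b c ρ m ⊗ₜ coactTransfer b c σ p))) =
      (cop a b c).toLinearMap.lTensor _
        (tensorMulMap k (LiuAlg n ξ a c) M N (coactTransfer a c ρ m ⊗ₜ coactTransfer a c σ p)) := by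
  rw [mulTransfer, assoc_rTensor_tensorMulMap, hρ.assoc_coactTransfer, hσ.assoc_coactTransfer,
    tensorMulMap_algHom]

theorem IsCoaction.tensorCoaction (hρ : IsCoaction a ρ) (hσ : IsCoaction a σ) :
    IsCoaction a (tensorCoaction ρ σ) where
  coassoc z := by
    induction z with
    | zero => simp
    | add u w hu hw => simp only [map_add, hu, hw]
    | tmul m p =>
      have := assoc_mulTransfer hρ hσ a a m p
      simp only [mulTransfer, coactTransfer_self] at this
      exact this
  counit z := by
    induction z with
    | zero => simp
    | add u w hu hw => simp only [map_add, hu, hw]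
    | tmul m p =>
      exact (RightComod.counit_tensorMulMap M N (ρ m) (σ p)).trans
        (by rw [counit_eq, hρ.counit, hσ.counit])

/-- The tensorator is colinear. -/
theorem tensorator_colinear (hρ : IsCoaction a ρ) (hσ : IsCoaction a σ) (b : k) (z : M ⊗[k] N) :
    coactTransfer b b (tensorCoaction ρ σ) (tensorator b ρ σ z) =
      (tensorator b ρ σ).rTensor _
        (tensorCoaction (coactTransfer b b ρ) (coactTransfer b b σ) z) := by
  -- After this injective map both sides become the comultiplication A(a,b) → A(a,b) ⊗ A(b,b)
  -- applied to the product computed in A(a,b).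
  apply (hρ.tensorCoaction hσ).rTensor_coactTransfer_injective b
  apply (TensorProduct.assoc k _ _ _).injective
  rw [(hρ.tensorCoaction hσ).assoc_coactTransfer, ← LinearMap.comp_apply (LinearMap.rTensor _ _),
    ← LinearMap.rTensor_comp, coactTransfer_comp_tensorator hρ hσ, ← LinearMap.comp_apply
    (coactTransfer _ _ _), coactTransfer_comp_tensorator hρ hσ]
  induction z with
  | zero => simp
  | add u w hu hw => simp only [map_add, hu, hw]
  | tmul m p => rw [mulTransfer_tmul, tensorCoaction_tmul, assoc_mulTransfer hρ hσ]

/-- The tensorators of the two opposite twists are inverse to each other. -/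
theorem tensorator_tensorator (hρ : IsCoaction a ρ) (hσ : IsCoaction a σ) (b : k) (z : M ⊗[k] N) :
    tensorator b ρ σ (tensorator a (coactTransfer b b ρ) (coactTransfer b b σ) z) = z := by
  have hρσ := hρ.tensorCoaction hσ
  apply hρσ.coactTransfer_injective a
  -- The comultiplication A(a,a) → A(a,b) ⊗ A(b,a) is injective because, up to transfers, it is the
  -- comultiplication of a Hopf algebra, and the counit undoes that.
  have hinj : Function.Injective (LinearMap.lTensor (M ⊗[k] N)
      (cop (n := n) (ξ := ξ) a b a).toLinearMap) := by
    have : Function.LeftInverse (LinearMap.lTensor (M ⊗[k] N)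
        (contract n ξ (LiuAlg n ξ a a) b a ∘ₗ ((transfer n ξ a b a a).toLinearMap.rTensor _)))
        (LinearMap.lTensor (M ⊗[k] N) (cop (n := n) (ξ := ξ) a b a).toLinearMap) := by
      intro z
      rw [← LinearMap.comp_apply, ← LinearMap.lTensor_comp]
      have : (contract n ξ (LiuAlg n ξ a a) b a ∘ₗ ((transfer n ξ a b a a).toLinearMap.rTensor _))
          ∘ₗ (cop (n := n) (ξ := ξ) a b a).toLinearMap = LinearMap.id := by
        refine LinearMap.ext fun u => ?_
        have h := eps_lTensor_cop b b (transfer n ξ a a b b u)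
        rw [cop_transfer a b a b b b] at h
        rw [LinearMap.comp_apply, LinearMap.comp_apply, AlgHom.toLinearMap_apply,
          LinearMap.id_apply]
        apply (transfer n ξ a a b b).injective
        refine Eq.trans ?_ h
        induction cop a b a u with
        | zero => simp
        | add u w hu hw => simp only [map_add, hu, hw]
        | tmul p q => simp [contract]
      rw [this, LinearMap.lTensor_id, LinearMap.id_apply]
    exact this.injective
  apply hinj
  rw [← hρσ.assoc_coactTransfer a b a, ← hρσ.assoc_coactTransfer a b a]
  congr 1
  -- Colinearity moves the transferred coaction past the outer tensorator. Each tensorator then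
  -- meets its own coaction and is replaced by a product, in A(a,b) and in A(b,a) respectively.
  have hcol : coactTransfer b a (tensorCoaction ρ σ)
      (tensorator b ρ σ (tensorator a (coactTransfer b b ρ) (coactTransfer b b σ) z)) =
      (tensorator b ρ σ).rTensor _ (coactTransfer b a
        (tensorCoaction (coactTransfer b b ρ) (coactTransfer b b σ))
          (tensorator a (coactTransfer b b ρ) (coactTransfer b b σ) z)) := by
    rw [← coactTransfer_natural (b := b) (c := a) (tensorator_colinear hρ hσ b),
      coactTransfer_coactTransfer]
  rw [hcol, ← LinearMap.comp_apply (coactTransfer b a (tensorCoaction _ _)),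
    coactTransfer_comp_tensorator (hρ.twist b) (hσ.twist b), ← LinearMap.comp_apply
    (LinearMap.rTensor _ _), ← LinearMap.rTensor_comp, coactTransfer_comp_tensorator hρ hσ]
  apply (TensorProduct.assoc k _ _ _).injective
  rw [hρσ.assoc_coactTransfer a b a]
  clear hcol
  induction z with
  | zero => simp
  | add u w hu hw => simp only [map_add, hu, hw]
  | tmul m p =>
    rw [mulTransfer_tmul, coactTransfer_coactTransfer, coactTransfer_coactTransfer,
      assoc_mulTransfer hρ hσ, coactTransfer_self, coactTransfer_self, coactTransfer_self,
      tensorCoaction_tmul]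

theorem tensorator_bijective (hρ : IsCoaction a ρ) (hσ : IsCoaction a σ) (b : k) :
    Function.Bijective (tensorator b ρ σ) := by
  have h := tensorator_tensorator (hρ.twist b) (hσ.twist b) a
  have h' := tensorator_tensorator hρ hσ b
  simp only [coactTransfer_coactTransfer, coactTransfer_self] at h
  exact Function.bijective_iff_has_inverse.2 ⟨_, h, h'⟩

theorem tensorator_natural {ρ' : M' →ₗ[k] M' ⊗[k] LiuAlg n ξ a a}
    {σ' : N' →ₗ[k] N' ⊗[k] LiuAlg n ξ a a} {f : M →ₗ[k] M'} {f' : N →ₗ[k] N'}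
    (hf : ∀ m, ρ' (f m) = f.rTensor _ (ρ m)) (hf' : ∀ m, σ' (f' m) = f'.rTensor _ (σ m)) (b : k)
    (z : M ⊗[k] N) : tensorator b ρ' σ' (TensorProduct.map f f' z) =
      TensorProduct.map f f' (tensorator b ρ σ z) := by
  rw [tensorator, LinearMap.comp_apply, tensorator, LinearMap.comp_apply, ← contract_rTensor]
  congr 1
  induction z with
  | zero => simp
  | add u w hu hw => simp only [map_add, hu, hw]
  | tmul m p =>
    rw [TensorProduct.map_tmul, mulTransfer_tmul, mulTransfer_tmul, coactTransfer_natural hf,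
      coactTransfer_natural hf', tensorMulMap_rTensor]

/-- By `coactTransfer_comp_tensorator` the inner tensorator is absorbed into a product, so both
sides contract the triple product m₁ n₁ p₁; associativity of A(a,b) finishes. -/
theorem tensorator_assoc (hρ : IsCoaction a ρ) (hσ : IsCoaction a σ) (hτ : IsCoaction a τ) (b : k)
    (z : (M ⊗[k] N) ⊗[k] P) :
    TensorProduct.assoc k M N P (tensorator b (tensorCoaction ρ σ) τ
      ((tensorator b ρ σ).rTensor P z)) =
    tensorator b ρ (tensorCoaction σ τ) ((tensorator b σ τ).lTensor M
      (TensorProduct.assoc k M N P z)) := by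
  have hl : ∀ z : (M ⊗[k] N) ⊗[k] P, mulTransfer b (tensorCoaction ρ σ) τ
      ((tensorator b ρ σ).rTensor P z) = tensorMulMap k (LiuAlg n ξ a b) (M ⊗[k] N) P
        (TensorProduct.map (mulTransfer b ρ σ) (coactTransfer a b τ) z) := by
    intro z
    rw [mulTransfer, LinearMap.comp_apply, ← LinearMap.comp_apply (TensorProduct.map _ _),
      LinearMap.map_comp_rTensor, coactTransfer_comp_tensorator hρ hσ]
  have hr : ∀ z : M ⊗[k] (N ⊗[k] P), mulTransfer b ρ (tensorCoaction σ τ)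
      ((tensorator b σ τ).lTensor M z) = tensorMulMap k (LiuAlg n ξ a b) M (N ⊗[k] P)
        (TensorProduct.map (coactTransfer a b ρ) (mulTransfer b σ τ) z) := by
    intro z
    rw [mulTransfer, LinearMap.comp_apply, ← LinearMap.comp_apply (TensorProduct.map _ _),
      LinearMap.map_comp_lTensor, coactTransfer_comp_tensorator hσ hτ]
  rw [tensorator, LinearMap.comp_apply, hl, tensorator, LinearMap.comp_apply, hr]
  rw [← LinearEquiv.coe_coe, ← contract_rTensor]
  congr 1
  induction z with
  | zero => simp
  | add u w hu hw => simp only [map_add, hu, hw]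
  | tmul z p =>
    induction z with
    | zero => simp
    | add u w hu hw => simp only [map_add, TensorProduct.add_tmul, hu, hw]
    | tmul m q =>
      rw [TensorProduct.map_tmul, mulTransfer_tmul, LinearEquiv.coe_coe, TensorProduct.assoc_tmul,
        TensorProduct.map_tmul, mulTransfer_tmul, tensorMulMap_tensorMulMap]

theorem tensorator_lid (hσ : IsCoaction a σ) (b : k) {ε : k →ₗ[k] k ⊗[k] LiuAlg n ξ a a}
    (hε : ∀ r, ε r = r ⊗ₜ 1) (z : k ⊗[k] N) :
    TensorProduct.lid k N (tensorator b ε σ z) = TensorProduct.lid k N z := by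
  rw [tensorator, LinearMap.comp_apply, ← LinearEquiv.coe_coe, ← contract_rTensor]
  induction z with
  | zero => simp
  | add u w hu hw => simp only [map_add, hu, hw]
  | tmul r p =>
    have : coactTransfer a b ε r = r ⊗ₜ 1 := by simp [coactTransfer, hε]
    rw [mulTransfer_tmul, this, tensorMulMap_tmul_one_left, map_smul, hσ.contract_coactTransfer]
    simp

theorem tensorator_rid (hρ : IsCoaction a ρ) (b : k) {ε : k →ₗ[k] k ⊗[k] LiuAlg n ξ a a}
    (hε : ∀ r, ε r = r ⊗ₜ 1) (z : M ⊗[k] k) :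
    TensorProduct.rid k M (tensorator b ρ ε z) = TensorProduct.rid k M z := by
  rw [tensorator, LinearMap.comp_apply, ← LinearEquiv.coe_coe, ← contract_rTensor]
  induction z with
  | zero => simp
  | add u w hu hw => simp only [map_add, hu, hw]
  | tmul p r =>
    have : coactTransfer a b ε r = r ⊗ₜ 1 := by simp [coactTransfer, hε]
    rw [mulTransfer_tmul, this, tensorMulMap_tmul_one_right, map_smul, hρ.contract_coactTransfer]
    simp

end

end
end LiuAlg

namespace LiuAlg
open CategoryTheory MonoidalCategory

noncomputable section

set_option linter.unusedSectionVars false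

variable {k : Type u} [Field k] {n : ℕ} {ξ : k} [hn : Fact (2 ≤ n)] [hξ : Fact (IsPrimitiveRoot ξ n)]

/-! ### The monoidal equivalence -/

theorem isCoaction_coact {a : k} (M : RightComod k (LiuAlg n ξ a a)) : IsCoaction a M.coact where
  coassoc := M.coassoc_apply
  counit := M.counit_apply

/-- The comodule over `LiuAlg n ξ b b` obtained by transferring the coaction. -/
def twistObj {a : k} (b : k) (M : RightComod k (LiuAlg n ξ a a)) :
    RightComod k (LiuAlg n ξ b b) where
  carrier := M.carrier
  coact := coactTransfer b b M.coact
  coassoc := LinearMap.ext ((isCoaction_coact M).twist b).coassoc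
  counit := LinearMap.ext ((isCoaction_coact M).twist b).counit

variable (n ξ) in
/-- The functor of comodules given by the transfer of coactions. -/
def twistFunctor (a b : k) : RightComod k (LiuAlg n ξ a a) ⥤ RightComod k (LiuAlg n ξ b b) where
  obj := twistObj b
  map {M N} f := RightComod.ofLin (M := twistObj b M) (N := twistObj b N)
    (RightComod.Hom.lin (M := M) (N := N) f) (coactTransfer_natural (RightComod.Hom.coact_lin f))

/-- Twisting back and forth gives an isomorphic comodule. -/
def twistTwistIso {a : k} (b : k) (M : RightComod k (LiuAlg n ξ a a)) :
    M ≅ twistObj a (twistObj b M) :=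
  RightComod.isoOfEquiv (N := twistObj a (twistObj b M)) (LinearEquiv.refl k M.carrier) fun m => by
    have : coactTransfer a a (coactTransfer b b M.coact) = M.coact := by
      rw [coactTransfer_coactTransfer, coactTransfer_self]
    refine (LinearMap.congr_fun this m).trans ?_
    exact (LinearMap.congr_fun (LinearMap.rTensor_id (LiuAlg n ξ a a) M.carrier) _).symm

variable (n ξ) in
/-- The equivalence of comodule categories given by the transfer of coactions. -/
def twistEquivalence (a b : k) :
    RightComod k (LiuAlg n ξ a a) ≌ RightComod k (LiuAlg n ξ b b) :=
  CategoryTheory.Equivalence.mk (twistFunctor n ξ a b) (twistFunctor n ξ b a)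
    (NatIso.ofComponents (fun M => twistTwistIso b M) fun _ => RightComod.hom_ext rfl)
    (NatIso.ofComponents (fun M => (twistTwistIso a M).symm) fun _ => RightComod.hom_ext rfl)

/-- The tensorator of the twisting functor, as an isomorphism. -/
def tensoratorIso {a : k} (b : k) (M N : RightComod k (LiuAlg n ξ a a)) :
    RightComod.tensor (twistObj b M) (twistObj b N) ≅ twistObj b (RightComod.tensor M N) :=
  RightComod.isoOfEquiv (M := RightComod.tensor (twistObj b M) (twistObj b N))
    (N := twistObj b (RightComod.tensor M N))
    (LinearEquiv.ofBijective (tensorator b M.coact N.coact)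
      (tensorator_bijective (isCoaction_coact M) (isCoaction_coact N) b))
    (tensorator_colinear (isCoaction_coact M) (isCoaction_coact N) b)

theorem lTensor_transfer_tmul_one (a b r : k) :
    (transfer n ξ a a b b).toLinearMap.lTensor k (r ⊗ₜ[k] 1) =
      (LinearEquiv.refl k k).toLinearMap.rTensor _ (r ⊗ₜ[k] 1) := by
  simp

variable (n ξ) in
/-- The unit comparison of the twisting functor. -/
def unitIso (a b : k) : RightComod.unit k (LiuAlg n ξ b b) ≅
    twistObj b (RightComod.unit k (LiuAlg n ξ a a)) :=
  RightComod.isoOfEquiv (M := RightComod.unit k (LiuAlg n ξ b b))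
    (N := twistObj b (RightComod.unit k (LiuAlg n ξ a a))) (LinearEquiv.refl k k) fun r =>
      lTensor_transfer_tmul_one a b r

variable (n ξ) in
/-- The twisting functor is monoidal. -/
def twistCoreMonoidal (a b : k) : (twistFunctor n ξ a b).CoreMonoidal where
  εIso := unitIso n ξ a b
  μIso M N := tensoratorIso b M N
  μIso_hom_natural_left {M N} f P := RightComod.hom_ext <| LinearMap.ext <|
    tensorator_natural (RightComod.Hom.coact_lin f) (RightComod.Hom.coact_lin (𝟙 P)) b
  μIso_hom_natural_right {M N} P f := RightComod.hom_ext <| LinearMap.ext <|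
    tensorator_natural (RightComod.Hom.coact_lin (𝟙 P)) (RightComod.Hom.coact_lin f) b
  associativity M N P := RightComod.hom_ext <| LinearMap.ext <|
    tensorator_assoc (isCoaction_coact M) (isCoaction_coact N) (isCoaction_coact P) b
  left_unitality M := RightComod.hom_ext <| LinearMap.ext fun z => by
    refine (tensorator_lid (isCoaction_coact M) b (ε := (RightComod.unit k _).coact)
      (fun _ => rfl) z).symm.trans ?_
    exact congrArg (fun w => TensorProduct.lid k M.carrier (tensorator b (RightComod.unit k _).coact M.coact w))
      (LinearMap.congr_fun TensorProduct.map_id z).symm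
  right_unitality M := RightComod.hom_ext <| LinearMap.ext fun z => by
    refine (tensorator_rid (isCoaction_coact M) b (ε := (RightComod.unit k _).coact)
      (fun _ => rfl) z).symm.trans ?_
    exact congrArg (fun w => TensorProduct.rid k M.carrier (tensorator b M.coact (RightComod.unit k _).coact w))
      (LinearMap.congr_fun TensorProduct.map_id z).symm

/-- The functor does not change underlying linear maps, so additivity and linearity are
definitional; the content lies in the tensorator. -/
theorem monoidallyMoritaTakeuchiEquivalent (a b : k) :
    MonoidallyMoritaTakeuchiEquivalent k (LiuAlg n ξ a a) (LiuAlg n ξ b b) :=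
  ⟨twistEquivalence n ξ a b, ⟨(twistCoreMonoidal n ξ a b).toMonoidal⟩,
    { map_add := RightComod.hom_ext rfl }, { map_smul := fun _ _ => RightComod.hom_ext rfl }⟩

end
end LiuAlg

/-! ### Homological dimensions: general facts -/

section Homological
open CategoryTheory

noncomputable section

variable {R : Type u} [Ring R]

/-- Every ideal of a localization is extended from its contraction, and a generator of the
contraction generates the extension. -/
theorem IsLocalization.isPrincipalIdealRing_of_isPrincipalIdealRing {A B : Type*} [CommRing A]
    [CommRing B] [Algebra A B] (S : Submonoid A) [IsLocalization S B] [IsPrincipalIdealRing A] :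
    IsPrincipalIdealRing B := by
  refine ⟨fun J => ?_⟩
  rw [← IsLocalization.map_under S B J]
  obtain ⟨a, ha⟩ := (IsPrincipalIdealRing.principal (Ideal.under A J)).principal
  rw [ha]
  exact ⟨algebraMap A B a, by rw [Ideal.submodule_span_eq, Ideal.map_span, Set.image_singleton]⟩

/-- Left ideals of a ring that is finite and torsion free over a principal ideal domain are
projective over the domain. -/
theorem Ideal.projective_of_finite_torsionFree (A : Type*) [CommRing A] [IsDomain A]
    [IsPrincipalIdealRing A] [Module A R] [IsScalarTower A R R] [Module.Finite A R]
    [Module.IsTorsionFree A R] (I : Ideal R) : Module.Projective A I := by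
  have : IsNoetherian A R := isNoetherian_of_isNoetherianRing_of_finite A R
  have : Module.Finite A I := inferInstanceAs (Module.Finite A (I.restrictScalars A))
  have : Module.Free A I := Module.free_of_finite_type_torsion_free'
  infer_instance

/-- Baer's criterion for the quotients of an injective module. -/
theorem Module.Injective.of_surjective_of_lift {J C : Type u} [AddCommGroup J] [AddCommGroup C]
    [Module R J] [Module R C] [hJ : Module.Injective R J] (q : J →ₗ[R] C)
    (h : ∀ (I : Ideal R) (f : I →ₗ[R] C), ∃ f' : I →ₗ[R] J, q ∘ₗ f' = f) :
    Module.Injective R C := by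
  refine Module.Baer.injective fun I f => ?_
  obtain ⟨f', hf'⟩ := h I f
  obtain ⟨F, hF⟩ := Module.Baer.of_injective hJ I f'
  exact ⟨q ∘ₗ F, fun m hm => by rw [LinearMap.comp_apply, hF m hm, ← hf']; rfl⟩

/-- By Baer's criterion the cokernel of M → J is injective as soon as maps from left ideals into it
lift to J; then 0 → M → J → J/M → 0 is an injective resolution of length one. -/
theorem hasInjectiveDimensionLT_two_of_lift {M J : Type u} [AddCommGroup M] [Module R M]
    [AddCommGroup J] [Module R J] [hJ : Module.Injective R J] (i : M →ₗ[R] J)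
    (hi : Function.Injective i) (h : ∀ (I : Ideal R) (f : I →ₗ[R] J ⧸ LinearMap.range i),
      ∃ f' : I →ₗ[R] J, (LinearMap.range i).mkQ ∘ₗ f' = f) :
    HasInjectiveDimensionLT (ModuleCat.of R M) 2 := by
  have hC : Module.Injective R (J ⧸ LinearMap.range i) :=
    Module.Injective.of_surjective_of_lift (LinearMap.range i).mkQ h
  have hS := ModuleCat.shortComplex_shortExact (ModuleCat.shortComplexOfCompEqZero _ _
    i.exact_map_mkQ_range.linearMap_comp_eq_zero) i.exact_map_mkQ_range hi
      (Submodule.mkQ_surjective _)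
  refine (hS.hasInjectiveDimensionLT_X₃_iff 0 ?_).1 ?_
  · exact (Module.injective_iff_injective_object R J).1 hJ
  · have := (Module.injective_iff_injective_object R _).1 hC
    exact injective_iff_hasInjectiveDimensionLT_one.1 this

theorem exists_injective_embedding (M : Type u) [AddCommGroup M] [Module R M] :
    ∃ (J : Type u) (_ : AddCommGroup J) (_ : Module R J) (_ : Module.Injective R J)
      (i : M →ₗ[R] J), Function.Injective i := by
  obtain ⟨⟨J, hJ, f, hf⟩⟩ := EnoughInjectives.presentation (ModuleCat.of R M)
  exact ⟨J, inferInstance, inferInstance, Module.injective_module_of_injective_object R J, f.hom,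
    (ModuleCat.mono_iff_injective f).1 hf⟩

/-- A ring whose left ideals are projective has left global dimension at most one. -/
theorem leftGlobalDim_le_one_of_projective_ideal (h : ∀ I : Ideal R, Module.Projective R I) :
    leftGlobalDim R ≤ 1 := by
  -- Maps out of projective ideals always lift, so every module has injective dimension at most one.
  -- Hence Ext² vanishes identically, and projective dimensions are at most one as well.
  have hid : ∀ M : ModuleCat.{u} R, HasInjectiveDimensionLT M 2 := by
    intro M
    obtain ⟨J, _, _, _, i, hi⟩ := exists_injective_embedding (R := R) M
    exact hasInjectiveDimensionLT_two_of_lift i hi fun I f =>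
      have := h I
      Module.projective_lifting_property _ f (Submodule.mkQ_surjective _)
  refine iSup_le fun M => ?_
  refine (projectiveDimension_le_iff M 1).2 ?_
  exact hasProjectiveDimensionLT_of_enoughInjectives M 2 fun Y =>
    have := hid Y
    HasInjectiveDimensionLT.subsingleton Y 2 2 le_rfl M

/-- A ring with a nonprojective left module has left global dimension at least one. -/
theorem one_le_leftGlobalDim {M : Type u} [AddCommGroup M] [Module R M]
    (h : ¬ Module.Projective R M) : 1 ≤ leftGlobalDim R := by
  refine le_trans ?_ (le_iSup _ (ModuleCat.of R M))
  refine (projectiveDimension_ge_iff _ 1).2 fun h' => h ?_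
  exact (IsProjective.iff_projective M).2 (projective_iff_hasProjectiveDimensionLT_one.2 h')

/-! ### Frobenius forms and injective dimension -/

/-- Existence of the linear map adjoint to an `A`-linear form, for a Frobenius form `lam`. -/
theorem exists_linearMap_of_frobenius {A : Type u} [CommRing A] [Module A R] [IsScalarTower A R R]
    (lam : R →ₗ[A] A) (hinj : ∀ r, (∀ u, lam (u * r) = 0) → r = 0)
    (hsurj : ∀ f : R →ₗ[A] A, ∃ r, ∀ u, f u = lam (u * r))
    {E : Type*} [AddCommGroup E] [Module R E] [Module A E] [IsScalarTower A R E]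
    (f : E →ₗ[A] A) : ∃ F : E →ₗ[R] R, ∀ e, lam (F e) = f e := by
  -- For fixed e the map u ↦ f (u • e) is an A-linear form on R, hence represented by an element,
  -- which is unique by nondegeneracy. Uniqueness makes F linear over R, and u = 1 gives the
  -- required identity.
  have h : ∀ e : E, ∃ r, ∀ u, f (u • e) = lam (u * r) := fun e =>
    hsurj (f ∘ₗ (LinearMap.toSpanSingleton R E e).restrictScalars A)
  choose F hF using h
  have hext : ∀ r s, (∀ u, lam (u * r) = lam (u * s)) → r = s := fun r s hrs =>
    sub_eq_zero.1 (hinj _ fun u => by rw [mul_sub, map_sub, hrs, sub_self])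
  refine ⟨⟨⟨F, fun e e' => hext _ _ fun u => ?_⟩, fun s e => hext _ _ fun u => ?_⟩, fun e => ?_⟩
  · rw [mul_add, map_add, ← hF, ← hF, ← hF, smul_add, map_add]
  · rw [← hF, RingHom.id_apply, smul_eq_mul, ← mul_assoc, ← hF, smul_smul]
  · have := hF e 1
    rw [one_smul, one_mul] at this
    exact this.symm

set_option maxHeartbeats 1000000 in
/-- Over a ring with a Frobenius form, `A`-linear lifts to an extension of the regular module can be
replaced by linear lifts. -/
theorem exists_lift_of_frobenius {A : Type u} [CommRing A] [Module A R] [IsScalarTower A R R]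
    (lam : R →ₗ[A] A) (hinj : ∀ r, (∀ u, lam (u * r) = 0) → r = 0)
    (hsurj : ∀ f : R →ₗ[A] A, ∃ r, ∀ u, f u = lam (u * r))
    {I J C : Type*} [AddCommGroup I] [Module R I] [Module A I] [IsScalarTower A R I]
    [AddCommGroup J] [Module R J] [Module A J] [IsScalarTower A R J] [AddCommGroup C] [Module R C]
    {i : R →ₗ[R] J} (hi : Function.Injective i) {q : J →ₗ[R] C}
    (hq : ∀ j, q j = 0 ↔ ∃ r, i r = j) (g : I →ₗ[R] C) (h₀ : I →ₗ[A] J)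
    (hh₀' : ∀ m, q (h₀ m) = g m) : ∃ h : I →ₗ[R] J, q ∘ₗ h = g := by
  -- E is the pullback of J → C ← I, an extension of I by R. The A-linear lift h₀ provides an
  -- A-linear retraction π of E onto R.
  let E : Submodule R (J × I) := LinearMap.ker (q ∘ₗ LinearMap.fst R J I - g ∘ₗ LinearMap.snd R J I)
  have hE : ∀ e : J × I, e ∈ E ↔ q e.1 = g e.2 := fun e => by
    rw [LinearMap.mem_ker, LinearMap.sub_apply, sub_eq_zero]; rfl
  have hret : ∀ e : E, ∃ r, i r = e.1.1 - h₀ e.1.2 := fun e =>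
    (hq _).1 (by rw [map_sub, hh₀', (hE e.1).1 e.2, sub_self])
  choose π hπ using hret
  let πl : E →ₗ[A] R :=
    { toFun := π
      map_add' := fun e e' => hi (by
        rw [map_add, hπ, hπ, hπ]
        simp only [Submodule.coe_add, Prod.fst_add, Prod.snd_add, map_add]
        abel)
      map_smul' := fun a e => hi (by
        have h1 : i (a • π e) = a • i (π e) := (i.restrictScalars A).map_smul a _
        rw [RingHom.id_apply, h1, hπ, hπ, smul_sub, ← map_smul]
        rfl) }
  -- The form lam ∘ π is represented by an R-linear map F. Nondegeneracy shows that F is again a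
  -- retraction, so the extension splits over R.
  obtain ⟨F, hF⟩ := exists_linearMap_of_frobenius lam hinj hsurj (lam ∘ₗ πl)
  let ι : R →ₗ[R] E := LinearMap.codRestrict E (LinearMap.inl R J I ∘ₗ i) fun r => by
    rw [hE]
    simpa using (hq _).2 ⟨r, rfl⟩
  have hπι : ∀ r, π (ι r) = r := fun r => hi (by rw [hπ]; simp [ι])
  have hFι : ∀ r, F (ι r) = r := by
    intro r
    refine sub_eq_zero.1 (hinj _ fun u => ?_)
    have h1 : u * F (ι r) = F (ι (u * r)) := by
      rw [← smul_eq_mul, ← map_smul, ← map_smul, smul_eq_mul]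
    have h2 : lam (F (ι (u * r))) = lam (u * r) := by
      rw [hF]
      change lam (π (ι (u * r))) = _
      rw [hπι]
    rw [mul_sub, map_sub, h1, h2, sub_self]
  let e₀ : I → E := fun m => ⟨(h₀ m, m), (hE _).2 (hh₀' m)⟩
  -- The difference e.1.1 - i (F e) depends only on the component of e in I. This makes the
  -- resulting lift R-linear although the section `e₀` is not.
  have hdiff : ∀ e e' : E, e.1.2 = e'.1.2 → e.1.1 - i (F e) = e'.1.1 - i (F e') := by
    intro e e' hee
    obtain ⟨r, hr⟩ : ∃ r, i r = e.1.1 - e'.1.1 := (hq _).1 (by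
      rw [map_sub, (hE _).1 e.2, (hE _).1 e'.2, hee, sub_self])
    have : e - e' = ι r := by
      ext1
      refine Prod.ext ?_ ?_
      · exact hr.symm
      · change e.1.2 - e'.1.2 = 0
        rw [hee, sub_self]
    have h2 : F e - F e' = r := by rw [← map_sub, this, hFι]
    rw [sub_eq_sub_iff_sub_eq_sub, ← map_sub, h2, hr]
  refine ⟨⟨⟨fun m => h₀ m - i (F (e₀ m)), fun m m' => ?_⟩, fun u m => ?_⟩, ?_⟩
  · have := hdiff (e₀ (m + m')) (e₀ m + e₀ m') rfl
    refine this.trans ?_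
    rw [map_add, map_add, Submodule.coe_add, Prod.fst_add]
    change h₀ m + h₀ m' - _ = _
    abel
  · have := hdiff (e₀ (u • m)) (u • e₀ m) rfl
    refine this.trans ?_
    rw [map_smul, map_smul, Submodule.coe_smul, Prod.smul_fst, RingHom.id_apply, smul_sub]
  · refine LinearMap.ext fun m => ?_
    change q (h₀ m - i (F (e₀ m))) = g m
    rw [map_sub, hh₀', (hq _).2 ⟨_, rfl⟩, sub_zero]

/-- Restriction of scalars along `a ↦ a • 1`. -/
theorem exists_module_isScalarTower (A : Type*) [CommRing A] [Module A R] [IsScalarTower A R R]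
    (J : Type*) [AddCommGroup J] [Module R J] : ∃ _ : Module A J, IsScalarTower A R J := by
  let φ : A →+* R :=
    { toFun := fun a => a • 1
      map_one' := one_smul _ _
      map_mul' := fun a b => by rw [smul_mul_assoc, one_mul, mul_smul]
      map_zero' := zero_smul _ _
      map_add' := fun a b => add_smul _ _ _ }
  refine ⟨Module.compHom J φ, @IsScalarTower.mk _ _ _ _ _ (_) fun a r j => ?_⟩
  change (a • r) • j = (a • (1 : R)) • (r • j)
  rw [smul_smul, smul_mul_assoc, one_mul]

theorem exists_quotient_lift {A : Type u} [CommRing A] [Module A R]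
    {I J : Type u} [AddCommGroup I] [Module R I] [Module A I] [IsScalarTower A R I]
    [AddCommGroup J] [Module R J] [Module A J] [IsScalarTower A R J] [Module.Projective A I]
    (N : Submodule R J) (g : I →ₗ[R] J ⧸ N) : ∃ h₀ : I →ₗ[A] J, ∀ m, N.mkQ (h₀ m) = g m := by
  obtain ⟨h₀, hh₀⟩ := Module.projective_lifting_property
    (N.mkQ.restrictScalars A) (g.restrictScalars A) (Submodule.mkQ_surjective _)
  exact ⟨h₀, fun m => LinearMap.congr_fun hh₀ m⟩

/-- A ring that is finite, torsion free and Frobenius over a principal ideal domain has injective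
dimension at most one. -/
theorem hasInjectiveDimensionLT_two_of_frobenius (A : Type u) [CommRing A] [IsDomain A]
    [IsPrincipalIdealRing A] [Module A R] [IsScalarTower A R R] [Module.Finite A R]
    [Module.IsTorsionFree A R] (lam : R →ₗ[A] A) (hinj : ∀ r, (∀ u, lam (u * r) = 0) → r = 0)
    (hsurj : ∀ f : R →ₗ[A] A, ∃ r, ∀ u, f u = lam (u * r)) :
    HasInjectiveDimensionLT (ModuleCat.of R R) 2 := by
  obtain ⟨J, _, _, hJ, i, hi⟩ := exists_injective_embedding (R := R) R
  obtain ⟨_, _⟩ := exists_module_isScalarTower (R := R) A J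
  refine hasInjectiveDimensionLT_two_of_lift i hi fun I g => ?_
  have := Ideal.projective_of_finite_torsionFree A I
  obtain ⟨h₀, hh₀⟩ := exists_quotient_lift (A := A) (LinearMap.range i) g
  refine exists_lift_of_frobenius lam hinj hsurj hi (fun j => ?_) g h₀ hh₀
  exact Submodule.Quotient.mk_eq_zero _

theorem leftInjDim_eq_one (h₂ : HasInjectiveDimensionLT (ModuleCat.of R R) 2)
    (h₁ : ¬ Module.Injective R R) : leftInjDim R = 1 := by
  refine le_antisymm ((injectiveDimension_le_iff _ 1).2 h₂) ?_
  refine (injectiveDimension_ge_iff _ 1).2 fun h => h₁ ?_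
  exact (Module.injective_iff_injective_object R R).2 (injective_iff_hasInjectiveDimensionLT_one.2 h)

/-! ### Periodic resolutions -/

/-- The left annihilator of y is Rw, so right multiplication by y gives an exact sequence 0 → R/Rw →
R → R/Ry → 0 with projective middle term. -/
theorem hasProjectiveDimensionLT_quotient_span_iff {y w : R}
    (h : ∀ u : R, u * y = 0 ↔ ∃ v, u = v * w) (i : ℕ) :
    HasProjectiveDimensionLT (ModuleCat.of R (R ⧸ Ideal.span {y})) (i + 2) ↔
      HasProjectiveDimensionLT (ModuleCat.of R (R ⧸ Ideal.span {w})) (i + 1) := by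
  let r : R →ₗ[R] R := LinearMap.toSpanSingleton R R y
  have hker : LinearMap.ker r = Ideal.span {w} := by
    ext u
    rw [LinearMap.mem_ker, Ideal.mem_span_singleton']
    exact (h u).trans ⟨fun ⟨v, hv⟩ => ⟨v, hv.symm⟩, fun ⟨v, hv⟩ => ⟨v, hv.symm⟩⟩
  have hrange : LinearMap.range r = Ideal.span {y} := LinearMap.range_toSpanSingleton y
  let f : (R ⧸ Ideal.span {w}) →ₗ[R] R := Submodule.liftQ _ r hker.ge
  have hfr : LinearMap.range f = Ideal.span {y} := (Submodule.range_liftQ _ _ _).trans hrange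
  have hf : Function.Injective f := by
    rw [← LinearMap.ker_eq_bot]
    exact Submodule.ker_liftQ_eq_bot _ _ _ hker.le
  have hexact : Function.Exact f (Submodule.mkQ (Ideal.span {y})) := by
    rw [LinearMap.exact_iff, Submodule.ker_mkQ, hfr]
  have hS := ModuleCat.shortComplex_shortExact (ModuleCat.shortComplexOfCompEqZero f
    (Submodule.mkQ (Ideal.span {y})) hexact.linearMap_comp_eq_zero) hexact hf
      (Submodule.mkQ_surjective _)
  exact hS.hasProjectiveDimensionLT_X₃_iff i ((IsProjective.iff_projective R).1 inferInstance)

/-- R/Ry and R/Rw are syzygies of each other, so a finite projective dimension could be lowered step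
by step until one of them, and then R/Rw, were projective. The condition `hp` excludes this: R/Rw is
projective only if w is von Neumann regular. -/
theorem leftGlobalDim_eq_top_of_periodic {y w : R} (hy : ∀ u : R, u * y = 0 ↔ ∃ v, u = v * w)
    (hw : ∀ u : R, u * w = 0 ↔ ∃ v, u = v * y) (hp : ∀ v, w ≠ w * v * w) :
    leftGlobalDim R = ⊤ := by
  have h0 : ¬ HasProjectiveDimensionLT (ModuleCat.of R (R ⧸ Ideal.span {w})) 1 := by
    intro h
    have : Module.Projective R (R ⧸ Ideal.span {w}) :=
      (IsProjective.iff_projective _).2 (projective_iff_hasProjectiveDimensionLT_one.2 h)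
    obtain ⟨s, hs⟩ := Module.projective_lifting_property (Submodule.mkQ (Ideal.span {w}))
      LinearMap.id (Submodule.mkQ_surjective _)
    have h1 := LinearMap.congr_fun hs (Submodule.Quotient.mk 1)
    rw [LinearMap.comp_apply, LinearMap.id_apply, Submodule.mkQ_apply, Submodule.Quotient.eq,
      Ideal.mem_span_singleton'] at h1
    -- The section sends the class of 1 to 1 + v w, which w annihilates from the left; thus w = w
    -- (-v) w.
    obtain ⟨v, hv⟩ := h1
    have h2 : w * s (Submodule.Quotient.mk 1) = 0 := by
      rw [← smul_eq_mul, ← map_smul, ← Submodule.Quotient.mk_smul, smul_eq_mul, mul_one,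
        (Submodule.Quotient.mk_eq_zero _).2 (Ideal.mem_span_singleton_self w), map_zero]
    rw [sub_eq_iff_eq_add.1 hv.symm, mul_add, mul_one, ← mul_assoc] at h2
    refine hp (-v) ?_
    rw [mul_neg, neg_mul]
    exact eq_neg_of_add_eq_zero_right h2
  have key : ∀ i, ¬ HasProjectiveDimensionLT (ModuleCat.of R (R ⧸ Ideal.span {w})) (i + 1) ∧
      ¬ HasProjectiveDimensionLT (ModuleCat.of R (R ⧸ Ideal.span {y})) (i + 1) := by
    intro i
    induction i with
    | zero =>
      refine ⟨h0, fun h => h0 ?_⟩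
      exact (hasProjectiveDimensionLT_quotient_span_iff hy 0).1
        (hasProjectiveDimensionLT_of_ge _ 1 2 (by omega))
    | succ i ih =>
      exact ⟨fun h => ih.2 ((hasProjectiveDimensionLT_quotient_span_iff hw i).1 h),
        fun h => ih.1 ((hasProjectiveDimensionLT_quotient_span_iff hy i).1 h)⟩
  refine top_le_iff.1 (le_trans ?_ (le_iSup _ (ModuleCat.of R (R ⧸ Ideal.span {w}))))
  refine top_le_iff.2 (not_not.1 fun h => ?_)
  obtain ⟨i, hi⟩ := (projectiveDimension_ne_top_iff _).1 h
  exact (key i).1 hi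

/-! ### Invariance under ring isomorphisms -/

attribute [local instance] RingHomInvPair.of_ringEquiv in
theorem leftGlobalDim_le_of_ringEquiv {S : Type u} [Ring S] (e : R ≃+* S) :
    leftGlobalDim R ≤ leftGlobalDim S := by
  refine iSup_le fun M => ?_
  let _ : Module S M := Module.compHom M e.symm.toRingHom
  let e' : M ≃ₛₗ[RingHomClass.toRingHom e] ModuleCat.of S M :=
    { AddEquiv.refl M with
      map_smul' := fun r m => by
        change r • m = e.symm (e r) • m
        rw [e.symm_apply_apply] }
  rw [ModuleCat.projectiveDimension_eq_of_semiLinearEquiv e e']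
  exact le_iSup (fun M : ModuleCat.{u} S => projectiveDimension M) _

theorem leftGlobalDim_eq_of_ringEquiv {S : Type u} [Ring S] (e : R ≃+* S) :
    leftGlobalDim R = leftGlobalDim S :=
  le_antisymm (leftGlobalDim_le_of_ringEquiv e) (leftGlobalDim_le_of_ringEquiv e.symm)

attribute [local instance] RingHomInvPair.of_ringEquiv in
theorem leftInjDim_eq_of_ringEquiv {S : Type u} [Ring S] (e : R ≃+* S) :
    leftInjDim R = leftInjDim S :=
  ModuleCat.injectiveDimension_eq_of_semiLinearEquiv (M := ModuleCat.of R R)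
    (N := ModuleCat.of S S) e e.toSemilinearEquiv

end
end Homological

/-! ### The algebras as modules over Laurent polynomials -/

namespace LiuAlg

noncomputable section

open LaurentPolynomial

set_option linter.unusedSectionVars false

variable {k : Type u} [Field k] {n : ℕ} {ξ : k}

theorem isPrincipalIdealRing_laurentPolynomial : IsPrincipalIdealRing k[T;T⁻¹] :=
  IsLocalization.isPrincipalIdealRing_of_isPrincipalIdealRing
    (Submonoid.powers (Polynomial.X : Polynomial k))

/-- The algebra map `T ↦ g`. -/
def laurentHom (a b : k) : k[T;T⁻¹] →ₐ[k] LiuAlg n ξ a b :=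
  AddMonoidAlgebra.lift k (LiuAlg n ξ a b) ℤ
    ((Units.coeHom (LiuAlg n ξ a b)).comp (zpowersHom _ (g n ξ a b)))

theorem laurentHom_T (a b : k) (i : ℤ) : laurentHom a b (T i)
    = ((g n ξ a b ^ i : (LiuAlg n ξ a b)ˣ) : LiuAlg n ξ a b) := by
  rw [laurentHom, T, AddMonoidAlgebra.lift_single, one_smul]
  rfl

/-- Laurent polynomials act by left multiplication, `T` acting as `g`. -/
instance (a b : k) : Module k[T;T⁻¹] (LiuAlg n ξ a b) :=
  Module.compHom _ (laurentHom (n := n) (ξ := ξ) a b).toRingHom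

theorem laurent_smul_def (a b : k) (p : k[T;T⁻¹]) (u : LiuAlg n ξ a b) :
    p • u = laurentHom a b p * u := rfl

instance (a b : k) : IsScalarTower k[T;T⁻¹] (LiuAlg n ξ a b) (LiuAlg n ξ a b) :=
  ⟨fun p u v => by rw [laurent_smul_def, smul_eq_mul, mul_assoc]; rfl⟩

instance (a b : k) : IsScalarTower k k[T;T⁻¹] (LiuAlg n ξ a b) :=
  ⟨fun r p u => by rw [laurent_smul_def, map_smul, smul_mul_assoc]; rfl⟩

theorem T_smul_monomial (a b : k) (i i' : ℤ) (j : ℕ) :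
    (T i : k[T;T⁻¹]) • monomial n ξ a b i' j = monomial n ξ a b (i + i') j := by
  rw [laurent_smul_def, laurentHom_T, monomial, monomial, ← mul_assoc, ← Units.val_mul, zpow_add]

variable [hn : Fact (2 ≤ n)] [hξ : Fact (IsPrimitiveRoot ξ n)]

/-- The coefficient of `x ^ j`, as a `k`-linear map. -/
def coordAux (a b : k) (j : ℕ) : LiuAlg n ξ a b →ₗ[k] k[T;T⁻¹] :=
  (basis n ξ a b).constr k fun p => if (p.2 : ℕ) = j then T p.1 else 0

theorem coordAux_monomial (a b : k) (j : ℕ) (i : ℤ) {l : ℕ} (hl : l < n) :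
    coordAux a b j (monomial n ξ a b i l) = if l = j then T i else 0 := by
  have := (basis n ξ a b).constr_basis k
    (fun p => if (p.2 : ℕ) = j then (T p.1 : k[T;T⁻¹]) else 0) (i, ⟨l, hl⟩)
  rwa [basis_apply] at this

theorem coordAux_smul (a b : k) (j : ℕ) (p : k[T;T⁻¹]) (u : LiuAlg n ξ a b) :
    coordAux a b j (p • u) = p * coordAux a b j u := by
  induction p using LaurentPolynomial.induction_on' with
  | add p q hp hq => rw [add_smul, map_add, hp, hq, add_mul]
  | C_mul_T i r =>
    rw [← smul_eq_C_mul, smul_assoc, map_smul, smul_mul_assoc]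
    congr 1
    have : (coordAux a b j) ∘ₗ (LinearMap.mulLeft k (laurentHom a b (T i)))
        = LinearMap.mulLeft k (T i) ∘ₗ coordAux (n := n) (ξ := ξ) a b j := by
      refine linearMap_ext fun i' l hl => ?_
      simp only [LinearMap.comp_apply, LinearMap.mulLeft_apply]
      rw [← laurent_smul_def, T_smul_monomial, coordAux_monomial _ _ _ _ hl,
        coordAux_monomial _ _ _ _ hl, mul_ite, mul_zero, T_add]
    exact LinearMap.congr_fun this u

/-- The coefficient of `x ^ j`. -/
def coord (a b : k) (j : ℕ) : LiuAlg n ξ a b →ₗ[k[T;T⁻¹]] k[T;T⁻¹] where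
  toFun := coordAux a b j
  map_add' := map_add _
  map_smul' := coordAux_smul a b j

theorem coord_monomial (a b : k) (j : ℕ) (i : ℤ) {l : ℕ} (hl : l < n) :
    coord a b j (monomial n ξ a b i l) = if l = j then T i else 0 :=
  coordAux_monomial a b j i hl

theorem sum_coord_smul (a b : k) (u : LiuAlg n ξ a b) :
    ∑ j : Fin n, coord a b j u • x n ξ a b ^ (j : ℕ) = u := by
  have : ∑ j : Fin n, LinearMap.mulRight k (x n ξ a b ^ (j : ℕ)) ∘ₗ
      (laurentHom a b).toLinearMap ∘ₗ coordAux a b j = LinearMap.id := by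
    refine linearMap_ext fun i l hl => ?_
    simp only [LinearMap.sum_apply, LinearMap.comp_apply, coordAux_monomial _ _ _ _ hl,
      LinearMap.mulRight_apply, LinearMap.id_apply]
    rw [Finset.sum_eq_single ⟨l, hl⟩]
    · rw [if_pos rfl]
      exact congrArg (· * x n ξ a b ^ l) (laurentHom_T a b i)
    · intro j _ hj
      rw [if_neg (fun h => hj (Fin.ext h.symm)), map_zero, zero_mul]
    · simp
  have h := LinearMap.congr_fun this u
  rw [LinearMap.sum_apply] at h
  exact h

/-- The basis `x ^ j`, `j < n`, over Laurent polynomials in `g`. -/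
def laurentBasis (a b : k) : Module.Basis (Fin n) k[T;T⁻¹] (LiuAlg n ξ a b) :=
  .ofEquivFun
    { LinearMap.pi fun j : Fin n => coord a b j with
      invFun := fun f => ∑ j : Fin n, f j • x n ξ a b ^ (j : ℕ)
      left_inv := sum_coord_smul a b
      right_inv := fun f => by
        ext1 i
        change coord a b i _ = _
        rw [map_sum, Finset.sum_eq_single i]
        · rw [map_smul, x_pow_eq_monomial, coord_monomial _ _ _ _ i.2, if_pos rfl, T_zero,
            smul_eq_mul, mul_one]
        · intro j _ hj
          rw [map_smul, x_pow_eq_monomial, coord_monomial _ _ _ _ j.2,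
            if_neg (fun h => hj (Fin.ext h)), smul_zero]
        · simp }

theorem laurentBasis_apply (a b : k) (j : Fin n) :
    laurentBasis a b j = x n ξ a b ^ (j : ℕ) := by
  rw [laurentBasis, Module.Basis.coe_ofEquivFun]
  change ∑ i : Fin n, Pi.single (M := fun _ => k[T;T⁻¹]) j 1 i • x n ξ a b ^ (i : ℕ) = _
  rw [Finset.sum_eq_single j] <;> simp +contextual

instance (a b : k) : Module.Free k[T;T⁻¹] (LiuAlg n ξ a b) :=
  Module.Free.of_basis (laurentBasis a b)

instance (a b : k) : Module.Finite k[T;T⁻¹] (LiuAlg n ξ a b) :=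
  Module.Finite.of_basis (laurentBasis a b)

instance (a b : k) : Module.IsTorsionFree k[T;T⁻¹] (LiuAlg n ξ a b) := inferInstance

/-! ### Noetherianity and the Frobenius form over Laurent polynomials -/

theorem isNoetherianRing (a b : k) : IsNoetherianRing (LiuAlg n ξ a b) := by
  have := isPrincipalIdealRing_laurentPolynomial (k := k)
  have : IsNoetherian k[T;T⁻¹] (LiuAlg n ξ a b) := isNoetherian_of_isNoetherianRing_of_finite _ _
  exact isNoetherian_of_tower k[T;T⁻¹] this

theorem isNoetherianRing_op (a : k) : IsNoetherianRing (LiuAlg n ξ a a)ᵐᵒᵖ :=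
  have := isNoetherianRing (n := n) (ξ := ξ) a a
  isNoetherianRing_of_ringEquiv _ (opEquiv n ξ a)

/-- Left multiplication by x^i shifts the degree in x by i and scales g^m by ξ^(m i). Terms that
pass degree n fall back to degree at most n - 2 and miss the top coefficient, so a and b play no
role. -/
theorem coeff_coord_x_pow_mul (a b : k) {i : ℕ} (hi : i < n) (u : LiuAlg n ξ a b) (m : ℤ) :
    (coord a b (n - 1) (x n ξ a b ^ i * u)).coeff m
      = ξ ^ (m * i) * (coord a b (n - 1 - i) u).coeff m := by
  let c : k[T;T⁻¹] →ₗ[k] k :=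
    Finsupp.lapply m ∘ₗ (AddMonoidAlgebra.coeffLinearEquiv k).toLinearMap
  have : c ∘ₗ coordAux a b (n - 1) ∘ₗ LinearMap.mulLeft k (x n ξ a b ^ i)
      = ξ ^ (m * i) • (c ∘ₗ coordAux a b (n - 1 - i)) := by
    refine linearMap_ext fun i' l hl => ?_
    simp only [LinearMap.comp_apply, LinearMap.smul_apply, LinearMap.mulLeft_apply]
    rw [x_pow_eq_monomial, monomial_mul_monomial, zero_add, map_smul,
      coordAux_monomial _ _ _ _ hl]
    by_cases h : i + l < n
    · rw [coordAux_monomial _ _ _ _ h]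
      by_cases h' : l = n - 1 - i
      · rw [if_pos h', if_pos (by omega), map_smul]
        change _ • (T i' : k[T;T⁻¹]).coeff m = _ • (T i' : k[T;T⁻¹]).coeff m
        rw [T_apply]
        split_ifs with e
        · rw [e]
        · rw [smul_zero, smul_zero]
      · rw [if_neg h', if_neg (by omega), smul_zero, map_zero, smul_zero]
    · obtain ⟨l', hl'⟩ : ∃ l', i + l = l' + n := ⟨i + l - n, by omega⟩
      rw [hl', monomial_add_natCast, map_sub, map_smul, map_smul,
        coordAux_monomial _ _ _ _ (by omega), map_smul, coordAux_monomial _ _ _ _ (by omega),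
        if_neg (by omega), if_neg (by omega), if_neg (by omega)]
      simp
  exact LinearMap.congr_fun this u

theorem exists_coeff_eq (p : k[T;T⁻¹]) (f : ℤ → k) : ∃ q : k[T;T⁻¹],
    ∀ m, q.coeff m = f m * p.coeff m :=
  ⟨(AddMonoidAlgebra.coeffLinearEquiv k).symm
    (Finsupp.onFinset p.coeff.support (fun m => f m * p.coeff m) fun _ hm =>
      Finsupp.mem_support_iff.2 (right_ne_zero_of_mul hm)), fun _ => rfl⟩

/-- The coefficient of x^(n-1) is a Frobenius form: up to invertible twists by powers of ξ, it pairs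
the coordinates j and n - 1 - j. -/
theorem hasInjectiveDimensionLT_two (a b : k) :
    CategoryTheory.HasInjectiveDimensionLT
      (ModuleCat.of (LiuAlg n ξ a b) (LiuAlg n ξ a b)) 2 := by
  have := isPrincipalIdealRing_laurentPolynomial (k := k)
  have hξ0 := root_ne_zero n ξ
  refine hasInjectiveDimensionLT_two_of_frobenius k[T;T⁻¹] (coord a b (n - 1)) ?_ ?_
  · intro u hu
    rw [← sum_coord_smul a b u]
    refine Finset.sum_eq_zero fun j _ => ?_
    have hj := j.2
    suffices coord a b j u = 0 by rw [this, zero_smul]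
    refine LaurentPolynomial.ext fun m => ?_
    -- Multiplication by x^(n-1-j) brings the coordinate j to the top.
    have h := coeff_coord_x_pow_mul a b (i := n - 1 - j) (by omega) u m
    rw [hu, show n - 1 - (n - 1 - (j : ℕ)) = j by omega] at h
    exact (mul_eq_zero.1 h.symm).resolve_left (zpow_ne_zero _ hξ0)
  · intro f
    -- The coordinate of w at x^(n-1-i) is forced by the value of f at x^i, after undoing the twist
    -- ξ^(m i) on the coefficient of g^m.
    choose q hq using fun i : ℕ =>
      exists_coeff_eq (f (x n ξ a b ^ i)) (fun m => (ξ ^ (m * i))⁻¹)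
    let w : LiuAlg n ξ a b := ∑ l : Fin n, q (n - 1 - l) • x n ξ a b ^ (l : ℕ)
    have hw : ∀ j < n, coord a b j w = q (n - 1 - j) := by
      intro j hj
      rw [map_sum, Finset.sum_eq_single ⟨j, hj⟩]
      · rw [map_smul, x_pow_eq_monomial, coord_monomial _ _ _ _ hj, if_pos rfl, T_zero,
            smul_eq_mul, mul_one]
      · intro l _ hl
        rw [map_smul, x_pow_eq_monomial, coord_monomial _ _ _ _ l.2,
            if_neg (fun h => hl (Fin.ext h)), smul_zero]
      · simp
    refine ⟨w, fun u => ?_⟩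
    have : f = coord a b (n - 1) ∘ₗ
        (LinearMap.toSpanSingleton (LiuAlg n ξ a b) (LiuAlg n ξ a b) w).restrictScalars
          k[T;T⁻¹] := by
      refine (laurentBasis a b).ext fun j => ?_
      have hj := j.2
      rw [laurentBasis_apply]
      refine LaurentPolynomial.ext fun m => ?_
      refine Eq.trans ?_ (coeff_coord_x_pow_mul a b hj w m).symm
      rw [hw _ (by omega), hq, show n - 1 - (n - 1 - (j : ℕ)) = j by omega,
        mul_inv_cancel_left₀ (zpow_ne_zero _ hξ0)]
    exact LinearMap.congr_fun this u

/-! ### Lower bounds from g - 1 -/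

theorem eq_zero_of_g_mul {a b : k} {u : LiuAlg n ξ a b}
    (h : (g n ξ a b : LiuAlg n ξ a b) * u = u) : u = 0 := by
  have h1 : (T 1 - 1 : k[T;T⁻¹]) • u = 0 := by
    rw [sub_smul, one_smul, laurent_smul_def, laurentHom_T, zpow_one, h, sub_self]
  refine (smul_eq_zero.1 h1).resolve_left fun h2 => ?_
  have := congrArg (fun p : k[T;T⁻¹] => p.coeff 1) h2
  rw [← T_zero] at this
  simp [-T_zero] at this

theorem eq_zero_of_mul_g {a : k} {u : LiuAlg n ξ a a}
    (h : u * (g n ξ a a : LiuAlg n ξ a a) = u) : u = 0 := by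
  have h1 := congrArg (anti a a) h
  rw [anti_mul, anti_g, Units.inv_mul_eq_iff_eq_mul] at h1
  exact (anti_bijective a a).1 ((eq_zero_of_g_mul h1.symm).trans (map_zero _).symm)

/-- The trivial module is not projective. -/
theorem one_le_leftGlobalDim (a : k) : 1 ≤ leftGlobalDim (LiuAlg n ξ a a) := by
  let _ : Module (LiuAlg n ξ a a) k := Module.compHom _ (eps a : LiuAlg n ξ a a →ₐ[k] k).toRingHom
  have hsm : ∀ (u : LiuAlg n ξ a a) (r : k), u • r = eps a u * r := fun _ _ => rfl
  refine _root_.one_le_leftGlobalDim (M := k) fun hp => ?_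
  obtain ⟨s, hs⟩ := Module.projective_lifting_property
    (LinearMap.toSpanSingleton (LiuAlg n ξ a a) k 1) LinearMap.id
    (fun r => ⟨algebraMap k _ r, by simp [hsm]⟩)
  have h1 := LinearMap.congr_fun hs 1
  -- A section of the counit sends 1 to an element fixed by g, and torsion freeness over k[g,g⁻¹]
  -- leaves only 0.
  have h2 : s 1 = 0 := by
    refine eq_zero_of_g_mul ?_
    rw [← smul_eq_mul, ← map_smul, hsm, eps_g, one_mul]
  rw [LinearMap.comp_apply, h2, map_zero] at h1
  exact zero_ne_one h1

/-- Right multiplication by g - 1 is injective. If the regular module were injective, this map would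
have a left inverse f, and (g - 1) f(1) = 1; the counit kills the left side. -/
theorem not_injective (a : k) : ¬ Module.Injective (LiuAlg n ξ a a) (LiuAlg n ξ a a) := by
  intro h
  let r := LinearMap.toSpanSingleton (LiuAlg n ξ a a) (LiuAlg n ξ a a) ((g n ξ a a : _) - 1)
  have hr : Function.Injective r := by
    rw [← LinearMap.ker_eq_bot, LinearMap.ker_eq_bot']
    intro u hu
    refine eq_zero_of_mul_g (sub_eq_zero.1 ?_)
    rw [← hu, LinearMap.toSpanSingleton_apply, smul_eq_mul, mul_sub, mul_one]
  obtain ⟨f, hf⟩ := h.out r hr LinearMap.id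
  have h1 := hf 1
  rw [LinearMap.toSpanSingleton_apply, one_smul, LinearMap.id_apply, 
    ← mul_one ((g n ξ a a : LiuAlg n ξ a a) - 1),
    ← smul_eq_mul, map_smul] at h1
  have h2 := congrArg (eps a) h1
  rw [smul_eq_mul, map_mul, map_sub, eps_g, map_one, sub_self, zero_mul] at h2
  exact zero_ne_one h2

theorem leftInjDim_eq_one (a : k) : leftInjDim (LiuAlg n ξ a a) = 1 :=
  _root_.leftInjDim_eq_one (hasInjectiveDimensionLT_two a a) (not_injective a)

theorem rightInjDim_eq_one (a : k) : rightInjDim (LiuAlg n ξ a a) = 1 :=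
  (leftInjDim_eq_of_ringEquiv (opEquiv n ξ a)).symm.trans (leftInjDim_eq_one a)

end
end LiuAlg

/-! ### Global dimension one -/

open Polynomial in
/-- Every nonzero polynomial divides a nonzero polynomial in `X ^ n`. -/
theorem Polynomial.exists_dvd_expand {k : Type u} [Field k] {p : k[X]} (hp : p ≠ 0) (n : ℕ) :
    ∃ q : k[X], q ≠ 0 ∧ p ∣ q.comp (X ^ n) := by
  have := (AdjoinRoot.powerBasis hp).finite
  -- The class of X in k[X]/(p) has an n-th power algebraic over k; a monic polynomial q
  -- annihilating that power satisfies p ∣ q(X^n).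
  obtain ⟨q, hq, h⟩ := IsIntegral.of_finite k (AdjoinRoot.root p ^ n)
  refine ⟨q, hq.ne_zero, AdjoinRoot.mk_eq_zero.1 ?_⟩
  rw [← AdjoinRoot.aeval_eq, aeval_comp, map_pow, aeval_X]
  exact h

namespace LiuAlg

noncomputable section

open Polynomial

set_option linter.unusedSectionVars false

variable {k : Type u} [Field k] {n : ℕ} {ξ : k} [hn : Fact (2 ≤ n)] [hξ : Fact (IsPrimitiveRoot ξ n)]

/-! #### Averaging over powers of `g` -/

/-- If the characteristic p divided n, then (ξ^(n/p))^p = 1 would force ξ^(n/p) = 1, against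
primitivity. -/
theorem natCast_ne_zero (n : ℕ) (ξ : k) [hn : Fact (2 ≤ n)] [hξ : Fact (IsPrimitiveRoot ξ n)] :
    (n : k) ≠ 0 := by
  have h := hn.out
  have : NeZero n := ⟨by omega⟩
  exact hξ.out.neZero'.out

/-- A Maschke-type argument: s commutes with k, x and g^n, so its conjugate by g^i depends only on i
modulo n, and the mean over a full period commutes with g. It still commutes with x because the
factors ξ^i and ξ^(-i) cancel. -/
theorem exists_linearMap_average (a b : k) {M P : Type*} [AddCommGroup M] [AddCommGroup P]
    [Module (LiuAlg n ξ a b) M] [Module (LiuAlg n ξ a b) P] (s : M →+ P)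
    (hk : ∀ r m, s (algebraMap k (LiuAlg n ξ a b) r • m) = algebraMap k (LiuAlg n ξ a b) r • s m)
    (hx : ∀ m, s (x n ξ a b • m) = x n ξ a b • s m)
    (hg : ∀ m, s (g n ξ a b ^ n • m) = g n ξ a b ^ n • s m) :
    ∃ s' : M →ₗ[LiuAlg n ξ a b] P, ∀ m, s' m = algebraMap k (LiuAlg n ξ a b) (n : k)⁻¹ •
      ∑ i ∈ Finset.range n, g n ξ a b ^ (i : ℤ) • s (g n ξ a b ^ (-i : ℤ) • m) := by
  let F (m : M) (i : ℤ) : P := g n ξ a b ^ i • s (g n ξ a b ^ (-i) • m)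
  let s' : M →+ P :=
    { toFun := fun m => algebraMap k (LiuAlg n ξ a b) (n : k)⁻¹ • ∑ i ∈ Finset.range n, F m i
      map_zero' := by simp [F]
      map_add' := fun m m' => by simp [F, Finset.sum_add_distrib] }
  have hs' : ∀ m, s' m =
    algebraMap k (LiuAlg n ξ a b) (n : k)⁻¹ • ∑ i ∈ Finset.range n, F m i := fun _ => rfl
  have hcomm : ∀ (r : k) (u : LiuAlg n ξ a b) (v : P), algebraMap k (LiuAlg n ξ a b) r • u • v
      = u • algebraMap k (LiuAlg n ξ a b) r • v := fun r u v => by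
    rw [smul_smul, Algebra.commutes, smul_smul]
  have hcommM : ∀ (r : k) (u : LiuAlg n ξ a b) (v : M), algebraMap k (LiuAlg n ξ a b) r • u • v
      = u • algebraMap k (LiuAlg n ξ a b) r • v := fun r u v => by
    rw [smul_smul, Algebra.commutes, smul_smul]
  have hgP : ∀ (i : ℤ) (v : P), x n ξ a b • g n ξ a b ^ i • v
      = algebraMap k (LiuAlg n ξ a b) (ξ ^ i) • g n ξ a b ^ i • x n ξ a b • v := fun i v => by
    simp only [Units.smul_def, smul_smul]
    rw [x_mul_g_zpow, Algebra.smul_def]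
  have hgM : ∀ (i : ℤ) (v : M), x n ξ a b • g n ξ a b ^ i • v
      = algebraMap k (LiuAlg n ξ a b) (ξ ^ i) • g n ξ a b ^ i • x n ξ a b • v := fun i v => by
    simp only [Units.smul_def, smul_smul]
    rw [x_mul_g_zpow, Algebra.smul_def]
  have hsg : ∀ m, s' ((g n ξ a b : LiuAlg n ξ a b) • m) = (g n ξ a b : LiuAlg n ξ a b) • s' m := by
    intro m
    -- Periodicity from g^n-linearity: it closes the cyclic shift of the sum by one.
    have hper : F m ((n : ℤ) - 1) = F m (-1) := by
      have h := hg (g n ξ a b ^ (-((n : ℤ) - 1)) • m)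
      simp only [F]
      rw [smul_smul, ← zpow_natCast, ← zpow_add, show (n : ℤ) + -((n : ℤ) - 1) = - -1 by ring] at h
      rw [h, smul_smul, ← zpow_add, show -1 + (n : ℤ) = n - 1 by ring]
    have hshift : ∑ i ∈ Finset.range n, F m ((i : ℤ) - 1) = ∑ i ∈ Finset.range n, F m i := by
      have h1 := Finset.sum_range_succ (fun i : ℕ => F m ((i : ℤ) - 1)) n
      rw [Finset.sum_range_succ', hper] at h1
      simpa using h1.symm
    rw [hs', hs', ← hcomm, ← hshift]
    congr 1
    rw [Finset.smul_sum]
    refine Finset.sum_congr rfl fun i _ => ?_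
    simp only [F]
    rw [← Units.smul_def, ← Units.smul_def, smul_smul, smul_smul, ← zpow_add_one, ← zpow_one_add]
    congr 2
    · ring
    · congr 2; ring
  refine ⟨{ s' with map_smul' := fun u => ?_ }, hs'⟩
  change ∀ m, s' (u • m) = u • s' m
  induction u using induction with
  | hk r =>
    intro m
    rw [hs', hs', ← hcomm]
    congr 1
    rw [Finset.smul_sum]
    refine Finset.sum_congr rfl fun i _ => ?_
    simp only [F, Units.smul_def]
    rw [← hcommM, hk, ← hcomm]
  | hg => exact hsg
  | hgi =>
    intro m
    have h := hsg ((((g n ξ a b)⁻¹ : (LiuAlg n ξ a b)ˣ) : LiuAlg n ξ a b) • m)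
    rw [smul_smul, Units.mul_inv, one_smul] at h
    rw [h, smul_smul, Units.inv_mul, one_smul]
  | hx =>
    intro m
    rw [hs', hs', ← hcomm]
    congr 1
    rw [Finset.smul_sum]
    refine Finset.sum_congr rfl fun i _ => ?_
    simp only [F]
    have h := hgM (-i) m
    have h0 := root_ne_zero n ξ
    have h1 : g n ξ a b ^ (-i : ℤ) • x n ξ a b • m = algebraMap k (LiuAlg n ξ a b) (ξ ^ (i : ℤ)) •
        x n ξ a b • g n ξ a b ^ (-i : ℤ) • m := by
      rw [h, smul_smul, ← map_mul, ← zpow_add₀ h0, add_neg_cancel, zpow_zero, map_one, one_smul]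
    rw [h1, hk, hx, hgP, Units.smul_def, ← hcomm]
    rfl
  | hm u v hu hv => intro m; rw [mul_smul, hu, hv, mul_smul]
  | ha u v hu hv => intro m; rw [add_smul, map_add, hu, hv, add_smul]

/-! #### The action of a localization of the polynomial ring -/

variable (k n) in
/-- The polynomial ring in `x` with `1 - x ^ n` inverted. -/
abbrev XRing : Type u := Localization.Away (1 - X ^ n : k[X])

theorem one_sub_X_pow_ne_zero : (1 - X ^ n : k[X]) ≠ 0 := by
  have := hn.out
  rw [← neg_ne_zero, neg_sub]
  exact (monic_X_pow_sub_C (1 : k) (by omega : n ≠ 0)).ne_zero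

variable (k n) in
theorem isDomain_xRing : IsDomain (XRing k n) :=
  IsLocalization.isDomain_localization
    (powers_le_nonZeroDivisors_of_noZeroDivisors one_sub_X_pow_ne_zero)

variable (k n) in
theorem isPrincipalIdealRing_xRing : IsPrincipalIdealRing (XRing k n) :=
  IsLocalization.isPrincipalIdealRing_of_isPrincipalIdealRing
    (Submonoid.powers (1 - X ^ n : k[X]))

/-- The reason for inverting 1 - X^n: its image in H is the unit g^n. -/
theorem aeval_one_sub_X_pow : aeval (x n ξ 1 1) (1 - X ^ n : k[X])
    = ((g n ξ 1 1 ^ n : (LiuAlg n ξ 1 1)ˣ) : LiuAlg n ξ 1 1) := by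
  rw [map_sub, map_pow, aeval_X, map_one, x_pow, map_one, one_smul, sub_sub_cancel,
    Units.val_pow_eq_pow_val]

theorem isUnit_aeval (s : Submonoid.powers (1 - X ^ n : k[X])) :
    IsUnit (((aeval (x n ξ 1 1) : k[X] →ₐ[k] LiuAlg n ξ 1 1) :
      k[X] →* LiuAlg n ξ 1 1).comp (Submonoid.subtype _) s) := by
  obtain ⟨_, i, rfl⟩ := s
  change IsUnit (aeval (x n ξ 1 1) ((1 - X ^ n : k[X]) ^ i))
  rw [map_pow, aeval_one_sub_X_pow]
  exact (Units.isUnit _).pow i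

variable (n ξ) in
/-- The ring map from the localized polynomial ring to the Liu algebra. -/
def xHom : XRing k n →+* LiuAlg n ξ 1 1 :=
  OreLocalization.universalHom
    ((aeval (x n ξ 1 1) : k[X] →ₐ[k] LiuAlg n ξ 1 1) : k[X] →+* LiuAlg n ξ 1 1)
    (IsUnit.liftRight _ (isUnit_aeval (n := n) (ξ := ξ))) fun _ => rfl

theorem xHom_algebraMap (p : k[X]) :
    xHom n ξ (algebraMap k[X] (XRing k n) p) = aeval (x n ξ 1 1) p :=
  OreLocalization.universalHom_commutes _ _ _

instance : Module (XRing k n) (LiuAlg n ξ 1 1) := Module.compHom _ (xHom n ξ)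

theorem xRing_smul_def (p : XRing k n) (u : LiuAlg n ξ 1 1) : p • u = xHom n ξ p * u := rfl

instance : IsScalarTower (XRing k n) (LiuAlg n ξ 1 1) (LiuAlg n ξ 1 1) :=
  ⟨fun p u v => by rw [xRing_smul_def, smul_eq_mul, mul_assoc]; rfl⟩

variable (n ξ) in
theorem exists_xHom_eq (q : ℤ) : ∃ p : XRing k n,
    xHom n ξ p = (((g n ξ 1 1 ^ n) ^ q : (LiuAlg n ξ 1 1)ˣ) : LiuAlg n ξ 1 1) := by
  obtain ⟨w, hw⟩ := IsLocalization.map_units (XRing k n)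
    (⟨1 - X ^ n, Submonoid.mem_powers _⟩ : Submonoid.powers (1 - X ^ n : k[X]))
  have h : Units.map (xHom n ξ).toMonoidHom w = g n ξ 1 1 ^ n := by
    refine Units.ext ?_
    change xHom n ξ w = _
    rw [hw, xHom_algebraMap, aeval_one_sub_X_pow]
  refine ⟨((w ^ q : (XRing k n)ˣ) : XRing k n), ?_⟩
  rw [← h, ← map_zpow]
  rfl

instance : Module.Finite (XRing k n) (LiuAlg n ξ 1 1) := by
  classical
  refine Module.finite_def.2 ⟨(Finset.range n).image fun i : ℕ =>
    ((g n ξ 1 1 ^ (i : ℤ) : (LiuAlg n ξ 1 1)ˣ) : LiuAlg n ξ 1 1), ?_⟩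
  rw [eq_top_iff]
  rintro u -
  have h0 := root_ne_zero n ξ
  have hn0 : (n : ℤ) ≠ 0 := by have := hn.out; omega
  rw [← (basis n ξ 1 1).linearCombination_repr u, Finsupp.linearCombination_apply]
  refine sum_mem fun ⟨i, j⟩ _ => ?_
  -- Splitting i = n (i / n) + i % n, the power g^(n (i / n)) comes from the localized ring, which
  -- leaves the generators g^r with 0 ≤ r < n. The factor ξ^(-i j) below pays for writing x^j on the
  -- left of g^i.
  obtain ⟨p, hp⟩ := exists_xHom_eq n ξ (i / n)
  have hr0 := Int.emod_nonneg i hn0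
  have hr1 := Int.emod_lt_of_pos i (show (0 : ℤ) < n by omega)
  have key : ((basis n ξ 1 1).repr u (i, j)) • basis n ξ 1 1 (i, j)
      = (algebraMap k[X] (XRing k n) (C ((basis n ξ 1 1).repr u (i, j) * (ξ ^ (i * (j : ℕ)))⁻¹)
          * X ^ (j : ℕ)) * p) •
        ((g n ξ 1 1 ^ (((i % n).toNat : ℕ) : ℤ) : (LiuAlg n ξ 1 1)ˣ) : LiuAlg n ξ 1 1) := by
    rw [xRing_smul_def, map_mul, xHom_algebraMap, hp, map_mul, aeval_C, map_pow, aeval_X,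
      mul_assoc, ← Units.val_mul, Int.toNat_of_nonneg hr0, ← zpow_natCast, ← zpow_mul, ← zpow_add,
      Int.mul_ediv_add_emod, mul_assoc, x_pow_mul_g_zpow, ← Algebra.smul_def, smul_smul,
      inv_mul_cancel_right₀ (zpow_ne_zero _ h0), basis_apply]
  change ((basis n ξ 1 1).repr u (i, j)) • basis n ξ 1 1 (i, j) ∈ _
  rw [key]
  refine Submodule.smul_mem _ _ (Submodule.subset_span ?_)
  simp only [Finset.coe_image, Set.mem_image, Finset.coe_range, Set.mem_Iio]
  exact ⟨(i % n).toNat, by omega, rfl⟩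

/-- A nonzero p divides some q(X^n) with q nonzero. Its value at x is q(1 - g^n), a nonzero Laurent
polynomial in g, and H is torsion free over those. -/
theorem eq_zero_of_aeval_mul {p : k[X]} (hp : p ≠ 0) {u : LiuAlg n ξ 1 1}
    (h : aeval (x n ξ 1 1) p * u = 0) : u = 0 := by
  obtain ⟨q, hq, c, hc⟩ := Polynomial.exists_dvd_expand hp n
  have h1 : laurentHom 1 1 (toLaurent (q.comp (1 - X ^ n))) * u = 0 := by
    have : laurentHom 1 1 (toLaurent (q.comp (1 - X ^ n))) = aeval (x n ξ 1 1) (c * p) := by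
      rw [mul_comm, ← hc, aeval_comp, map_pow, aeval_X, x_pow, map_one, one_smul,
        ← Polynomial.toLaurentAlg_apply]
      have h2 : (laurentHom 1 1).comp (toLaurentAlg (R := k))
          = aeval (g n ξ 1 1 : LiuAlg n ξ 1 1) := by
        refine Polynomial.algHom_ext ?_
        rw [AlgHom.comp_apply, toLaurentAlg_apply, toLaurent_X, laurentHom_T, zpow_one, aeval_X]
      rw [← AlgHom.comp_apply, h2, aeval_comp]
      simp
    rw [this, map_mul, mul_assoc, h, mul_zero]
  refine (smul_eq_zero.1 (show toLaurent (q.comp (1 - X ^ n)) • u = 0 from h1)).resolve_left ?_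
  rw [toLaurent_eq_zero, comp_eq_zero_iff]
  rintro (h2 | ⟨-, h2⟩)
  · exact hq h2
  · have h3 := congrArg (fun r : k[X] => r.coeff n) h2
    have := hn.out
    rw [coeff_C_of_ne_zero (by omega)] at h3
    simp [coeff_one, show n ≠ 0 by omega] at h3

instance : Module.IsTorsionFree (XRing k n) (LiuAlg n ξ 1 1) := by
  have := isDomain_xRing k n
  refine ⟨fun r hr => ?_⟩
  rw [isSMulRegular_iff_right_eq_zero_of_smul]
  intro u hu
  obtain ⟨⟨p, s⟩, hp⟩ := IsLocalization.surj (Submonoid.powers (1 - X ^ n : k[X])) r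
  refine eq_zero_of_aeval_mul (p := p) ?_ ?_
  · rintro rfl
    rw [map_zero] at hp
    exact (mul_ne_zero hr.ne_zero (IsLocalization.map_units _ s).ne_zero) hp
  · rw [← xHom_algebraMap, ← hp, mul_comm, map_mul, mul_assoc, ← xRing_smul_def r, hu, mul_zero]

/-- Over the localized k[x] the ideal is projective, so its canonical free cover over H splits
there. Such a splitting commutes with k, x and g^n = 1 - x^n, and its average over g is an H-linear
splitting. -/
theorem projective_ideal (I : Ideal (LiuAlg n ξ 1 1)) :
    Module.Projective (LiuAlg n ξ 1 1) I := by
  have := isDomain_xRing k n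
  have := isPrincipalIdealRing_xRing k n
  have := Ideal.projective_of_finite_torsionFree (XRing k n) I
  let π := Finsupp.linearCombination (LiuAlg n ξ 1 1) (id : I → I)
  have hπ : Function.Surjective π := Finsupp.linearCombination_id_surjective _ _
  obtain ⟨s, hs⟩ := Module.projective_lifting_property (π.restrictScalars (XRing k n))
    LinearMap.id hπ
  have hsp : ∀ (p : XRing k n) (m : I), s (xHom n ξ p • m) = xHom n ξ p • s m := fun p m =>
    s.map_smul p m
  obtain ⟨s', hs'⟩ := exists_linearMap_average (n := n) (ξ := ξ) 1 1 s.toAddMonoidHom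
    (fun r m => by
      have h := hsp (algebraMap k[X] _ (C r)) m
      rwa [xHom_algebraMap, aeval_C] at h)
    (fun m => by
      have h := hsp (algebraMap k[X] _ X) m
      rwa [xHom_algebraMap, aeval_X] at h)
    (fun m => by
      have h := hsp (algebraMap k[X] _ (1 - X ^ n)) m
      rwa [xHom_algebraMap, aeval_one_sub_X_pow] at h)
  refine Module.Projective.of_split s' π (LinearMap.ext fun m => ?_)
  rw [LinearMap.comp_apply, hs', map_smul, map_sum, LinearMap.id_apply]
  -- Every conjugate of a section by a power of g is again a section, because π is H-linear; so is
  -- their mean.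
  have : ∀ i ∈ Finset.range n, π (g n ξ 1 1 ^ (i : ℤ) •
      s.toAddMonoidHom (g n ξ 1 1 ^ (-i : ℤ) • m)) = m := by
    intro i _
    have h := LinearMap.congr_fun hs (g n ξ 1 1 ^ (-i : ℤ) • m)
    change π (s _) = _ at h
    rw [Units.smul_def, map_smul]
    change _ • π (s _) = _
    rw [h, LinearMap.id_apply, ← Units.smul_def, smul_smul, ← zpow_add, add_neg_cancel, zpow_zero,
      one_smul]
  rw [Finset.sum_congr rfl this, Finset.sum_const, Finset.card_range, ← Nat.cast_smul_eq_nsmul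
    (LiuAlg n ξ 1 1), smul_smul, ← map_natCast (algebraMap k (LiuAlg n ξ 1 1)), ← map_mul,
    inv_mul_cancel₀ (LiuAlg.natCast_ne_zero n ξ), map_one, one_smul]

variable (n ξ) in
theorem leftGlobalDim_liuH : leftGlobalDim (LiuAlg n ξ 1 1) = 1 :=
  le_antisymm (leftGlobalDim_le_one_of_projective_ideal projective_ideal) (one_le_leftGlobalDim 1)

end
end LiuAlg

/-! ### Infinite global dimension -/

namespace LiuAlg

noncomputable section

open LaurentPolynomial

set_option linter.unusedSectionVars false

variable {k : Type u} [Field k] {n : ℕ} {ξ : k} [hn : Fact (2 ≤ n)] [hξ : Fact (IsPrimitiveRoot ξ n)]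

theorem monomial_eq_zero (i : ℤ) {j : ℕ} (hj : n ≤ j) : monomial n ξ 0 0 i j = 0 := by
  obtain ⟨l, rfl⟩ : ∃ l, j = l + n := ⟨j - n, by omega⟩
  rw [monomial_add_natCast, zero_smul, zero_smul, sub_zero]

theorem coord_mul_x_pow {j s : ℕ} (h : j + s < n) (u : LiuAlg n ξ 0 0) :
    coord 0 0 (j + s) (u * x n ξ 0 0 ^ s) = coord 0 0 j u := by
  have : coordAux 0 0 (j + s) ∘ₗ LinearMap.mulRight k (x n ξ 0 0 ^ s) = coordAux 0 0 j := by
    refine linearMap_ext fun i l hl => ?_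
    rw [LinearMap.comp_apply, LinearMap.mulRight_apply, coordAux_monomial _ _ _ _ hl, monomial,
      mul_assoc, ← pow_add]
    change coordAux 0 0 (j + s) (monomial n ξ 0 0 i (l + s)) = _
    by_cases hs : l + s < n
    · rw [coordAux_monomial _ _ _ _ hs]
      simp
    · rw [monomial_eq_zero i (by omega), map_zero, if_neg (by omega)]
  exact LinearMap.congr_fun this u

/-- With x^n = 0, right multiplication by x^s shifts coordinates up and loses only the top s of
them. So u x^s = 0 means that the coordinates below t vanish. -/
theorem mul_x_pow_eq_zero_iff {s t : ℕ} (h : s + t = n) (u : LiuAlg n ξ 0 0) :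
    u * x n ξ 0 0 ^ s = 0 ↔ ∃ v, u = v * x n ξ 0 0 ^ t := by
  constructor
  · intro hu
    -- For j < t the exponent is truncated to 0, harmlessly, since the coefficient vanishes there.
    refine ⟨∑ j : Fin n, coord 0 0 j u • x n ξ 0 0 ^ ((j : ℕ) - t), ?_⟩
    conv_lhs => rw [← sum_coord_smul 0 0 u]
    rw [Finset.sum_mul]
    refine Finset.sum_congr rfl fun j _ => ?_
    by_cases hj : t ≤ j
    · rw [smul_mul_assoc, ← pow_add, Nat.sub_add_cancel hj]
    · have h1 := coord_mul_x_pow (j := j) (s := s) (by omega) u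
      rw [hu, map_zero] at h1
      rw [← h1, zero_smul, zero_smul, zero_mul]
  · rintro ⟨v, rfl⟩
    rw [mul_assoc, ← pow_add, add_comm, h, x_pow_eq_monomial, monomial_eq_zero 0 le_rfl, mul_zero]

/-- Half of the normality of x; it serves to move a power of x past an arbitrary element. -/
theorem exists_x_mul_eq (a b : k) (u : LiuAlg n ξ a b) : ∃ v, x n ξ a b * u = v * x n ξ a b := by
  induction u using induction with
  | hk r => exact ⟨algebraMap k _ r, (Algebra.commutes _ _).symm⟩
  | hg => exact ⟨ξ • (g n ξ a b : LiuAlg n ξ a b), by rw [x_mul_g, smul_mul_assoc]⟩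
  | hgi => exact ⟨ξ⁻¹ • (((g n ξ a b)⁻¹ : (LiuAlg n ξ a b)ˣ) : LiuAlg n ξ a b), by
      rw [x_mul_g_inv, smul_mul_assoc]⟩
  | hx => exact ⟨_, rfl⟩
  | hm u v hu hv =>
    obtain ⟨u', hu⟩ := hu
    obtain ⟨v', hv⟩ := hv
    exact ⟨u' * v', by rw [← mul_assoc, hu, mul_assoc, hv, mul_assoc]⟩
  | ha u v hu hv =>
    obtain ⟨u', hu⟩ := hu
    obtain ⟨v', hv⟩ := hv
    exact ⟨u' + v', by rw [mul_add, hu, hv, add_mul]⟩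

theorem exists_x_pow_mul_eq (a b : k) (j : ℕ) (u : LiuAlg n ξ a b) :
    ∃ v, x n ξ a b ^ j * u = v * x n ξ a b ^ j := by
  induction j generalizing u with
  | zero => exact ⟨u, by simp⟩
  | succ j ih =>
    obtain ⟨v, hv⟩ := exists_x_mul_eq a b u
    obtain ⟨w, hw⟩ := ih v
    exact ⟨w, by rw [pow_succ, mul_assoc, hv, ← mul_assoc, hw, mul_assoc]⟩

variable (n ξ) in
theorem leftGlobalDim_liuL : leftGlobalDim (LiuAlg n ξ 0 0) = ⊤ := by
  have h := hn.out
  refine leftGlobalDim_eq_top_of_periodic (y := x n ξ 0 0) (w := x n ξ 0 0 ^ (n - 1)) (fun u => ?_)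
    (fun u => ?_) fun v hv => ?_
  · simpa using mul_x_pow_eq_zero_iff (s := 1) (t := n - 1) (by omega) u
  · simpa using mul_x_pow_eq_zero_iff (s := n - 1) (t := 1) (by omega) u
  -- For w = x^(n-1) one has w v w = v' x^(2n-2), which is 0 because 2n - 2 ≥ n; but w is a basis
  -- vector.
  · obtain ⟨v', hv'⟩ := exists_x_pow_mul_eq 0 0 (n - 1) v
    rw [hv', mul_assoc, ← pow_add, x_pow_eq_monomial _ _ (n - 1 + _),
      monomial_eq_zero 0 (by omega), mul_zero, x_pow_eq_monomial] at hv
    exact (basis n ξ 0 0).ne_zero (0, ⟨n - 1, by omega⟩) ((basis_apply _ _ _).trans hv)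

end
end LiuAlg

/-! ### Polynomial identities -/

section PI

noncomputable section

/-- The standard polynomial `∑ sgn(σ) X_σ(0) ⋯ X_σ(m-1)`. -/
def standardPolynomial (k : Type u) [Field k] (m : ℕ) : FreeAlgebra k ℕ :=
  ∑ σ : Equiv.Perm (Fin m), (Equiv.Perm.sign σ : ℤ) •
    (List.ofFn fun i => FreeAlgebra.ι k ((σ i : Fin m) : ℕ)).prod

/-- Distinct permutations give distinct words, so in the algebra of the free monoid the word 0, 1,
…, m-1 has coefficient 1, coming from the identity alone. -/
theorem standardPolynomial_ne_zero (k : Type u) [Field k] (m : ℕ) :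
    standardPolynomial k m ≠ 0 := by
  classical
  intro h
  let φ : FreeAlgebra k ℕ →ₐ[k] MonoidAlgebra k (FreeMonoid ℕ) :=
    FreeAlgebra.lift k fun i => MonoidAlgebra.of k _ (FreeMonoid.of i)
  have hφ : ∀ f : Fin m → ℕ, φ (List.ofFn fun i => FreeAlgebra.ι k (f i)).prod
      = MonoidAlgebra.single (FreeMonoid.ofList (List.ofFn f)) 1 := by
    intro f
    rw [map_list_prod, List.map_ofFn]
    have : (List.ofFn (φ ∘ fun i => FreeAlgebra.ι k (f i)))
        = ((List.ofFn f).map fun i => MonoidAlgebra.of k _ (FreeMonoid.of i)) := by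
      rw [List.map_ofFn]
      congr 1
      ext1 i
      exact FreeAlgebra.lift_ι_apply _ _
    rw [this, ← FreeMonoid.lift_ofList]
    have h2 : FreeMonoid.lift (fun i : ℕ => MonoidAlgebra.of k (FreeMonoid ℕ) (FreeMonoid.of i))
        = MonoidAlgebra.of k (FreeMonoid ℕ) := by ext; simp
    rw [h2]
    rfl
  have h1 := congrArg (fun p => (φ p).coeff (FreeMonoid.ofList (List.ofFn fun i : Fin m => (i : ℕ)))) h
  simp only [standardPolynomial, map_sum, map_zsmul, hφ, map_zero] at h1
  have h2 : ∀ σ : Equiv.Perm (Fin m), ((Equiv.Perm.sign σ : ℤ) •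
      (MonoidAlgebra.single (FreeMonoid.ofList (List.ofFn fun i => ((σ i : Fin m) : ℕ))) (1 : k) :
        MonoidAlgebra k (FreeMonoid ℕ))).coeff
        (FreeMonoid.ofList (List.ofFn fun i : Fin m => (i : ℕ))) = if σ = 1 then 1 else 0 := by
    intro σ
    rw [MonoidAlgebra.coeff_smul, Finsupp.smul_apply, MonoidAlgebra.coeff_single]
    split_ifs with hσ
    · subst hσ
      simp
    · rw [Finsupp.single_eq_of_ne, smul_zero]
      intro he
      refine hσ (Equiv.ext fun i => Fin.ext ?_)
      exact (congrFun (List.ofFn_injective (FreeMonoid.ofList.injective he)) i).symm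
  rw [MonoidAlgebra.coeff_sum, Finsupp.finsetSum_apply, Finset.sum_congr rfl fun σ _ => h2 σ] at h1
  simp at h1

/-- An algebra that is a finite module over some commutative ring is a PI algebra. -/
theorem isPIAlgebra_of_finite (k : Type u) [Field k] {R : Type u} [Ring R] [Algebra k R]
    (C : Type*) [CommRing C] [Algebra C R] [Module.Finite C R] : IsPIAlgebra k R := by
  obtain ⟨m, π, hπ⟩ := Module.Finite.exists_fin' C R
  refine ⟨standardPolynomial k (m + 1), standardPolynomial_ne_zero k _, fun v => ?_⟩
  -- The standard polynomial of degree m + 1 is an alternating C-multilinear map. Pulled back to C^m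
  -- it vanishes, since m + 1 basis vectors cannot be distinct.
  let alt := MultilinearMap.alternatization (MultilinearMap.mkPiAlgebraFin C (m + 1) R)
  have h0 : alt.compLinearMap π = 0 := by
    refine (Pi.basisFun C (Fin m)).ext_alternating fun f hf => ?_
    have := Fintype.card_le_of_injective f hf
    simp at this
  have h1 : alt (fun i => v i) = 0 := by
    choose w hw using hπ
    have := congrArg (fun F : AlternatingMap C (Fin m → C) R (Fin (m + 1)) => F fun i => w (v i)) h0
    simpa [hw] using this
  rw [← h1, MultilinearMap.alternatization_apply, standardPolynomial, map_sum]
  refine Finset.sum_congr rfl fun σ _ => ?_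
  rw [map_zsmul, map_list_prod, List.map_ofFn, MultilinearMap.domDomCongr_apply,
    MultilinearMap.mkPiAlgebraFin_apply, Units.smul_def]
  congr 3
  ext1 i
  exact FreeAlgebra.lift_ι_apply _ _

end
end PI

/-! ### Finite generation and finiteness over the centre -/

namespace LiuAlg

noncomputable section

set_option linter.unusedSectionVars false

variable {k : Type u} [Field k] {n : ℕ} {ξ : k}

theorem finiteType (a b : k) : Algebra.FiniteType k (LiuAlg n ξ a b) := by
  have : Finite LiuGen := Finite.of_surjective
    (fun i : Fin 3 => match i with | 0 => LiuGen.g | 1 => LiuGen.ginv | 2 => LiuGen.x)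
    (by rintro (_ | _ | _); exacts [⟨0, rfl⟩, ⟨1, rfl⟩, ⟨2, rfl⟩])
  exact Algebra.FiniteType.of_surjective (mk a b) (mk_surjective a b)

variable [hn : Fact (2 ≤ n)] [hξ : Fact (IsPrimitiveRoot ξ n)]

theorem monomial_mem_center (a b : k) (i : ℤ) :
    monomial n ξ a b (n * i) 0 ∈ Subring.center (LiuAlg n ξ a b) := by
  rw [Subring.mem_center_iff]
  intro u
  have : LinearMap.mulRight k (monomial n ξ a b (n * i) 0)
      = LinearMap.mulLeft k (monomial n ξ a b (n * i) 0) := by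
    refine linearMap_ext fun i' j _ => ?_
    rw [LinearMap.mulRight_apply, LinearMap.mulLeft_apply, monomial_mul_monomial,
      monomial_mul_monomial, add_comm i', zero_add, add_zero, Nat.cast_zero, mul_zero, zpow_zero,
      mul_assoc, mul_comm, root_zpow_mul_natCast]
  exact LinearMap.congr_fun this u

theorem algebraMap_mem_center (a b : k) (r : k) :
    algebraMap k (LiuAlg n ξ a b) r ∈ Subring.center (LiuAlg n ξ a b) :=
  Subring.mem_center_iff.2 fun u => (Algebra.commutes r u).symm

/-- The central powers of g^n absorb i up to its residue modulo n, so the n² monomials with both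
exponents below n generate. -/
theorem finite_center (a b : k) :
    Module.Finite (Subring.center (LiuAlg n ξ a b)) (LiuAlg n ξ a b) := by
  classical
  refine Module.finite_def.2 ⟨(Finset.range n ×ˢ Finset.range n).image fun p : ℕ × ℕ =>
    monomial n ξ a b p.1 p.2, ?_⟩
  rw [eq_top_iff]
  rintro u -
  have hn0 : (n : ℤ) ≠ 0 := by have := hn.out; omega
  rw [← (basis n ξ a b).linearCombination_repr u, Finsupp.linearCombination_apply]
  refine sum_mem fun ⟨i, j⟩ _ => ?_
  have hr0 := Int.emod_nonneg i hn0
  have hr1 := Int.emod_lt_of_pos i (show (0 : ℤ) < n by omega)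
  have key : basis n ξ a b (i, j) = (⟨_, monomial_mem_center a b (i / n)⟩ :
      Subring.center (LiuAlg n ξ a b)) • monomial n ξ a b ((i % n).toNat : ℕ) j := by
    rw [Subring.smul_def, smul_eq_mul, monomial_mul_monomial, Int.toNat_of_nonneg hr0,
      Int.mul_ediv_add_emod, basis_apply]
    simp
  have key' : ((basis n ξ a b).repr u (i, j)) • basis n ξ a b (i, j)
      = (⟨_, algebraMap_mem_center a b ((basis n ξ a b).repr u (i, j))⟩ :
      Subring.center (LiuAlg n ξ a b)) • basis n ξ a b (i, j) := Algebra.smul_def _ _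
  change ((basis n ξ a b).repr u (i, j)) • basis n ξ a b (i, j) ∈ _
  rw [key', key]
  refine Submodule.smul_mem _ _ (Submodule.smul_mem _ _ (Submodule.subset_span ?_))
  simp only [Finset.coe_image, Set.mem_image]
  exact ⟨((i % n).toNat, j), by simp; omega, rfl⟩

theorem isPIAlgebra (a b : k) : IsPIAlgebra k (LiuAlg n ξ a b) :=
  have := finite_center (n := n) (ξ := ξ) a b
  isPIAlgebra_of_finite k (Subring.center (LiuAlg n ξ a b))

end
end LiuAlg

/-! ### The example and the failure of invariance of global dimension -/

theorem mainTheorem9 {k : Type u} [Field k] (n : ℕ) (ξ : k)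
    [Fact (2 ≤ n)] [Fact (IsPrimitiveRoot ξ n)] :
    -- the Hopf structure of `H` on generators
    ((Coalgebra.comul (R := k) (LiuH.g n ξ : LiuH n ξ)
          = (LiuH.g n ξ : LiuH n ξ) ⊗ₜ[k] (LiuH.g n ξ : LiuH n ξ) ∧
        Coalgebra.comul (R := k) (LiuH.x n ξ)
          = LiuH.x n ξ ⊗ₜ[k] 1 + (LiuH.g n ξ : LiuH n ξ) ⊗ₜ[k] LiuH.x n ξ ∧
        Coalgebra.counit (R := k) (LiuH.g n ξ : LiuH n ξ) = 1 ∧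
        Coalgebra.counit (R := k) (LiuH.x n ξ) = 0 ∧
        HopfAlgebra.antipode k (LiuH.g n ξ : LiuH n ξ) = ((LiuH.g n ξ)⁻¹ : (LiuH n ξ)ˣ) ∧
        HopfAlgebra.antipode k (LiuH.x n ξ)
          = -(((LiuH.g n ξ)⁻¹ : (LiuH n ξ)ˣ) * LiuH.x n ξ)) ∧
      -- the Hopf structure of `L` on generators
      (Coalgebra.comul (R := k) (LiuL.g n ξ : LiuL n ξ)
          = (LiuL.g n ξ : LiuL n ξ) ⊗ₜ[k] (LiuL.g n ξ : LiuL n ξ) ∧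
        Coalgebra.comul (R := k) (LiuL.y n ξ)
          = LiuL.y n ξ ⊗ₜ[k] 1 + (LiuL.g n ξ : LiuL n ξ) ⊗ₜ[k] LiuL.y n ξ ∧
        Coalgebra.counit (R := k) (LiuL.g n ξ : LiuL n ξ) = 1 ∧
        Coalgebra.counit (R := k) (LiuL.y n ξ) = 0 ∧
        HopfAlgebra.antipode k (LiuL.g n ξ : LiuL n ξ) = ((LiuL.g n ξ)⁻¹ : (LiuL n ξ)ˣ) ∧
        HopfAlgebra.antipode k (LiuL.y n ξ)
          = -(((LiuL.g n ξ)⁻¹ : (LiuL n ξ)ˣ) * LiuL.y n ξ)) ∧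
      -- both antipodes are bijective
      (Function.Bijective (HopfAlgebra.antipode k : LiuH n ξ →ₗ[k] LiuH n ξ) ∧
        Function.Bijective (HopfAlgebra.antipode k : LiuL n ξ →ₗ[k] LiuL n ξ)) ∧
      -- the coactions on generators
      (LiuB.ρ n ξ (LiuB.g n ξ) = (LiuB.g n ξ : LiuB n ξ) ⊗ₜ[k] (LiuH.g n ξ : LiuH n ξ) ∧
        LiuB.ρ n ξ (LiuB.t n ξ)
          = LiuB.t n ξ ⊗ₜ[k] 1 + (LiuB.g n ξ : LiuB n ξ) ⊗ₜ[k] LiuH.x n ξ ∧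
        LiuB.δ n ξ (LiuB.g n ξ) = (LiuL.g n ξ : LiuL n ξ) ⊗ₜ[k] (LiuB.g n ξ : LiuB n ξ) ∧
        LiuB.δ n ξ (LiuB.t n ξ)
          = (LiuL.g n ξ : LiuL n ξ) ⊗ₜ[k] LiuB.t n ξ + LiuL.y n ξ ⊗ₜ[k] 1) ∧
      -- `B` is `H`-cleft through `g ^ i x ^ j ↦ g ^ i t ^ j`
      (∃ γ : LiuH n ξ ≃ₗ[k] LiuB n ξ,
        (∀ (i : ℤ) (j : ℕ), j < n →
          γ (((LiuH.g n ξ ^ i : (LiuH n ξ)ˣ) : LiuH n ξ) * LiuH.x n ξ ^ j)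
            = ((LiuB.g n ξ ^ i : (LiuB n ξ)ˣ) : LiuB n ξ) * LiuB.t n ξ ^ j) ∧
        IsCleaving k (LiuB.ρ n ξ) γ.toLinearMap (γ.toLinearMap ∘ₗ HopfAlgebra.antipode k)) ∧
      -- `B` is an `L`-`H`-biGalois extension of `k`
      IsBiGaloisExtension k (LiuB.δ n ξ) (LiuB.ρ n ξ) ∧
      -- the comodule categories are monoidally equivalent
      MonoidallyMoritaTakeuchiEquivalent k (LiuL n ξ) (LiuH n ξ) ∧
      -- global dimensions
      (leftGlobalDim (LiuH n ξ) = 1 ∧ rightGlobalDim (LiuH n ξ) = 1) ∧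
      (leftGlobalDim (LiuL n ξ) = ⊤ ∧ rightGlobalDim (LiuL n ξ) = ⊤) ∧
      -- `H` and `L` are noetherian affine PI algebras with the same injective dimension
      (IsNoetherianRing (LiuH n ξ) ∧ IsNoetherianRing (LiuH n ξ)ᵐᵒᵖ ∧
        Algebra.FiniteType k (LiuH n ξ) ∧ IsPIAlgebra k (LiuH n ξ)) ∧
      (IsNoetherianRing (LiuL n ξ) ∧ IsNoetherianRing (LiuL n ξ)ᵐᵒᵖ ∧
        Algebra.FiniteType k (LiuL n ξ) ∧ IsPIAlgebra k (LiuL n ξ)) ∧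
      (∃ d : ℕ, leftInjDim (LiuH n ξ) = d ∧ rightInjDim (LiuH n ξ) = d ∧
        leftInjDim (LiuL n ξ) = d ∧ rightInjDim (LiuL n ξ) = d)) ∧
    -- global dimension is not an invariant of monoidal Morita-Takeuchi equivalence
    ¬ ∀ (A A' : Type u) [Ring A] [Ring A'] [HopfAlgebra k A] [HopfAlgebra k A'],
        Function.Bijective (HopfAlgebra.antipode k : A →ₗ[k] A) →
        Function.Bijective (HopfAlgebra.antipode k : A' →ₗ[k] A') →
        MonoidallyMoritaTakeuchiEquivalent k A A' → leftGlobalDim A = leftGlobalDim A' := by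
  refine ⟨⟨⟨LiuAlg.cop_g 1 1 1, LiuAlg.cop_x 1 1 1, LiuAlg.eps_g 1, LiuAlg.eps_x 1,
        LiuAlg.anti_g 1 1, LiuAlg.anti_x 1 1⟩,
      ⟨LiuAlg.cop_g 0 0 0, LiuAlg.cop_x 0 0 0, LiuAlg.eps_g 0, LiuAlg.eps_x 0,
        LiuAlg.anti_g 0 0, LiuAlg.anti_x 0 0⟩,
      ⟨LiuAlg.anti_bijective 1 1, LiuAlg.anti_bijective 0 0⟩,
      ⟨LiuAlg.cop_g 0 1 1, LiuAlg.cop_x 0 1 1, LiuAlg.cop_g 0 0 1,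
        (LiuAlg.cop_x 0 0 1).trans (add_comm _ _)⟩,
      ⟨LiuAlg.transfer n ξ 1 1 0 1, fun i j hj => LiuAlg.transfer_monomial 1 1 0 1 i hj,
        LiuAlg.isCleaving 0 1⟩,
      LiuAlg.isBiGaloisExtension 0 1,
      LiuAlg.monoidallyMoritaTakeuchiEquivalent 0 1,
      ⟨LiuAlg.leftGlobalDim_liuH n ξ, (leftGlobalDim_eq_of_ringEquiv
        (LiuAlg.opEquiv n ξ 1)).symm.trans (LiuAlg.leftGlobalDim_liuH n ξ)⟩,
      ⟨LiuAlg.leftGlobalDim_liuL n ξ, (leftGlobalDim_eq_of_ringEquiv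
        (LiuAlg.opEquiv n ξ 0)).symm.trans (LiuAlg.leftGlobalDim_liuL n ξ)⟩,
      ⟨LiuAlg.isNoetherianRing 1 1, LiuAlg.isNoetherianRing_op 1, LiuAlg.finiteType 1 1,
        LiuAlg.isPIAlgebra 1 1⟩,
      ⟨LiuAlg.isNoetherianRing 0 0, LiuAlg.isNoetherianRing_op 0, LiuAlg.finiteType 0 0,
        LiuAlg.isPIAlgebra 0 0⟩,
      1, LiuAlg.leftInjDim_eq_one 1, LiuAlg.rightInjDim_eq_one 1, LiuAlg.leftInjDim_eq_one 0,
        LiuAlg.rightInjDim_eq_one 0⟩, fun h => ?_⟩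
  have h1 := h (LiuL n ξ) (LiuH n ξ) (LiuAlg.anti_bijective 0 0) (LiuAlg.anti_bijective 1 1)
    (LiuAlg.monoidallyMoritaTakeuchiEquivalent 0 1)
  rw [LiuAlg.leftGlobalDim_liuL, LiuAlg.leftGlobalDim_liuH] at h1
  exact absurd h1 (by decide)
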